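/- Points $z\neq 0$ are taken on the Riemann surface of the logarithm, i.e. $z=|z|e^{i\arg z}$ with $\arg z\in\mathbb R$, and $z^{s}=\exp(s(\log|z|+i\arg z))$. Let $J_\nu$, $Y_\nu$, $K_\nu$ be the Bessel functions, $J_\nu',Y_\nu',K_\nu'$ their derivatives in $z$, and $\omega=z-\frac{\pi}{2}\nu-\frac{\pi}{4}$. Put $b_0(\nu)=1$ and, for $n\ge 1$, \[ b_n(\nu)=\frac{(4\nu^2-1^2)(4\nu^2-3^2)\cdots(4\nu^2-(2n-3)^2)\,(4\nu^2+4n^2-1)}{8^n\,n!} \] (empty products are $1$). Define the basic terminants by $\Lambda_p(w)=w^pe^w\Gamma(1-p,w)$, with $\Gamma(a,w)$ the incomplete gamma function, and $\Pi_p(w)=\frac12\big(\Lambda_p(we^{\pi i/2})+\Lambda_p(we^{-\pi i/2})\big)$. For $N,M\ge0$ the remainders $R^{(K')}_N$ and $R^{(J')}_N$ are defined by \[ K_\nu'(z)=-\Big(\frac{\pi}{2z}\Big)^{1/2}e^{-z}\Big(\sum_{n=0}^{N-1}\frac{b_n(\nu)}{z^n}+R^{(K')}_N(z,\nu)\Big)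 \] and by requiring, simultaneously, \[ J_\nu'(z)=-\Big(\frac{2}{\pi z}\Big)^{1/2}\Big(\sin\omega\Big(\sum_{n=0}^{N-1}(-1)^n\frac{b_{2n}(\nu)}{z^{2n}}+R^{(J')}_{2N}(z,\nu)\Big)+\cos\omega\Big(\sum_{m=0}^{M-1}(-1)^m\frac{b_{2m+1}(\nu)}{z^{2m+1}}-R^{(J')}_{2M+1}(z,\nu)\Big)\Big), \] \[ Y_\nu'(z)=\Big(\frac{2}{\pi z}\Big)^{1/2}\Big(\cos\omega\Big(\sum_{n=0}^{N-1}(-1)^n\frac{b_{2n}(\nu)}{z^{2n}}+R^{(J')}_{2N}(z,\nu)\Big)-\sin\omega\Big(\sum_{m=0}^{M-1}(-1)^m\frac{b_{2m+1}(\nu)}{z^{2m+1}}-R^{(J')}_{2M+1}(z,\nu)\Big)\Big). \] For $M<N$ the re-expansion remainders are defined by \[ R_N^{(K')}(z,\nu)=(-1)^{N+1}\frac{\cos(\pi\nu)}{2^N\pi}\frac1{z^N}\sum_{m=0}^{M-1}2^mb_m(\nu)\Gamma(N-m)\Lambda_{N-m}(2z)+R^{(K')}_{N,M}(z,\nu),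 \] \[ R_N^{(J')}(z,\nu)=(-1)^{\lfloor N/2\rfloor+1}\frac{\cos(\pi\nu)}{2^N\pi}\frac1{z^N}\sum_{m=0}^{M-1}2^mb_m(\nu)\Gamma(N-m)\Pi_{N-m}(2z)+R^{(J')}_{N,M}(z,\nu). \] \textbf{Theorem.} Let $N$ and $M$ be positive integers with $M<N$, and let $\nu$ be a complex number with $|\Re\nu|<M-\frac12$. Then \[ \big|R^{(K')}_{N,M}(z,\nu)\big|\le\frac{|\cos(\pi\nu)|}{2^N\pi}\frac{1}{|z|^N}2^M|z|^M\big|R_M^{(K')}(|z|,\nu)\big|\,\Gamma(N-M)\,|\Lambda_{N-M}(2z)|+\frac{|\cos(\pi\nu)|}{2^N\pi}\frac{1}{|z|^N}2^M\frac{|\cos(\pi\nu)|}{|\cos(\pi\Re\nu)|}\,|b_M(\Re\nu)|\,\Gamma(N-M) \] for $|\arg z|\le\pi$, and \[ \big|R^{(J')}_{N,M}(z,\nu)\big|\le\frac{|\cos(\pi\nu)|}{2^N\pi}\frac{1}{|z|^N}2^M|z|^M\big|R_M^{(K')}(|z|,\nu)\big|\,\Gamma(N-M)\,|\Pi_{N-M}(2z)|+\frac{|\cos(\pi\nu)|}{2^N\pi}\frac{1}{|z|^N}2^M\frac{|\cos(\pi\nu)|}{|\cos(\pi\Re\nu)|}\,|b_M(\Re\nu)|\,\Gamma(N-M)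 \] for $|\arg z|\le\frac{\pi}{2}$. If $2\Re\nu$ is an odd integer, $|b_M(\Re\nu)|/|\cos(\pi\Re\nu)|$ is replaced by its limiting value $\lim_{x\to\Re\nu}|b_M(x)|/|\cos(\pi x)|$. -/

import Mathlib

open Filter Topology MeasureTheory

noncomputable section

namespace BesselRemainder

/-! All functions below live on the Riemann surface of the logarithm: the point `z ≠ 0` with
modulus `|z|` and argument `arg z ∈ ℝ` is given by its logarithm `ζ = log |z| + i arg z ∈ ℂ`,
so that `z = exp ζ`, `|z| = exp ζ.re`, `arg z = ζ.im`. A power `z ^ s` is `exp (s * ζ)`,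
the point `z * exp (± i π / 2)` is `ζ ± i π / 2`, the point `2 * z` is `ζ + log 2`, and the
point `|z|` (of argument zero) is `ζ.re`. -/

/-- The Bessel function `J_ν(z) = ∑ (-1)^k (z/2)^(2k+ν) / (k! Γ(k+ν+1))` at `z = exp ζ`
(`1 / Γ` vanishes at the poles of `Γ`, which agrees with the value of `(Complex.Gamma s)⁻¹`). -/
def besselJ (ν ζ : ℂ) : ℂ :=
  ∑' k : ℕ, (-1) ^ k * Complex.exp ((2 * k + ν) * (ζ - Real.log 2)) *
    ((k.factorial : ℂ) * Complex.Gamma (k + ν + 1))⁻¹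

/-- The modified Bessel function `I_ν(z) = ∑ (z/2)^(2k+ν) / (k! Γ(k+ν+1))` at `z = exp ζ`. -/
def besselI (ν ζ : ℂ) : ℂ :=
  ∑' k : ℕ, Complex.exp ((2 * k + ν) * (ζ - Real.log 2)) *
    ((k.factorial : ℂ) * Complex.Gamma (k + ν + 1))⁻¹

/-- The Bessel function `Y_ν(z) = (J_ν(z) cos(νπ) - J_{-ν}(z)) / sin(νπ)` at `z = exp ζ`,
with the limiting value in the order when `ν` is an integer. -/
def besselY (ν ζ : ℂ) : ℂ :=
  let f : ℂ → ℂ := fun μ =>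
    (besselJ μ ζ * Complex.cos (Real.pi * μ) - besselJ (-μ) ζ) / Complex.sin (Real.pi * μ)
  open Classical in
  if Complex.sin (Real.pi * ν) = 0 then limUnder (𝓝[≠] ν) f else f ν

/-- The modified Bessel function `K_ν(z) = (π / 2) (I_{-ν}(z) - I_ν(z)) / sin(νπ)` at
`z = exp ζ`, with the limiting value in the order when `ν` is an integer. -/
def besselK (ν ζ : ℂ) : ℂ :=
  let f : ℂ → ℂ := fun μ =>
    (Real.pi / 2 : ℂ) * (besselI (-μ) ζ - besselI μ ζ) / Complex.sin (Real.pi * μ)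
  open Classical in
  if Complex.sin (Real.pi * ν) = 0 then limUnder (𝓝[≠] ν) f else f ν

/-- The derivative with respect to `z = exp ζ` of a function given in the variable `ζ`. -/
def zDeriv (f : ℂ → ℂ) (ζ : ℂ) : ℂ := Complex.exp (-ζ) * deriv f ζ

/-- The derivative `J'_ν(z)`. -/
def besselJ' (ν ζ : ℂ) : ℂ := zDeriv (besselJ ν) ζ

/-- The derivative `Y'_ν(z)`. -/
def besselY' (ν ζ : ℂ) : ℂ := zDeriv (besselY ν) ζ

/-- The derivative `K'_ν(z)`. -/
def besselK' (ν ζ : ℂ) : ℂ := zDeriv (besselK ν) ζ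

/-- The coefficients `b_n(ν)`: `b_0(ν) = 1` and, for `n ≥ 1`,
`b_n(ν) = (4ν² - 1²)(4ν² - 3²)⋯(4ν² - (2n-3)²) (4ν² + 4n² - 1) / (8^n n!)`. -/
def bCoeff : ℕ → ℂ → ℂ
  | 0, _ => 1
  | n + 1, ν =>
    (∏ k ∈ Finset.range n, (4 * ν ^ 2 - (2 * (k : ℂ) + 1) ^ 2)) *
      (4 * ν ^ 2 + 4 * ((n : ℂ) + 1) ^ 2 - 1) / (8 ^ (n + 1) * ((n + 1).factorial : ℂ))

/-- `|b_M(x)| / |cos(πx)|` for real `x`, with the limiting value where `cos(πx) = 0`. -/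
def bCosRatio (M : ℕ) (x : ℝ) : ℝ :=
  let f : ℝ → ℝ := fun y => ‖bCoeff M (y : ℂ)‖ / |Real.cos (Real.pi * y)|
  open Classical in
  if Real.cos (Real.pi * x) = 0 then limUnder (𝓝[≠] x) f else f x

/-- The incomplete gamma function `Γ(a, w) = ∫_w^∞ t^(a-1) e^(-t) dt` at `w = exp η`: the
integral along the path on the Riemann surface of the logarithm which first follows the circular
arc from `w` to `|w|` and then the ray from `|w|` to `+∞`. -/
def incGamma (a η : ℂ) : ℂ :=
  (∫ t in Set.Ioi (Real.exp η.re), (t : ℂ) ^ (a - 1) * Complex.exp (-(t : ℂ))) -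
    Complex.I * ∫ φ in (0 : ℝ)..η.im,
      Complex.exp (a * (η.re + φ * Complex.I)) *
        Complex.exp (-Complex.exp (η.re + φ * Complex.I))

/-- The basic terminant `Λ_p(w) = w^p e^w Γ(1 - p, w)` at `w = exp η`. -/
def terminantL (p η : ℂ) : ℂ :=
  Complex.exp (p * η) * Complex.exp (Complex.exp η) * incGamma (1 - p) η

/-- The basic terminant `Π_p(w) = (Λ_p(w e^{πi/2}) + Λ_p(w e^{-πi/2})) / 2` at `w = exp η`. -/
def terminantP (p η : ℂ) : ℂ :=
  (terminantL p (η + Real.pi / 2 * Complex.I) + terminantL p (η - Real.pi / 2 * Complex.I)) / 2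

/-- The prefactor `(π / (2z))^(1/2) e^(-z)`. -/
def prefK (ζ : ℂ) : ℂ :=
  (Real.sqrt (Real.pi / 2) : ℂ) * Complex.exp (-ζ / 2) * Complex.exp (-Complex.exp ζ)

/-- The prefactor `(2 / (πz))^(1/2)`. -/
def prefJ (ζ : ℂ) : ℂ := (Real.sqrt (2 / Real.pi) : ℂ) * Complex.exp (-ζ / 2)

/-- The phase `ω = z - πν/2 - π/4`. -/
def phase (ν ζ : ℂ) : ℂ := Complex.exp ζ - Real.pi / 2 * ν - Real.pi / 4

/-- The remainder `R_N^{(K')}(z, ν)`, defined by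
`K'_ν(z) = -(π/(2z))^(1/2) e^(-z) (∑_{n<N} b_n(ν)/z^n + R_N^{(K')}(z, ν))`. -/
def remK' (N : ℕ) (ζ ν : ℂ) : ℂ :=
  -besselK' ν ζ / prefK ζ - ∑ n ∈ Finset.range N, bCoeff n ν / Complex.exp ζ ^ n

/-- The sum `∑_{n<N} (-1)^n b_{2n}(ν)/z^{2n}`. -/
def evenSum (N : ℕ) (ζ ν : ℂ) : ℂ :=
  ∑ n ∈ Finset.range N, (-1) ^ n * bCoeff (2 * n) ν / Complex.exp ζ ^ (2 * n)

/-- The sum `∑_{m<M} (-1)^m b_{2m+1}(ν)/z^{2m+1}`. -/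
def oddSum (M : ℕ) (ζ ν : ℂ) : ℂ :=
  ∑ m ∈ Finset.range M, (-1) ^ m * bCoeff (2 * m + 1) ν / Complex.exp ζ ^ (2 * m + 1)

/-- The remainders `R_n^{(J')}(z, ν)`. Together the expansions
`J'_ν = -(2/(πz))^(1/2) (sin ω (evenSum N + R_{2N}) + cos ω (oddSum M - R_{2M+1}))` and
`Y'_ν =  (2/(πz))^(1/2) (cos ω (evenSum N + R_{2N}) - sin ω (oddSum M - R_{2M+1}))`
are a linear system of determinant `sin² ω + cos² ω = 1` for `evenSum N + R_{2N}` and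
`oddSum M - R_{2M+1}`; the definition is its solution, see `remJ'_unique`. -/
def remJ' (n : ℕ) (ζ ν : ℂ) : ℂ :=
  if Even n then
    (-besselJ' ν ζ * Complex.sin (phase ν ζ) + besselY' ν ζ * Complex.cos (phase ν ζ)) / prefJ ζ
      - evenSum (n / 2) ζ ν
  else
    oddSum (n / 2) ζ ν -
      (-besselJ' ν ζ * Complex.cos (phase ν ζ) - besselY' ν ζ * Complex.sin (phase ν ζ)) / prefJ ζ

/-- The re-expansion remainder `R_{N,M}^{(K')}(z, ν)`, defined by
`R_N^{(K')} = (-1)^(N+1) cos(πν)/(2^N π) z^(-N) ∑_{m<M} 2^m b_m(ν) Γ(N-m) Λ_{N-m}(2z)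
+ R_{N,M}^{(K')}`. -/
def reexpK' (N M : ℕ) (ζ ν : ℂ) : ℂ :=
  remK' N ζ ν - (-1) ^ (N + 1) * (Complex.cos (Real.pi * ν) / (2 ^ N * Real.pi)) *
    (1 / Complex.exp ζ ^ N) * ∑ m ∈ Finset.range M,
      2 ^ m * bCoeff m ν * Complex.Gamma ((N : ℂ) - m) *
        terminantL ((N : ℂ) - m) (ζ + Real.log 2)

/-- The re-expansion remainder `R_{N,M}^{(J')}(z, ν)`, defined by
`R_N^{(J')} = (-1)^(⌊N/2⌋+1) cos(πν)/(2^N π) z^(-N) ∑_{m<M} 2^m b_m(ν) Γ(N-m) Π_{N-m}(2z)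
+ R_{N,M}^{(J')}`. -/
def reexpJ' (N M : ℕ) (ζ ν : ℂ) : ℂ :=
  remJ' N ζ ν - (-1) ^ (N / 2 + 1) * (Complex.cos (Real.pi * ν) / (2 ^ N * Real.pi)) *
    (1 / Complex.exp ζ ^ N) * ∑ m ∈ Finset.range M,
      2 ^ m * bCoeff m ν * Complex.Gamma ((N : ℂ) - m) *
        terminantP ((N : ℂ) - m) (ζ + Real.log 2)

theorem prefK_ne_zero (ζ : ℂ) : prefK ζ ≠ 0 := by
  unfold prefK
  have : Real.sqrt (Real.pi / 2) ≠ 0 := (Real.sqrt_pos.2 (by positivity)).ne'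
  simp only [ne_eq, mul_eq_zero, Complex.ofReal_eq_zero, this, Complex.exp_ne_zero, or_self,
    not_false_eq_true]

theorem prefJ_ne_zero (ζ : ℂ) : prefJ ζ ≠ 0 := by
  unfold prefJ
  have : Real.sqrt (2 / Real.pi) ≠ 0 := (Real.sqrt_pos.2 (by positivity)).ne'
  simp only [ne_eq, mul_eq_zero, Complex.ofReal_eq_zero, this, Complex.exp_ne_zero, or_self,
    not_false_eq_true]

/-- The expansion that defines `R_N^{(K')}`. -/
theorem besselK'_eq (N : ℕ) (ζ ν : ℂ) :
    besselK' ν ζ = -prefK ζ *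
      (∑ n ∈ Finset.range N, bCoeff n ν / Complex.exp ζ ^ n + remK' N ζ ν) := by
  have := prefK_ne_zero ζ
  unfold remK'
  field_simp
  ring

/-- The remainders `R_n^{(J')}` are exactly the functions for which the expansions of `J'_ν`
and of `Y'_ν` hold simultaneously. -/
theorem remJ'_unique (N M : ℕ) (ζ ν R₀ R₁ : ℂ) :
    (besselJ' ν ζ = -prefJ ζ * (Complex.sin (phase ν ζ) * (evenSum N ζ ν + R₀) +
        Complex.cos (phase ν ζ) * (oddSum M ζ ν - R₁)) ∧
      besselY' ν ζ = prefJ ζ * (Complex.cos (phase ν ζ) * (evenSum N ζ ν + R₀) -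
        Complex.sin (phase ν ζ) * (oddSum M ζ ν - R₁))) ↔
    R₀ = remJ' (2 * N) ζ ν ∧ R₁ = remJ' (2 * M + 1) ζ ν := by
  have hp := prefJ_ne_zero ζ
  have hsc := Complex.sin_sq_add_cos_sq (phase ν ζ)
  have h1 : (2 * M + 1) / 2 = M := by omega
  have h2 : ¬ Even (2 * M + 1) := by simp
  have h3 : 2 * N / 2 = N := by omega
  simp only [remJ', h1, h2, h3, even_two, Even.mul_right, if_true, if_false]
  generalize besselJ' ν ζ = j
  generalize besselY' ν ζ = y
  generalize Complex.sin (phase ν ζ) = s at *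
  generalize Complex.cos (phase ν ζ) = c at *
  generalize evenSum N ζ ν = e
  generalize oddSum M ζ ν = o
  generalize prefJ ζ = p at *
  constructor
  · rintro ⟨rfl, rfl⟩
    constructor
    · field_simp
      linear_combination (-(e + R₀)) * hsc
    · field_simp
      linear_combination (o - R₁) * hsc
  · rintro ⟨rfl, rfl⟩
    constructor
    · field_simp
      linear_combination (-j) * hsc
    · field_simp
      linear_combination (-y) * hsc

end BesselRemainder

end

/-!
Why the bounds hold. Write `t = e^τ`. For `|Re ν| < N - 1/2` and `|arg z| < π` the remainder has
the representation
`R_N^{(K')}(z, ν) = (-1)^(N+1) (cos(πν)/π) (2/π)^(1/2) z^(-N)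
  ∫₀^∞ e^(-t) t^(N-1/2) κ(t)/(1 + t/z) dt`
with `κ = -K'_ν = (K_{ν+1} + K_{ν-1})/2` (`remK'_eq`). Under the integral sign, `κ(t)` is replaced
by its own expansion with `M` terms and remainder. The terms give the basic terminants, since
`Γ(p) Λ_p(w) = ∫₀^∞ t^(p-1) e^(-t)/(1 + t/w) dt` (`Gamma_mul_terminantL`), so that (`reexpK'_eq`)
`R_{N,M}^{(K')}(z, ν) = (-1)^(N+1) (cos(πν)/π) z^(-N)
  ∫₀^∞ e^(-2t) t^(N-M-1) · t^M R_M^{(K')}(t, ν) / (1 + t/z) dt`.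
The factor `t^M R_M^{(K')}(t, ν)` is frozen at `t = |z|`, which produces the first term of the
bound. It is itself a Stieltjes transform on the positive axis, and `|1/(1 + s/t) - 1/(1 + s/r)| ≤
|t - r|/r ≤ |1 + t/z|` for `r = |z|`, so the kernel `1/(1 + t/z)` cancels in the error of freezing
(`norm_remK'_sub_le`). What is left is an absolute moment of the density, bounded by the moment at
the order `Re ν`, which is `|b_M(Re ν)|/|cos(π Re ν)|` up to a constant (`bCoeff_eq_integral`,
`bCosRatio_eq`); as a moment it is continuous in the order, which accounts for the limiting value
where the cosine vanishes. The rays `|arg z| = π` follow by continuity (`norm_reexpK'_sub_le`).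

For `J'_ν` and `Y'_ν`, the connection formulas express both through `K'_ν(z e^(±iπ/2))`. Then
`R^{(J')}` and the frozen parts are the same combination, with weights of modulus `1/2`, of the
corresponding quantities for `K'_ν` at `z e^(±iπ/2)` (`exists_weights`), and the bounds average.

The representation of the remainder rests on the expansion of `K_ν` itself. On the positive axis,
`K_ν` is Macdonald's integral `½ ∫ e^(νu - x cosh u) du`. An integration by parts against the
modified Bessel equation shows that the truncated series plus the Stieltjes transform of `e^(-t)
t^(N-1/2) K_ν(t)` solves the equation of `x^(1/2) e^x K_ν(x)` (`hasDerivAt_besselBracketDeriv`);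
both solutions being recessive at `+∞`, they are proportional, and the limits there fix the factor
(`macdonald_eq_besselBracket`). The series definition of `K_ν` agrees with the integral because
both have the same Wronskians with `I_ν` (`sin_mul_macdonald`). The identity theorem carries the
expansion to `|arg z| < π`, continuity in the order to integer orders (`besselK_eq_bracket`), and
the connection formulas for `K_ν(z e^(±iπ))` to `|arg z| < 2π`.
-/

noncomputable section

namespace BesselRemainder

/-! ### The integral of Macdonald for `K_ν` on the positive axis -/

theorem one_add_sq_div_two_le_cosh (u : ℝ) : 1 + u ^ 2 / 2 ≤ Real.cosh u := by
  have h1 : Real.cosh u = 1 + 2 * Real.sinh (u / 2) ^ 2 := by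
    have := Real.cosh_two_mul (u / 2)
    rw [Real.cosh_sq] at this
    rw [mul_div_cancel₀ u two_ne_zero] at this
    linarith
  have h2 : (u / 2) ^ 2 ≤ Real.sinh (u / 2) ^ 2 := by
    apply sq_le_sq.2
    rcases le_total 0 (u / 2) with h | h
    · rw [abs_of_nonneg h]
      exact (Real.self_le_sinh_iff.2 h).trans (le_abs_self _)
    · rw [abs_of_nonpos h]
      exact (neg_le_neg (Real.sinh_le_self_iff.2 h)).trans (neg_le_abs _)
  nlinarith

/-- The integrand `e^{νu - x cosh u}` of the modified Bessel function `K_ν(x)`. -/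
def coshKernel (ν : ℂ) (x u : ℝ) : ℂ := Complex.exp (ν * u - (x * Real.cosh u : ℝ))

theorem continuous_coshKernel (ν : ℂ) (x : ℝ) : Continuous (coshKernel ν x) := by
  unfold coshKernel; fun_prop

theorem norm_coshKernel (ν : ℂ) (x u : ℝ) :
    ‖coshKernel ν x u‖ = Real.exp (ν.re * u - x * Real.cosh u) := by
  simp [coshKernel, Complex.norm_exp]

theorem integrable_coshKernel (ν : ℂ) {x : ℝ} (hx : 0 < x) : Integrable (coshKernel ν x) := by
  have h : Integrable fun u : ℝ => Real.exp (-(x / 2) * u ^ 2 + ν.re * u) := by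
    have := (integrable_cexp_quadratic (b := ((x / 2 : ℝ) : ℂ)) (by simpa using hx)
      (ν.re : ℂ) 0).norm
    refine this.congr (ae_of_all _ fun u => ?_)
    simp only [Complex.norm_exp]
    congr 1
    simp [← Complex.ofReal_pow]
  refine h.mono' (continuous_coshKernel ν x).aestronglyMeasurable (ae_of_all _ fun u => ?_)
  rw [norm_coshKernel, Real.exp_le_exp]
  nlinarith [one_add_sq_div_two_le_cosh u]

theorem cosh_mul_coshKernel (ν : ℂ) (x u : ℝ) :
    (Real.cosh u : ℂ) * coshKernel ν x u =
      (coshKernel (ν + 1) x u + coshKernel (ν - 1) x u) / 2 := by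
  simp only [coshKernel, Real.cosh_eq, Complex.exp_sub, add_mul, sub_mul, Complex.exp_add,
    Complex.ofReal_div, Complex.ofReal_add, Complex.ofReal_exp, Complex.ofReal_neg,
    Complex.exp_neg, one_mul, Complex.ofReal_ofNat]
  field_simp [Complex.exp_ne_zero]

/-- The modified Bessel function `K_ν(e^τ) = ½ ∫_ℝ e^{νu - e^τ cosh u} du`. -/
def macdonald (ν : ℂ) (τ : ℝ) : ℂ := (1 / 2) * ∫ u : ℝ, coshKernel ν (Real.exp τ) u

theorem macdonald_neg (ν : ℂ) (τ : ℝ) : macdonald (-ν) τ = macdonald ν τ := by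
  unfold macdonald
  rw [← integral_neg_eq_self (coshKernel ν (Real.exp τ))]
  simp [coshKernel]

theorem integral_cosh_mul_coshKernel (ν : ℂ) (τ : ℝ) :
    ∫ u : ℝ, (Real.cosh u : ℂ) * coshKernel ν (Real.exp τ) u =
      macdonald (ν + 1) τ + macdonald (ν - 1) τ := by
  simp_rw [cosh_mul_coshKernel, macdonald]
  rw [integral_div, integral_add (integrable_coshKernel _ (Real.exp_pos _))
    (integrable_coshKernel _ (Real.exp_pos _))]
  ring

/-- The three-term recurrence `K_{ν+1}(x) - K_{ν-1}(x) = (2ν/x) K_ν(x)`. -/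
theorem macdonald_recurrence (ν : ℂ) (τ : ℝ) :
    (Real.exp τ : ℂ) * (macdonald (ν + 1) τ - macdonald (ν - 1) τ) = 2 * ν * macdonald ν τ := by
  have hx := Real.exp_pos τ
  set x := Real.exp τ with hxd
  have hd : ∀ u : ℝ, HasDerivAt (coshKernel ν x)
      (ν * coshKernel ν x u - x * ((coshKernel (ν + 1) x u - coshKernel (ν - 1) x u) / 2)) u := by
    intro u
    have h1 : HasDerivAt (fun u : ℝ => ν * u - (x * Real.cosh u : ℝ))
        (ν * 1 - (x * Real.sinh u : ℝ)) u :=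
      ((Complex.ofRealCLM.hasDerivAt (x := u)).const_mul ν).sub
        (((Real.hasDerivAt_cosh u).const_mul x).ofReal_comp)
    have h2 := h1.cexp
    unfold coshKernel at *
    convert! h2 using 1
    simp only [Real.sinh_eq, Complex.exp_sub, add_mul, sub_mul, Complex.exp_add,
      Complex.ofReal_div, Complex.ofReal_sub, Complex.ofReal_exp, Complex.ofReal_neg,
      Complex.exp_neg, one_mul, Complex.ofReal_ofNat, Complex.ofReal_mul]
    field_simp [Complex.exp_ne_zero]
  have i0 := integrable_coshKernel ν hx
  have i1 := integrable_coshKernel (ν + 1) hx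
  have i2 := integrable_coshKernel (ν - 1) hx
  have := integral_eq_zero_of_hasDerivAt_of_integrable hd
    ((i0.const_mul ν).sub (((i1.sub i2).div_const 2).const_mul (x : ℂ))) i0
  rw [integral_sub (i0.const_mul ν) (((show Integrable fun u => coshKernel (ν + 1) x u -
      coshKernel (ν - 1) x u from i1.sub i2).div_const 2).const_mul (x : ℂ)),
    integral_const_mul, integral_const_mul, integral_div, integral_sub i1 i2] at this
  simp only [macdonald, ← hxd]
  linear_combination -this

theorem hasDerivAt_macdonald (ν : ℂ) (τ : ℝ) :
    HasDerivAt (macdonald ν)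
      (-(Real.exp τ / 2) * (macdonald (ν + 1) τ + macdonald (ν - 1) τ)) τ := by
  have key := (hasDerivAt_integral_of_dominated_loc_of_deriv_le (𝕜 := ℝ) (μ := volume)
    (F := fun (t : ℝ) (u : ℝ) => coshKernel ν (Real.exp t) u)
    (F' := fun (t : ℝ) (u : ℝ) =>
      -(Real.exp t : ℂ) * ((Real.cosh u : ℂ) * coshKernel ν (Real.exp t) u))
    (bound := fun u => Real.exp (τ + 1) *
      ‖(Real.cosh u : ℂ) * coshKernel ν (Real.exp (τ - 1)) u‖)
    (x₀ := τ) (s := Metric.ball τ 1) (Metric.ball_mem_nhds τ one_pos)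
    (Eventually.of_forall fun t => (continuous_coshKernel ν _).aestronglyMeasurable)
    (integrable_coshKernel ν (Real.exp_pos τ)) ?_ ?_ ?_ ?_).2
  · unfold macdonald
    have h := key.const_mul (1 / 2 : ℂ)
    rw [integral_const_mul, integral_cosh_mul_coshKernel] at h
    convert! h using 1
    simp only [macdonald]
    ring
  · exact (continuous_const.mul ((by fun_prop : Continuous fun u : ℝ => (Real.cosh u : ℂ)).mul
      (continuous_coshKernel ν _))).aestronglyMeasurable
  · refine ae_of_all _ fun u t ht => ?_
    rw [Metric.mem_ball, Real.dist_eq, abs_lt] at ht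
    rw [norm_mul, norm_mul, norm_mul, norm_coshKernel, norm_coshKernel, norm_neg,
      Complex.norm_real, Real.norm_of_nonneg (Real.exp_pos t).le]
    gcongr
    · linarith
    · linarith
  · refine Integrable.const_mul (Integrable.norm ?_) _
    simp_rw [cosh_mul_coshKernel]
    exact ((integrable_coshKernel _ (Real.exp_pos _)).add
      (integrable_coshKernel _ (Real.exp_pos _))).div_const 2
  · refine ae_of_all _ fun u t _ => ?_
    have h1 : HasDerivAt (fun t : ℝ => ν * u - (Real.exp t * Real.cosh u : ℝ))
        (-(Real.exp t * Real.cosh u : ℝ)) t :=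
      (((Real.hasDerivAt_exp t).mul_const (Real.cosh u)).ofReal_comp).const_sub _
    have h2 := h1.cexp
    convert! h2 using 1
    simp only [coshKernel, Complex.ofReal_mul]
    ring

theorem hasDerivAt_macdonald' (ν : ℂ) (τ : ℝ) :
    HasDerivAt (macdonald ν) (ν * macdonald ν τ - Real.exp τ * macdonald (ν + 1) τ) τ := by
  convert! hasDerivAt_macdonald ν τ using 1
  linear_combination -(1 / 2 : ℂ) * macdonald_recurrence ν τ

theorem hasDerivAt_macdonald_succ (ν : ℂ) (τ : ℝ) :
    HasDerivAt (macdonald (ν + 1))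
      (-(ν + 1) * macdonald (ν + 1) τ - Real.exp τ * macdonald ν τ) τ := by
  convert! hasDerivAt_macdonald (ν + 1) τ using 1
  have := macdonald_recurrence (ν + 1) τ
  rw [add_sub_cancel_right] at this ⊢
  linear_combination (1 / 2 : ℂ) * this

/-- `K_σ(e^τ)` as a real number, for real order `σ`. -/
def macdonaldReal (σ τ : ℝ) : ℝ :=
  (1 / 2) * ∫ u : ℝ, Real.exp (σ * u - Real.exp τ * Real.cosh u)

theorem ofReal_macdonaldReal (σ τ : ℝ) : (macdonaldReal σ τ : ℂ) = macdonald σ τ := by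
  unfold macdonaldReal macdonald coshKernel
  push_cast
  rw [← integral_complex_ofReal]
  push_cast
  rfl

theorem integrable_macdonaldReal (σ τ : ℝ) :
    Integrable fun u : ℝ => Real.exp (σ * u - Real.exp τ * Real.cosh u) := by
  have := (integrable_coshKernel σ (Real.exp_pos τ)).norm
  simpa only [norm_coshKernel, Complex.ofReal_re] using this

theorem norm_macdonald_le (ν : ℂ) (τ : ℝ) : ‖macdonald ν τ‖ ≤ macdonaldReal ν.re τ := by
  unfold macdonald macdonaldReal
  rw [norm_mul]
  have : ‖(1 / 2 : ℂ)‖ = 1 / 2 := by norm_num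
  rw [this]
  gcongr
  refine (norm_integral_le_integral_norm _).trans_eq ?_
  simp_rw [norm_coshKernel]

theorem macdonaldReal_nonneg (σ τ : ℝ) : 0 ≤ macdonaldReal σ τ := by
  unfold macdonaldReal; positivity

theorem exp_mul_le_add {σ s : ℝ} (h : |σ| ≤ s) (u : ℝ) :
    Real.exp (σ * u) ≤ Real.exp (s * u) + Real.exp (-s * u) := by
  have := abs_le.1 h
  rcases le_total 0 u with hu | hu
  · have : Real.exp (σ * u) ≤ Real.exp (s * u) := by gcongr; linarith
    linarith [Real.exp_pos (-s * u)]
  · have : Real.exp (σ * u) ≤ Real.exp (-s * u) := Real.exp_le_exp.2 (by nlinarith)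
    linarith [Real.exp_pos (s * u)]

theorem macdonaldReal_neg (σ τ : ℝ) : macdonaldReal (-σ) τ = macdonaldReal σ τ := by
  have := macdonald_neg σ τ
  rw [← Complex.ofReal_neg, ← ofReal_macdonaldReal, ← ofReal_macdonaldReal] at this
  exact_mod_cast this

theorem macdonaldReal_le {σ s : ℝ} (h : |σ| ≤ s) (τ : ℝ) :
    macdonaldReal σ τ ≤ 2 * macdonaldReal s τ := by
  have h1 : macdonaldReal σ τ ≤ macdonaldReal s τ + macdonaldReal (-s) τ := by
    unfold macdonaldReal
    rw [← mul_add, ← integral_add (integrable_macdonaldReal _ _) (integrable_macdonaldReal _ _)]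
    refine mul_le_mul_of_nonneg_left ?_ (by norm_num)
    refine integral_mono (integrable_macdonaldReal _ _)
      ((integrable_macdonaldReal _ _).fun_add (integrable_macdonaldReal _ _)) fun u => ?_
    simp only [sub_eq_add_neg, Real.exp_add]
    rw [← add_mul]
    gcongr
    exact exp_mul_le_add h u
  rw [macdonaldReal_neg] at h1
  linarith

theorem continuous_macdonald_order (τ : ℝ) : Continuous fun ν => macdonald ν τ := by
  refine continuous_iff_continuousAt.2 fun ν => ?_
  refine ContinuousAt.mul continuousAt_const ?_
  refine continuousAt_of_dominated (bound := fun u =>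
      Real.exp ((|ν.re| + 1) * u - Real.exp τ * Real.cosh u) +
        Real.exp (-(|ν.re| + 1) * u - Real.exp τ * Real.cosh u))
    (Eventually.of_forall fun μ => (continuous_coshKernel μ _).aestronglyMeasurable) ?_
    ((integrable_macdonaldReal _ _).add (integrable_macdonaldReal _ _))
    (ae_of_all _ fun u => ?_)
  · have : ∀ᶠ μ in 𝓝 ν, |μ.re| < |ν.re| + 1 :=
      (by fun_prop : Continuous fun μ : ℂ => |μ.re|).continuousAt.eventually_lt
        continuousAt_const (by simp)
    filter_upwards [this] with μ hμ
    refine ae_of_all _ fun u => ?_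
    rw [norm_coshKernel]
    simp only [sub_eq_add_neg, Real.exp_add]
    rw [← add_mul]
    gcongr
    exact exp_mul_le_add hμ.le u
  · unfold coshKernel
    fun_prop

/-! ### Gamma and Beta integrals, moments and limits of `K_ν` -/

theorem exp_smul_gammaIntegrand (a : ℂ) (τ : ℝ) :
    |Real.exp τ| • ((Real.exp (-Real.exp τ) : ℂ) * (Real.exp τ : ℂ) ^ (a - 1)) =
      Complex.exp (a * τ - Real.exp τ) := by
  have h0 : (Real.exp τ : ℂ) ≠ 0 := by exact_mod_cast (Real.exp_pos τ).ne'
  rw [abs_of_pos (Real.exp_pos τ), Complex.real_smul, Complex.cpow_def_of_ne_zero h0,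
    ← Complex.ofReal_log (Real.exp_pos τ).le, Real.log_exp, Complex.ofReal_exp,
    Complex.ofReal_exp, Complex.ofReal_neg, ← Complex.exp_add, ← Complex.exp_add]
  congr 1
  push_cast
  ring

/-- Euler's integral for `Γ` in the logarithmic variable. -/
theorem integrable_gammaKernel {a : ℂ} (ha : 0 < a.re) :
    Integrable fun τ : ℝ => Complex.exp (a * τ - Real.exp τ) := by
  have h := Complex.GammaIntegral_convergent ha
  rw [← Real.range_exp, ← Set.image_univ,
    integrableOn_image_iff_integrableOn_abs_deriv_smul MeasurableSet.univ
      (fun x _ => (Real.hasDerivAt_exp x).hasDerivWithinAt) Real.exp_injective.injOn,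
    integrableOn_univ] at h
  simpa only [exp_smul_gammaIntegrand] using h

theorem integral_gammaKernel {a : ℂ} (ha : 0 < a.re) :
    ∫ τ : ℝ, Complex.exp (a * τ - Real.exp τ) = Complex.Gamma a := by
  rw [Complex.Gamma_eq_integral ha, Complex.GammaIntegral, ← Real.range_exp, ← Set.image_univ,
    integral_image_eq_integral_abs_deriv_smul MeasurableSet.univ
      (fun x _ => (Real.hasDerivAt_exp x).hasDerivWithinAt) Real.exp_injective.injOn,
    setIntegral_univ]
  simp only [exp_smul_gammaIntegrand]

theorem gammaKernel_scaled (a : ℂ) {c : ℝ} (hc : 0 < c) (τ : ℝ) :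
    Complex.exp (a * τ - (c * Real.exp τ : ℝ)) = Complex.exp (-a * Real.log c) *
      Complex.exp (a * (τ + Real.log c : ℝ) - Real.exp (τ + Real.log c)) := by
  rw [← Complex.exp_add, Real.exp_add, Real.exp_log hc]
  congr 1
  push_cast
  ring

theorem integrable_gammaKernel_scaled {a : ℂ} (ha : 0 < a.re) {c : ℝ} (hc : 0 < c) :
    Integrable fun τ : ℝ => Complex.exp (a * τ - (c * Real.exp τ : ℝ)) := by
  simp_rw [gammaKernel_scaled a hc]
  exact ((integrable_gammaKernel ha).comp_add_right (Real.log c)).const_mul _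

theorem integral_gammaKernel_scaled {a : ℂ} (ha : 0 < a.re) {c : ℝ} (hc : 0 < c) :
    ∫ τ : ℝ, Complex.exp (a * τ - (c * Real.exp τ : ℝ)) =
      Complex.exp (-a * Real.log c) * Complex.Gamma a := by
  simp_rw [gammaKernel_scaled a hc]
  rw [integral_const_mul, integral_add_right_eq_self
    (fun τ : ℝ => Complex.exp (a * τ - Real.exp τ)), integral_gammaKernel ha]

/-- The double integral behind Euler's Beta integral: the shear `(τ, u) ↦ (τ, τ + u)` turns it into
a product of two Gamma integrals. -/
theorem integrable_betaKernel_prod {a b : ℂ} (ha : 0 < a.re) (hb : 0 < b.re) :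
    Integrable (fun z : ℝ × ℝ => Complex.exp ((a + b) * z.1 + a * z.2 -
      ((1 + Real.exp z.2) * Real.exp z.1 : ℝ))) (volume.prod volume) := by
  have h := (integrable_gammaKernel hb).mul_prod (integrable_gammaKernel ha)
  have h2 := (measurePreserving_prod_add (volume : Measure ℝ) (volume : Measure ℝ)).integrable_comp
    h.aestronglyMeasurable
  refine (h2.2 h).congr (ae_of_all _ fun z => ?_)
  simp only [Function.comp]
  rw [← Complex.exp_add]
  congr 1
  rw [Real.exp_add]
  push_cast
  ring

theorem integral_betaKernel_prod {a b : ℂ} (ha : 0 < a.re) (hb : 0 < b.re) :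
    ∫ z : ℝ × ℝ, Complex.exp ((a + b) * z.1 + a * z.2 -
      ((1 + Real.exp z.2) * Real.exp z.1 : ℝ)) ∂(volume.prod volume) =
      Complex.Gamma b * Complex.Gamma a := by
  rw [← integral_gammaKernel hb, ← integral_gammaKernel ha, ← integral_prod_mul]
  have h2 := (measurePreserving_prod_add (volume : Measure ℝ)
    (volume : Measure ℝ)).integral_comp (MeasurableEquiv.shearAddRight ℝ).measurableEmbedding
    (fun z : ℝ × ℝ => Complex.exp (b * z.1 - Real.exp z.1) * Complex.exp (a * z.2 - Real.exp z.2))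
  rw [← h2]
  congr 1
  ext z
  simp only
  rw [← Complex.exp_add]
  congr 1
  rw [Real.exp_add]
  push_cast
  ring

theorem integral_betaKernel_inner {a b : ℂ} (ha : 0 < a.re) (hb : 0 < b.re) (u : ℝ) :
    ∫ τ : ℝ, Complex.exp ((a + b) * τ + a * u - ((1 + Real.exp u) * Real.exp τ : ℝ)) =
      Complex.Gamma (a + b) * Complex.exp (a * u - (a + b) * Real.log (1 + Real.exp u)) := by
  have hc : 0 < 1 + Real.exp u := by positivity
  have : ∀ τ : ℝ, Complex.exp ((a + b) * τ + a * u - ((1 + Real.exp u) * Real.exp τ : ℝ)) =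
      Complex.exp (a * u) * Complex.exp ((a + b) * τ - ((1 + Real.exp u) * Real.exp τ : ℝ)) := by
    intro τ
    rw [← Complex.exp_add]
    congr 1
    ring
  simp_rw [this]
  rw [integral_const_mul, integral_gammaKernel_scaled (by simpa using add_pos ha hb) hc,
    mul_left_comm, ← mul_assoc, mul_comm, ← Complex.exp_add]
  congr 2
  ring

/-- Euler's Beta integral `∫_ℝ e^{au} (1 + e^u)^{-(a+b)} du` converges. -/
theorem integrable_betaKernel {a b : ℂ} (ha : 0 < a.re) (hb : 0 < b.re) :
    Integrable fun u : ℝ => Complex.exp (a * u - (a + b) * Real.log (1 + Real.exp u)) := by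
  have h := (integrable_betaKernel_prod ha hb).integral_prod_right
  simp only [integral_betaKernel_inner ha hb] at h
  have hne : Complex.Gamma (a + b) ≠ 0 :=
    Complex.Gamma_ne_zero_of_re_pos (by simpa using add_pos ha hb)
  exact (integrable_const_mul_iff (IsUnit.mk0 _ hne) _).1 h

theorem integral_betaKernel {a b : ℂ} (ha : 0 < a.re) (hb : 0 < b.re) :
    ∫ u : ℝ, Complex.exp (a * u - (a + b) * Real.log (1 + Real.exp u)) =
      Complex.Gamma a * Complex.Gamma b / Complex.Gamma (a + b) := by
  have hne : Complex.Gamma (a + b) ≠ 0 :=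
    Complex.Gamma_ne_zero_of_re_pos (by simpa using add_pos ha hb)
  rw [eq_div_iff hne, mul_comm, ← integral_const_mul]
  simp_rw [← integral_betaKernel_inner ha hb]
  rw [← integral_prod_symm _ (integrable_betaKernel_prod ha hb), integral_betaKernel_prod ha hb,
    mul_comm]

theorem one_add_cosh_eq (u : ℝ) :
    Real.log (1 + Real.cosh u) = 2 * Real.log (1 + Real.exp u) - u - Real.log 2 := by
  have h : 1 + Real.cosh u = (1 + Real.exp u) ^ 2 * Real.exp (-u) / 2 := by
    rw [Real.cosh_eq, Real.exp_neg]
    field_simp [(Real.exp_pos u).ne']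
    ring
  have hc : 0 < 1 + Real.exp u := by positivity
  rw [h, Real.log_div (by positivity) two_ne_zero, Real.log_mul (by positivity) (by positivity),
    Real.log_exp, Real.log_pow]
  push_cast
  ring

/-- The weight `e^{νu} (1 + cosh u)^{-μ}` written as a Beta kernel. -/
theorem coshWeight_eq (μ ν : ℂ) (u : ℝ) :
    Complex.exp (ν * u - μ * Real.log (1 + Real.cosh u)) = Complex.exp (μ * Real.log 2) *
      Complex.exp ((μ + ν) * u - ((μ + ν) + (μ - ν)) * Real.log (1 + Real.exp u)) := by
  rw [← Complex.exp_add, one_add_cosh_eq]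
  congr 1
  push_cast
  ring

theorem re_add_pos_of_abs_lt {μ ν : ℂ} (h : |ν.re| < μ.re) : 0 < (μ + ν).re := by
  have := abs_lt.1 h
  rw [Complex.add_re]; linarith

theorem re_sub_pos_of_abs_lt {μ ν : ℂ} (h : |ν.re| < μ.re) : 0 < (μ - ν).re := by
  have := abs_lt.1 h
  rw [Complex.sub_re]; linarith

theorem re_pos_of_abs_lt {μ ν : ℂ} (h : |ν.re| < μ.re) : 0 < μ.re :=
  (abs_nonneg _).trans_lt h

theorem momentKernel_eq (μ ν : ℂ) (τ u : ℝ) :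
    Complex.exp (μ * τ - Real.exp τ) * coshKernel ν (Real.exp τ) u =
      Complex.exp (ν * u) * Complex.exp (μ * τ - ((1 + Real.cosh u) * Real.exp τ : ℝ)) := by
  unfold coshKernel
  rw [← Complex.exp_add, ← Complex.exp_add]
  congr 1
  push_cast
  ring

theorem integral_momentKernel_inner {μ : ℂ} (hμ : 0 < μ.re) (ν : ℂ) (u : ℝ) :
    ∫ τ : ℝ, Complex.exp (μ * τ - Real.exp τ) * coshKernel ν (Real.exp τ) u =
      Complex.Gamma μ * Complex.exp (ν * u - μ * Real.log (1 + Real.cosh u)) := by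
  have hc : 0 < 1 + Real.cosh u := by positivity
  simp_rw [momentKernel_eq]
  rw [integral_const_mul, integral_gammaKernel_scaled hμ hc, mul_left_comm, ← mul_assoc, mul_comm,
    ← Complex.exp_add]
  congr 2
  ring

theorem integrable_coshWeight {μ ν : ℂ} (h : |ν.re| < μ.re) :
    Integrable fun u : ℝ => Complex.exp (ν * u - μ * Real.log (1 + Real.cosh u)) := by
  simp_rw [coshWeight_eq]
  exact (integrable_betaKernel (re_add_pos_of_abs_lt h) (re_sub_pos_of_abs_lt h)).const_mul _

theorem integrable_momentKernel {μ ν : ℂ} (h : |ν.re| < μ.re) :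
    Integrable (fun z : ℝ × ℝ => Complex.exp (μ * z.1 - Real.exp z.1) *
      coshKernel ν (Real.exp z.1) z.2) (volume.prod volume) := by
  have hμ := re_pos_of_abs_lt h
  have hm : Continuous (fun z : ℝ × ℝ => Complex.exp (μ * z.1 - Real.exp z.1) *
      coshKernel ν (Real.exp z.1) z.2) := by
    unfold coshKernel
    fun_prop
  refine (integrable_prod_iff' hm.aestronglyMeasurable).2 ⟨ae_of_all _ fun u => ?_, ?_⟩
  · simp_rw [momentKernel_eq]
    exact (integrable_gammaKernel_scaled hμ (by positivity)).const_mul _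
  · have key : ∀ u : ℝ, ∫ τ : ℝ, ‖Complex.exp (μ * τ - Real.exp τ) *
        coshKernel ν (Real.exp τ) u‖ =
        ‖Complex.Gamma μ.re * Complex.exp ((ν.re : ℂ) * u -
          (μ.re : ℂ) * Real.log (1 + Real.cosh u))‖ := by
      intro u
      rw [← integral_momentKernel_inner (by simpa using hμ)]
      have hr : ∀ τ : ℝ, Complex.exp ((μ.re : ℂ) * τ - Real.exp τ) *
          coshKernel (ν.re : ℂ) (Real.exp τ) u = (‖Complex.exp (μ * τ - Real.exp τ) *
        coshKernel ν (Real.exp τ) u‖ : ℝ) := by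
        intro τ
        rw [norm_mul, norm_coshKernel, Complex.norm_exp, coshKernel]
        push_cast
        congr 2
        simp [← Complex.ofReal_exp]
      simp_rw [hr]
      rw [integral_complex_ofReal, Complex.norm_real, Real.norm_of_nonneg]
      positivity
    simp_rw [key]
    exact ((integrable_coshWeight (by simpa using h)).const_mul _).norm

/-- The moments of `e^{-x} K_ν(x)` converge absolutely for `|Re ν| < Re μ`. -/
theorem integrable_moment {μ ν : ℂ} (h : |ν.re| < μ.re) :
    Integrable fun τ : ℝ => Complex.exp (μ * τ - Real.exp τ) * macdonald ν τ := by
  have := ((integrable_momentKernel h).integral_prod_left).const_mul (1 / 2 : ℂ)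
  refine this.congr (ae_of_all _ fun τ => ?_)
  simp only [integral_const_mul, macdonald]
  ring

/-- The moments `∫₀^∞ x^{μ-1} e^{-x} K_ν(x) dx`. -/
theorem integral_moment {μ ν : ℂ} (h : |ν.re| < μ.re) :
    ∫ τ : ℝ, Complex.exp (μ * τ - Real.exp τ) * macdonald ν τ =
      (1 / 2) * Complex.exp (μ * Real.log 2) * Complex.Gamma μ *
        (Complex.Gamma (μ + ν) * Complex.Gamma (μ - ν)) / Complex.Gamma (2 * μ) := by
  have h1 : ∀ τ : ℝ, Complex.exp (μ * τ - Real.exp τ) * macdonald ν τ =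
      (1 / 2) * ∫ u : ℝ, Complex.exp (μ * τ - Real.exp τ) * coshKernel ν (Real.exp τ) u := by
    intro τ
    rw [integral_const_mul, macdonald]
    ring
  simp_rw [h1]
  rw [integral_const_mul, integral_integral_swap (integrable_momentKernel h)]
  simp_rw [integral_momentKernel_inner (re_pos_of_abs_lt h), coshWeight_eq]
  rw [integral_const_mul, integral_const_mul,
    integral_betaKernel (re_add_pos_of_abs_lt h) (re_sub_pos_of_abs_lt h)]
  rw [show μ + ν + (μ - ν) = 2 * μ by ring]
  ring

/-- The small-argument limit `(x/2)^ν K_ν(x) → Γ(ν)/2` for `Re ν > 0`. -/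
theorem tendsto_macdonald_atBot {ν : ℂ} (hν : 0 < ν.re) :
    Tendsto (fun τ : ℝ => Complex.exp (ν * (τ - Real.log 2)) * macdonald ν τ) atBot
      (𝓝 (Complex.Gamma ν / 2)) := by
  have h1 : ∀ τ : ℝ, Complex.exp (ν * (τ - Real.log 2)) * macdonald ν τ =
      (1 / 2) * ∫ u : ℝ, Complex.exp (ν * u - Real.exp u) *
        Complex.exp (-(Real.exp (2 * τ - u) / 4 : ℝ)) := by
    intro τ
    rw [macdonald, ← integral_add_right_eq_self (coshKernel ν (Real.exp τ)) (Real.log 2 - τ),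
      mul_left_comm, ← integral_const_mul]
    congr 2
    ext u
    unfold coshKernel
    rw [← Complex.exp_add, ← Complex.exp_add]
    congr 1
    have : Real.exp τ * Real.cosh (u + (Real.log 2 - τ)) =
        Real.exp u + Real.exp (2 * τ - u) / 4 := by
      rw [Real.cosh_eq, show -(u + (Real.log 2 - τ)) = -u + τ - Real.log 2 by ring,
        show u + (Real.log 2 - τ) = u - τ + Real.log 2 by ring, Real.exp_add (u - τ),
        Real.exp_sub _ (Real.log 2), Real.exp_log two_pos, Real.exp_sub, Real.exp_add,
        Real.exp_sub, two_mul, Real.exp_add, Real.exp_neg]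
      field_simp [Real.exp_ne_zero]
      ring
    rw [this]
    push_cast
    ring
  simp_rw [h1]
  rw [show Complex.Gamma ν / 2 = (1 / 2) * Complex.Gamma ν by ring, ← integral_gammaKernel hν]
  refine Tendsto.const_mul _ ?_
  refine tendsto_integral_filter_of_dominated_convergence
    (fun u : ℝ => ‖Complex.exp (ν * u - Real.exp u)‖)
    (Eventually.of_forall fun τ => (by fun_prop : Continuous _).aestronglyMeasurable)
    (Eventually.of_forall fun τ => ae_of_all _ fun u => ?_)
    (integrable_gammaKernel hν).norm (ae_of_all _ fun u => ?_)
  · rw [norm_mul]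
    refine mul_le_of_le_one_right (norm_nonneg _) ?_
    rw [Complex.norm_exp, Real.exp_le_one_iff, Complex.neg_re, Complex.ofReal_re]
    have := Real.exp_pos (2 * τ - u)
    linarith
  · have h3 : Tendsto (fun τ : ℝ => Real.exp (2 * τ - u) / 4) atBot (𝓝 (0 / 4)) := by
      refine Tendsto.div_const (Real.tendsto_exp_atBot.comp ?_) _
      exact tendsto_atBot_add_const_right _ _ (tendsto_id.const_mul_atBot two_pos)
    have h4 : Tendsto (fun τ : ℝ => Complex.exp (-((Real.exp (2 * τ - u) / 4 : ℝ) : ℂ))) atBot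
        (𝓝 (Complex.exp (-((0 / 4 : ℝ) : ℂ)))) :=
      ((Complex.continuous_exp.tendsto _).comp ((Complex.continuous_ofReal.tendsto _).comp h3).neg)
    simpa using h4.const_mul (Complex.exp (ν * u - Real.exp u))

/-- The large-argument limit `x^{1/2} e^x K_ν(x) → (π/2)^{1/2}`. -/
theorem tendsto_macdonald_atTop (ν : ℂ) :
    Tendsto (fun τ : ℝ => Complex.exp (τ / 2 + Real.exp τ) * macdonald ν τ) atTop
      (𝓝 (Real.sqrt (Real.pi / 2) : ℂ)) := by
  -- rescale the integration variable by `e^{-τ/2}`, so that the integrand tends to a Gaussian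
  have h1 : ∀ τ : ℝ, Complex.exp (τ / 2 + Real.exp τ) * macdonald ν τ =
      (1 / 2) * ∫ v : ℝ, Complex.exp (ν * (Real.exp (-τ / 2) * v : ℝ) -
        (Real.exp τ * (Real.cosh (Real.exp (-τ / 2) * v) - 1) : ℝ)) := by
    intro τ
    have := Measure.integral_comp_mul_left (fun u : ℝ => Complex.exp (ν * (u : ℝ) -
        (Real.exp τ * (Real.cosh u - 1) : ℝ))) (Real.exp (-τ / 2))
    rw [this, macdonald, abs_of_pos (by positivity), ← Real.exp_neg, Complex.real_smul,
      mul_left_comm]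
    congr 1
    rw [← integral_const_mul, ← integral_const_mul]
    congr 1
    ext u
    unfold coshKernel
    rw [Complex.ofReal_exp (-(-τ / 2)), ← Complex.exp_add, ← Complex.exp_add]
    congr 1
    push_cast
    ring
  simp_rw [h1]
  have h2 : (Real.sqrt (Real.pi / 2) : ℂ) = (1 / 2) * ∫ v : ℝ, Complex.exp (-(v ^ 2 / 2 : ℝ)) := by
    have := integral_gaussian (1 / 2)
    have h3 : ∫ v : ℝ, Complex.exp (-(v ^ 2 / 2 : ℝ)) =
        ((∫ v : ℝ, Real.exp (-(1 / 2) * v ^ 2) : ℝ) : ℂ) := by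
      rw [← integral_complex_ofReal]
      congr 1
      ext v
      rw [Complex.ofReal_exp]
      congr 1
      push_cast
      ring
    rw [h3, this]
    rw [show Real.pi / (1 / 2) = 2 ^ 2 * (Real.pi / 2) by ring, Real.sqrt_mul (by norm_num),
      Real.sqrt_sq (by norm_num)]
    push_cast
    ring
  rw [h2]
  refine Tendsto.const_mul _ ?_
  refine tendsto_integral_filter_of_dominated_convergence
    (fun v : ℝ => Real.exp (-(1 / 2) * v ^ 2 + |ν.re| * v) +
      Real.exp (-(1 / 2) * v ^ 2 + (-|ν.re|) * v))
    (Eventually.of_forall fun τ => (by fun_prop : Continuous _).aestronglyMeasurable)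
    ?_ ?_ (ae_of_all _ fun v => ?_)
  · filter_upwards [eventually_ge_atTop 0] with τ hτ
    refine ae_of_all _ fun v => ?_
    rw [Complex.norm_exp]
    have hq := one_add_sq_div_two_le_cosh (Real.exp (-τ / 2) * v)
    have he : Real.exp τ * Real.exp (-τ / 2) ^ 2 = 1 := by
      rw [← Real.exp_nat_mul, ← Real.exp_add]
      norm_num
      ring
    have h5 : v ^ 2 / 2 ≤ Real.exp τ * (Real.cosh (Real.exp (-τ / 2) * v) - 1) := by
      calc v ^ 2 / 2 = Real.exp τ * ((Real.exp (-τ / 2) * v) ^ 2 / 2) := by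
            rw [mul_pow]; linear_combination (-v ^ 2 / 2) * he
        _ ≤ _ := by gcongr; linarith
    simp only [Complex.sub_re, Complex.mul_re, Complex.ofReal_re, Complex.ofReal_im, mul_zero,
      sub_zero]
    have h6 := exp_mul_le_add (σ := ν.re * Real.exp (-τ / 2)) (s := |ν.re|) (by
      rw [abs_mul, abs_of_pos (Real.exp_pos _)]
      exact mul_le_of_le_one_right (abs_nonneg _) (Real.exp_le_one_iff.2 (by linarith))) v
    rw [Real.exp_add, Real.exp_add, ← mul_add, sub_eq_add_neg, Real.exp_add, mul_comm]
    refine mul_le_mul (Real.exp_le_exp.2 (by linarith)) ?_ (Real.exp_pos _).le (Real.exp_pos _).le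
    rw [← mul_assoc]
    exact h6
  · have : ∀ s : ℝ, Integrable fun v : ℝ => Real.exp (-(1 / 2) * v ^ 2 + s * v) := by
      intro s
      have := (integrable_cexp_quadratic (b := ((1 / 2 : ℝ) : ℂ)) (by norm_num) (s : ℂ) 0).norm
      refine this.congr (ae_of_all _ fun u => ?_)
      simp only [Complex.norm_exp]
      congr 1
      simp [← Complex.ofReal_pow]
    exact (this _).add (this _)
  · refine (Complex.continuous_exp.tendsto _).comp ?_
    have he : Tendsto (fun τ : ℝ => Real.exp (-τ / 2)) atTop (𝓝 0) := by
      refine Real.tendsto_exp_atBot.comp ?_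
      have := (tendsto_id (α := ℝ) (x := atTop)).atTop_mul_const_of_neg
        (r := (-1 / 2 : ℝ)) (by norm_num)
      refine this.congr fun τ => ?_
      simp only [id]
      ring
    have hc : Tendsto (fun τ : ℝ => Real.exp τ * (Real.cosh (Real.exp (-τ / 2) * v) - 1)) atTop
        (𝓝 (v ^ 2 / 2)) := by
      have hcosh : Tendsto (fun y : ℝ => (Real.sinh (y / 2) / y) ^ 2) (𝓝[≠] 0)
          (𝓝 ((1 / 2) ^ 2)) := by
        have hd : HasDerivAt (fun y : ℝ => Real.sinh (y / 2)) (1 / 2) 0 := by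
          have := (Real.hasDerivAt_sinh (0 / 2)).comp (0 : ℝ) ((hasDerivAt_id (0 : ℝ)).div_const 2)
          convert! this using 1
          simp
        have := hd.tendsto_slope
        refine Tendsto.pow (this.congr fun y => ?_) 2
        simp [slope_def_field]
      rcases eq_or_ne v 0 with rfl | hv
      · simp
      have hin : Tendsto (fun τ : ℝ => Real.exp (-τ / 2) * v) atTop (𝓝[≠] 0) := by
        refine tendsto_nhdsWithin_iff.2 ⟨by simpa using he.mul_const v,
          Eventually.of_forall fun τ => mul_ne_zero (Real.exp_ne_zero _) hv⟩
      have := (hcosh.comp hin).const_mul (2 * v ^ 2)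
      rw [show v ^ 2 / 2 = 2 * v ^ 2 * (1 / 2) ^ 2 by ring]
      refine this.congr fun τ => ?_
      simp only [Function.comp]
      have hcc : Real.cosh (Real.exp (-τ / 2) * v) - 1 =
          2 * Real.sinh (Real.exp (-τ / 2) * v / 2) ^ 2 := by
        have := Real.cosh_two_mul (Real.exp (-τ / 2) * v / 2)
        rw [Real.cosh_sq, mul_div_cancel₀ _ two_ne_zero] at this
        linarith
      rw [hcc, div_pow, mul_pow]
      have he2 : Real.exp τ * Real.exp (-τ / 2) ^ 2 = 1 := by
        rw [← Real.exp_nat_mul, ← Real.exp_add]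
        norm_num
        ring
      have hE := Real.exp_ne_zero (-τ / 2)
      generalize Real.sinh (Real.exp (-τ / 2) * v / 2) = S
      generalize Real.exp (-τ / 2) = E at *
      rw [eq_inv_of_mul_eq_one_left he2]
      field_simp
    have h7 : Tendsto (fun τ : ℝ => ν * ((Real.exp (-τ / 2) * v : ℝ) : ℂ)) atTop
        (𝓝 (ν * ((0 * v : ℝ) : ℂ))) :=
      ((Complex.continuous_ofReal.tendsto _).comp (he.mul_const v)).const_mul ν
    have h8 := h7.sub ((Complex.continuous_ofReal.tendsto _).comp hc)
    simpa using h8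

/-! ### Power series, and `K_ν` in terms of `I_ν` and `I_{-ν}` on the positive axis -/

/-- The reciprocals `1/Γ(k+ν+1)` are bounded uniformly in `k`, locally uniformly in `ν`: for large
`k` the recurrence of `Γ` makes them decrease in modulus. -/
theorem exists_bound_Gamma_inv (ν₀ : ℂ) : ∃ C : ℝ, 0 ≤ C ∧ ∀ ν ∈ Metric.closedBall ν₀ 1, ∀ k : ℕ,
    ‖(Complex.Gamma (k + ν + 1))⁻¹‖ ≤ C := by
  obtain ⟨n, hn⟩ := exists_nat_ge (‖ν₀‖ + 2)
  have hcont : Continuous fun ν : ℂ =>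
      ∑ k ∈ Finset.range (n + 1), ‖(Complex.Gamma (k + ν + 1))⁻¹‖ := by
    refine continuous_finsetSum _ fun k _ => ?_
    exact (Complex.differentiable_one_div_Gamma.continuous.comp
      (by fun_prop : Continuous fun ν : ℂ => k + ν + 1)).norm
  obtain ⟨C, hC⟩ := (isCompact_closedBall ν₀ 1).exists_bound_of_continuousOn hcont.continuousOn
  refine ⟨|C|, abs_nonneg C, fun ν hν k => ?_⟩
  have hsmall : ∀ k ≤ n, ‖(Complex.Gamma (k + ν + 1))⁻¹‖ ≤ |C| := fun k hk => by
    have h1 := Finset.single_le_sum (f := fun k : ℕ => ‖(Complex.Gamma (k + ν + 1))⁻¹‖)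
      (fun i _ => norm_nonneg _) (Finset.mem_range.2 (Nat.lt_succ_of_le hk))
    exact h1.trans ((le_abs_self _).trans ((hC ν hν).trans (le_abs_self _)))
  rcases le_total k n with hk | hk
  · exact hsmall k hk
  · induction k, hk using Nat.le_induction with
    | base => exact hsmall n le_rfl
    | succ k hk ih =>
      have hs : 1 ≤ ‖(k : ℂ) + ν + 1‖ := by
        have h1 : ‖ν‖ ≤ ‖ν₀‖ + 1 := by
          have := norm_le_norm_add_norm_sub' ν ν₀
          have h2 := mem_closedBall_iff_norm.1 hν
          linarith
        have h2 : ‖((k : ℂ) + 1)‖ ≤ ‖(k : ℂ) + ν + 1‖ + ‖ν‖ := by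
          calc ‖((k : ℂ) + 1)‖ = ‖((k : ℂ) + ν + 1) - ν‖ := by congr 1; ring
            _ ≤ _ := norm_sub_le _ _
        have h3 : ‖((k : ℂ) + 1)‖ = k + 1 := by
          rw [← Nat.cast_succ, Complex.norm_natCast]; push_cast; rfl
        have h4 : (n : ℝ) ≤ k := by exact_mod_cast hk
        linarith
      have hne : (k : ℂ) + ν + 1 ≠ 0 := norm_pos_iff.1 (by linarith)
      have : ((k + 1 : ℕ) : ℂ) + ν + 1 = ((k : ℂ) + ν + 1) + 1 := by push_cast; ring
      rw [this, Complex.Gamma_add_one _ hne, mul_inv, norm_mul, norm_inv]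
      calc ‖(k : ℂ) + ν + 1‖⁻¹ * ‖(Complex.Gamma (k + ν + 1))⁻¹‖ ≤ 1 * |C| := by
            gcongr
            exact inv_le_one_of_one_le₀ hs
        _ = |C| := one_mul _

/-- The entire function `∑ y^k / (k! Γ(k+ν+1))`, through which
`I_ν(z) = (z/2)^ν besselSeries ν (z²/4)` and `J_ν(z) = (z/2)^ν besselSeries ν (-z²/4)`. -/
def besselSeries (ν y : ℂ) : ℂ :=
  ∑' k : ℕ, y ^ k * ((k.factorial : ℂ) * Complex.Gamma (k + ν + 1))⁻¹

theorem norm_besselSeries_term_le {ν : ℂ} {C : ℝ}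
    (hC : ∀ k : ℕ, ‖(Complex.Gamma (k + ν + 1))⁻¹‖ ≤ C) (y : ℂ) (k : ℕ) :
    ‖y ^ k * ((k.factorial : ℂ) * Complex.Gamma (k + ν + 1))⁻¹‖ ≤
      C * (‖y‖ ^ k / (k.factorial : ℝ)) := by
  rw [mul_inv, norm_mul, norm_mul, norm_pow, norm_inv, Complex.norm_natCast]
  calc _ = ‖(Complex.Gamma (k + ν + 1))⁻¹‖ * (‖y‖ ^ k / (k.factorial : ℝ)) := by ring
    _ ≤ _ := by gcongr; exact hC k

theorem summable_besselSeries (ν y : ℂ) :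
    Summable fun k : ℕ => y ^ k * ((k.factorial : ℂ) * Complex.Gamma (k + ν + 1))⁻¹ := by
  obtain ⟨C, -, hC⟩ := exists_bound_Gamma_inv ν
  exact Summable.of_norm_bounded ((Real.summable_pow_div_factorial ‖y‖).mul_left C)
    (norm_besselSeries_term_le (hC ν (Metric.mem_closedBall_self zero_le_one)) y)

theorem continuous_besselSeries_order (y : ℂ) : Continuous fun ν => besselSeries ν y := by
  refine continuous_iff_continuousAt.2 fun ν₀ => ?_
  obtain ⟨C, -, hC⟩ := exists_bound_Gamma_inv ν₀
  refine ContinuousOn.continuousAt (s := Metric.closedBall ν₀ 1) ?_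
    (Metric.closedBall_mem_nhds _ one_pos)
  refine continuousOn_tsum (fun k => ?_) ((Real.summable_pow_div_factorial ‖y‖).mul_left C)
    fun k ν hν => norm_besselSeries_term_le (hC ν hν) y k
  simp_rw [mul_inv]
  exact (continuous_const.mul (continuous_const.mul
    (Complex.differentiable_one_div_Gamma.continuous.comp
      (by fun_prop : Continuous fun ν : ℂ => k + ν + 1)))).continuousOn

theorem besselSeries_deriv_term (ν y : ℂ) (k : ℕ) :
    ((k + 1 : ℕ) : ℂ) * y ^ k * (((k + 1).factorial : ℂ) *
      Complex.Gamma ((k + 1 : ℕ) + ν + 1))⁻¹ =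
      y ^ k * ((k.factorial : ℂ) * Complex.Gamma (k + (ν + 1) + 1))⁻¹ := by
  have h1 : ((k + 1 : ℕ) : ℂ) + ν + 1 = k + (ν + 1) + 1 := by push_cast; ring
  have h2 : ((k + 1 : ℕ) : ℂ) ≠ 0 := Nat.cast_ne_zero.2 (Nat.succ_ne_zero k)
  rw [h1, Nat.factorial_succ, Nat.cast_mul]
  field_simp

theorem besselSeries_deriv_eq (ν y : ℂ) :
    ∑' k : ℕ, (k : ℂ) * y ^ (k - 1) * ((k.factorial : ℂ) * Complex.Gamma (k + ν + 1))⁻¹ =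
      besselSeries (ν + 1) y := by
  have hs : Summable fun k : ℕ =>
      (k : ℂ) * y ^ (k - 1) * ((k.factorial : ℂ) * Complex.Gamma (k + ν + 1))⁻¹ := by
    rw [← summable_nat_add_iff 1]
    simp only [Nat.add_sub_cancel, besselSeries_deriv_term]
    exact summable_besselSeries _ _
  rw [hs.tsum_eq_zero_add]
  simp only [Nat.add_sub_cancel, besselSeries_deriv_term]
  simp [besselSeries]

theorem hasDerivAt_besselSeries (ν y : ℂ) :
    HasDerivAt (besselSeries ν) (besselSeries (ν + 1) y) y := by
  obtain ⟨C, hC0, hC⟩ := exists_bound_Gamma_inv ν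
  replace hC := hC ν (Metric.mem_closedBall_self zero_le_one)
  rw [← besselSeries_deriv_eq]
  set R := ‖y‖ + 1
  have hu : Summable fun k : ℕ => C * ((k : ℝ) * R ^ (k - 1) / (k.factorial : ℝ)) := by
    refine Summable.mul_left C ?_
    rw [← summable_nat_add_iff 1]
    refine (Real.summable_pow_div_factorial R).congr fun k => ?_
    rw [Nat.add_sub_cancel, Nat.factorial_succ]
    have : ((k + 1 : ℕ) : ℝ) ≠ 0 := Nat.cast_ne_zero.2 (Nat.succ_ne_zero k)
    push_cast at *
    field_simp
  have hR : 0 < R := by positivity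
  refine hasDerivAt_tsum_of_isPreconnected (t := Metric.ball (0 : ℂ) R) (y₀ := 0)
    (g := fun (k : ℕ) (y : ℂ) => y ^ k * ((k.factorial : ℂ) * Complex.Gamma (k + ν + 1))⁻¹)
    (g' := fun (k : ℕ) (y : ℂ) =>
      (k : ℂ) * y ^ (k - 1) * ((k.factorial : ℂ) * Complex.Gamma (k + ν + 1))⁻¹)
    hu Metric.isOpen_ball
    (convex_ball _ _).isPreconnected (fun k w _ => (hasDerivAt_pow k w).mul_const _)
    (fun k w hw => ?_) (Metric.mem_ball_self hR) (summable_besselSeries ν 0)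
    (mem_ball_zero_iff.2 (lt_add_one _))
  rw [mul_inv, norm_mul, norm_mul, norm_mul, norm_pow, norm_inv, Complex.norm_natCast,
    Complex.norm_natCast]
  calc _ = ‖(Complex.Gamma (k + ν + 1))⁻¹‖ * ((k : ℝ) * ‖w‖ ^ (k - 1) / (k.factorial : ℝ)) := by
        ring
    _ ≤ _ := by
        gcongr
        · exact hC k
        · exact (mem_ball_zero_iff.1 hw).le

theorem besselSeries_recurrence (ν y : ℂ) :
    besselSeries (ν - 1) y = ν * besselSeries ν y + y * besselSeries (ν + 1) y := by
  have hk : ∀ k : ℕ, y ^ k * ((k.factorial : ℂ) * Complex.Gamma (k + (ν - 1) + 1))⁻¹ =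
      ν * (y ^ k * ((k.factorial : ℂ) * Complex.Gamma (k + ν + 1))⁻¹) +
      y * ((k : ℂ) * y ^ (k - 1) * ((k.factorial : ℂ) * Complex.Gamma (k + ν + 1))⁻¹) := by
    intro k
    have h1 := Complex.one_div_Gamma_eq_self_mul_one_div_Gamma_add_one (k + ν)
    rw [show (k : ℂ) + (ν - 1) + 1 = k + ν by ring, mul_inv, mul_inv, h1]
    rcases k with _ | k
    · simp
    · rw [Nat.add_sub_cancel, pow_succ]
      ring
  have hs : Summable fun k : ℕ =>
      (k : ℂ) * y ^ (k - 1) * ((k.factorial : ℂ) * Complex.Gamma (k + ν + 1))⁻¹ := by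
    rw [← summable_nat_add_iff 1]
    simp only [Nat.add_sub_cancel, besselSeries_deriv_term]
    exact summable_besselSeries _ _
  rw [← besselSeries_deriv_eq]
  unfold besselSeries
  simp_rw [hk]
  rw [((summable_besselSeries ν y).mul_left ν).tsum_add (hs.mul_left y), tsum_mul_left,
    tsum_mul_left]

theorem besselSeries_zero (ν : ℂ) : besselSeries ν 0 = (Complex.Gamma (ν + 1))⁻¹ := by
  unfold besselSeries
  rw [tsum_eq_single 0 (fun k hk => by simp [hk])]
  simp

theorem besselI_eq (ν ζ : ℂ) : besselI ν ζ = Complex.exp (ν * (ζ - Real.log 2)) *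
    besselSeries ν (Complex.exp (2 * (ζ - Real.log 2))) := by
  unfold besselI besselSeries
  rw [← tsum_mul_left]
  congr 1
  ext k
  rw [← Complex.exp_nat_mul, ← mul_assoc, ← Complex.exp_add]
  congr 2
  ring

theorem besselJ_eq (ν ζ : ℂ) : besselJ ν ζ = Complex.exp (ν * (ζ - Real.log 2)) *
    besselSeries ν (-Complex.exp (2 * (ζ - Real.log 2))) := by
  unfold besselJ besselSeries
  rw [← tsum_mul_left]
  congr 1
  ext k
  rw [neg_pow (Complex.exp _), ← Complex.exp_nat_mul,
    show ∀ a b c d : ℂ, a * (b * c * d) = b * (a * c) * d by intros; ring, ← Complex.exp_add]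
  congr 3
  ring

theorem continuous_besselI_order (ζ : ℂ) : Continuous fun ν => besselI ν ζ := by
  simp_rw [besselI_eq]
  exact (by fun_prop : Continuous fun ν : ℂ => Complex.exp (ν * (ζ - Real.log 2))).mul
    (continuous_besselSeries_order _)

theorem exp_log_two : Complex.exp (Real.log 2 : ℝ) = 2 := by
  rw [← Complex.ofReal_exp, Real.exp_log two_pos]; norm_num

theorem two_mul_exp_sub_log_two (ζ : ℂ) :
    2 * Complex.exp (ζ - Real.log 2) = Complex.exp ζ := by
  rw [Complex.exp_sub, exp_log_two, mul_div_cancel₀ _ two_ne_zero]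

theorem hasDerivAt_besselI (ν ζ : ℂ) :
    HasDerivAt (besselI ν) (ν * besselI ν ζ + Complex.exp ζ * besselI (ν + 1) ζ) ζ := by
  have h1 : HasDerivAt (fun ζ : ℂ => Complex.exp (ν * (ζ - Real.log 2)))
      (Complex.exp (ν * (ζ - Real.log 2)) * (ν * 1)) ζ :=
    (((hasDerivAt_id ζ).sub_const _).const_mul ν).cexp
  have h2 : HasDerivAt (fun ζ : ℂ => Complex.exp (2 * (ζ - Real.log 2)))
      (Complex.exp (2 * (ζ - Real.log 2)) * (2 * 1)) ζ :=
    (((hasDerivAt_id ζ).sub_const _).const_mul 2).cexp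
  have h3 := h1.mul ((hasDerivAt_besselSeries ν _).comp ζ h2)
  have h4 : besselI ν = fun ζ => Complex.exp (ν * (ζ - Real.log 2)) *
    besselSeries ν (Complex.exp (2 * (ζ - Real.log 2))) := funext (besselI_eq ν)
  rw [besselI_eq ν, besselI_eq (ν + 1), h4]
  convert! h3 using 1
  rw [add_mul, Complex.exp_add, ← two_mul_exp_sub_log_two ζ]
  simp only [Function.comp, two_mul (ζ - _), Complex.exp_add]
  ring_nf

theorem besselI_recurrence (ν ζ : ℂ) :
    Complex.exp ζ * (besselI (ν - 1) ζ - besselI (ν + 1) ζ) = 2 * ν * besselI ν ζ := by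
  rw [besselI_eq, besselI_eq ν, besselI_eq (ν + 1), besselSeries_recurrence, sub_mul ν,
    Complex.exp_sub, add_mul ν, Complex.exp_add, ← two_mul_exp_sub_log_two ζ,
    two_mul (ζ - _), Complex.exp_add]
  have := Complex.exp_ne_zero (1 * (ζ - Real.log 2))
  rw [one_mul] at *
  field_simp
  ring

theorem hasDerivAt_besselI_succ (ν ζ : ℂ) :
    HasDerivAt (besselI (ν + 1))
      (Complex.exp ζ * besselI ν ζ - (ν + 1) * besselI (ν + 1) ζ) ζ := by
  convert! hasDerivAt_besselI (ν + 1) ζ using 1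
  have := besselI_recurrence (ν + 1) ζ
  rw [add_sub_cancel_right] at this
  linear_combination this

theorem differentiable_besselI (ν : ℂ) : Differentiable ℂ (besselI ν) := fun ζ =>
  (hasDerivAt_besselI ν ζ).differentiableAt

/-- The leading behaviour `(x/2)^{-ν} I_ν(x) → 1/Γ(ν+1)` as `x → 0`. -/
theorem tendsto_besselI_atBot (ν : ℂ) :
    Tendsto (fun τ : ℝ => Complex.exp (-ν * (τ - Real.log 2)) * besselI ν τ) atBot
      (𝓝 (Complex.Gamma (ν + 1))⁻¹) := by
  have h0 : Tendsto (fun τ : ℝ => Complex.exp (2 * ((τ : ℂ) - Real.log 2))) atBot (𝓝 0) := by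
    rw [tendsto_zero_iff_norm_tendsto_zero]
    have : ∀ τ : ℝ, ‖Complex.exp (2 * ((τ : ℂ) - Real.log 2))‖ =
        Real.exp (2 * (τ - Real.log 2)) := by
      intro τ
      rw [← Complex.ofReal_sub, ← Complex.ofReal_ofNat, ← Complex.ofReal_mul,
        Complex.norm_exp_ofReal]
    simp_rw [this]
    refine Real.tendsto_exp_atBot.comp ?_
    exact (tendsto_atBot_add_const_right _ (-Real.log 2) tendsto_id).const_mul_atBot two_pos
  have h1 := ((hasDerivAt_besselSeries ν 0).continuousAt.tendsto).comp h0
  rw [besselSeries_zero] at h1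
  refine h1.congr fun τ => ?_
  rw [besselI_eq, ← mul_assoc, ← Complex.exp_add, neg_mul, neg_add_cancel, Complex.exp_zero,
    one_mul]
  rfl

theorem tendsto_exp_mul_atBot {s : ℂ} (hs : 0 < s.re) (c : ℂ) :
    Tendsto (fun τ : ℝ => Complex.exp (s * (τ - c))) atBot (𝓝 0) := by
  rw [tendsto_zero_iff_norm_tendsto_zero]
  have : ∀ τ : ℝ, ‖Complex.exp (s * ((τ : ℂ) - c))‖ = Real.exp (s.re * τ + -(s * c).re) := by
    intro τ
    rw [Complex.norm_exp, mul_sub]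
    congr 1
    simp [sub_eq_add_neg]
  simp_rw [this]
  refine Real.tendsto_exp_atBot.comp ?_
  exact tendsto_atBot_add_const_right _ _ (tendsto_id.const_mul_atBot hs)

theorem eq_of_hasDerivAt_zero_of_tendsto {f : ℝ → ℂ} {c : ℂ} {l : Filter ℝ} [l.NeBot]
    (hf : ∀ τ, HasDerivAt f 0 τ) (hl : Tendsto f l (𝓝 c)) (τ : ℝ) : f τ = c := by
  have h := is_const_of_deriv_eq_zero (fun τ => (hf τ).differentiableAt) fun τ => (hf τ).deriv
  have h2 : Tendsto f l (𝓝 (f τ)) := by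
    rw [show f = fun _ => f τ from funext fun s => h s τ]
    exact tendsto_const_nhds
  exact tendsto_nhds_unique h2 hl

theorem ofReal_exp_eq_two_mul (τ : ℝ) :
    (Real.exp τ : ℂ) = 2 * Complex.exp ((τ : ℂ) - Real.log 2) := by
  rw [two_mul_exp_sub_log_two, Complex.ofReal_exp]

/-- The Wronskian relation of `I_ν` and `K_ν`. It holds for `Re ν > 0` by comparison at the
origin; the recurrences show that the left-hand side is the same at `ν` and at `ν + 1`. -/
theorem besselI_macdonald_wronskian (ν : ℂ) (τ : ℝ) :
    (Real.exp τ : ℂ) * (besselI ν τ * macdonald (ν + 1) τ + besselI (ν + 1) τ * macdonald ν τ)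
      = 1 := by
  have hpos : ∀ μ : ℂ, 0 < μ.re → (Real.exp τ : ℂ) *
      (besselI μ τ * macdonald (μ + 1) τ + besselI (μ + 1) τ * macdonald μ τ) = 1 := by
    intro μ hμ
    refine eq_of_hasDerivAt_zero_of_tendsto (l := atBot) (f := fun τ : ℝ => (Real.exp τ : ℂ) *
      (besselI μ τ * macdonald (μ + 1) τ + besselI (μ + 1) τ * macdonald μ τ)) (fun t => ?_) ?_ τ
    · have hI := (hasDerivAt_besselI μ t).comp_ofReal
      have hI1 := (hasDerivAt_besselI_succ μ t).comp_ofReal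
      have hK := hasDerivAt_macdonald' μ t
      have hK1 := hasDerivAt_macdonald_succ μ t
      have := (Real.hasDerivAt_exp t).ofReal_comp.mul ((hI.mul hK1).add (hI1.mul hK))
      convert! this using 1
      simp only [Pi.add_apply, Pi.mul_apply, ← Complex.ofReal_exp]
      ring
    · have hμ1 : 0 < (μ + 1).re := by simp; linarith
      have hG : Complex.Gamma (μ + 1) ≠ 0 := Complex.Gamma_ne_zero_of_re_pos hμ1
      have h1 := ((tendsto_besselI_atBot μ).mul (tendsto_macdonald_atBot hμ1)).const_mul 2
      have h2 := ((tendsto_besselI_atBot (μ + 1)).mul (tendsto_macdonald_atBot hμ)).mul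
        ((tendsto_exp_mul_atBot (s := 2) (by norm_num) (Real.log 2 : ℂ)).const_mul 2)
      have h3 := h1.add h2
      have h4 : 2 * ((Complex.Gamma (μ + 1))⁻¹ * (Complex.Gamma (μ + 1) / 2)) +
          (Complex.Gamma (μ + 1 + 1))⁻¹ * (Complex.Gamma μ / 2) * (2 * 0) = 1 := by
        field_simp
        ring
      rw [h4] at h3
      refine h3.congr fun t => ?_
      rw [ofReal_exp_eq_two_mul, neg_mul, neg_mul, Complex.exp_neg, Complex.exp_neg, add_mul μ,
        Complex.exp_add, one_mul, two_mul (_ - _), Complex.exp_add]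
      have e1 := Complex.exp_ne_zero (μ * ((t : ℂ) - Real.log 2))
      have e2 := Complex.exp_ne_zero ((t : ℂ) - Real.log 2)
      field_simp
  have hstep : ∀ μ : ℂ, (Real.exp τ : ℂ) *
      (besselI (μ + 1) τ * macdonald (μ + 1 + 1) τ + besselI (μ + 1 + 1) τ * macdonald (μ + 1) τ) =
      (Real.exp τ : ℂ) *
      (besselI μ τ * macdonald (μ + 1) τ + besselI (μ + 1) τ * macdonald μ τ) := by
    intro μ
    have h1 := macdonald_recurrence (μ + 1) τ
    have h2 := besselI_recurrence (μ + 1) τ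
    rw [add_sub_cancel_right] at h1 h2
    rw [← Complex.ofReal_exp] at h2
    linear_combination besselI (μ + 1) τ * h1 - macdonald (μ + 1) τ * h2
  have hall : ∀ n : ℕ, ∀ μ : ℂ, 0 < (μ + n).re → (Real.exp τ : ℂ) *
      (besselI μ τ * macdonald (μ + 1) τ + besselI (μ + 1) τ * macdonald μ τ) = 1 := by
    intro n
    induction n with
    | zero => intro μ hμ; exact hpos μ (by simpa using hμ)
    | succ n ih =>
      intro μ hμ
      rw [← hstep]
      refine ih (μ + 1) ?_
      rw [show μ + 1 + n = μ + ((n + 1 : ℕ) : ℂ) by push_cast; ring]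
      exact hμ
  obtain ⟨n, hn⟩ := exists_nat_gt (-ν.re)
  exact hall n ν (by simp; linarith)

/-- The Wronskian relation of `I_ν` and `I_{-ν}`. -/
theorem besselI_besselI_wronskian (ν : ℂ) (τ : ℝ) :
    (Real.exp τ : ℂ) * (besselI ν τ * besselI (-ν - 1) τ - besselI (ν + 1) τ * besselI (-ν) τ)
      = -2 * Complex.sin (Real.pi * ν) / Real.pi := by
  have hG : -2 * Complex.sin (Real.pi * ν) / Real.pi =
      2 * ((Complex.Gamma (ν + 1))⁻¹ * (Complex.Gamma (-ν))⁻¹) := by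
    have h := Complex.Gamma_mul_Gamma_one_sub (-ν)
    rw [sub_neg_eq_add, add_comm 1 ν, mul_neg, Complex.sin_neg] at h
    rw [← mul_inv, mul_comm (Complex.Gamma _), h, inv_div]
    ring
  rw [hG]
  refine eq_of_hasDerivAt_zero_of_tendsto (l := atBot) (f := fun τ : ℝ => (Real.exp τ : ℂ) *
    (besselI ν τ * besselI (-ν - 1) τ - besselI (ν + 1) τ * besselI (-ν) τ)) (fun t => ?_) ?_ τ
  · have h1 := (hasDerivAt_besselI ν t).comp_ofReal
    have h2 := (hasDerivAt_besselI_succ ν t).comp_ofReal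
    have h3 := (hasDerivAt_besselI (-ν - 1) t).comp_ofReal
    have h4 := (hasDerivAt_besselI_succ (-ν - 1) t).comp_ofReal
    rw [sub_add_cancel] at h3 h4
    have := (Real.hasDerivAt_exp t).ofReal_comp.mul ((h1.mul h3).sub (h2.mul h4))
    convert! this using 1
    simp only [Pi.sub_apply, Pi.mul_apply, ← Complex.ofReal_exp]
    ring
  · have h1 := ((tendsto_besselI_atBot ν).mul (tendsto_besselI_atBot (-ν - 1))).const_mul 2
    have h2 := ((tendsto_besselI_atBot (ν + 1)).mul (tendsto_besselI_atBot (-ν))).mul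
        ((tendsto_exp_mul_atBot (s := 2) (by norm_num) (Real.log 2 : ℂ)).const_mul 2)
    have h3 := h1.sub h2
    rw [sub_add_cancel, mul_zero, mul_zero, sub_zero] at h3
    refine h3.congr fun t => ?_
    rw [ofReal_exp_eq_two_mul, neg_sub_left, neg_neg, neg_neg, neg_mul, neg_mul, Complex.exp_neg,
      Complex.exp_neg, add_mul ν, add_comm 1 ν, add_mul ν,
      Complex.exp_add, one_mul, two_mul (_ - _), Complex.exp_add]
    have e1 := Complex.exp_ne_zero (ν * ((t : ℂ) - Real.log 2))
    have e2 := Complex.exp_ne_zero ((t : ℂ) - Real.log 2)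
    field_simp

/-- For every order, `(2/π) sin(πν) K_ν = I_{-ν} - I_ν` on the positive axis. -/
theorem sin_mul_macdonald (ν : ℂ) (τ : ℝ) :
    2 * Complex.sin (Real.pi * ν) / Real.pi * macdonald ν τ = besselI (-ν) τ - besselI ν τ := by
  have hA := besselI_macdonald_wronskian ν τ
  have hB := besselI_macdonald_wronskian (-ν - 1) τ
  have hW := besselI_besselI_wronskian ν τ
  rw [sub_add_cancel, macdonald_neg, show -ν - 1 = -(ν + 1) by ring, macdonald_neg,
    ← show -ν - 1 = -(ν + 1) by ring] at hB
  linear_combination macdonald ν τ * hW + besselI (-ν) τ * hA - besselI ν τ * hB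

theorem besselK_ofReal {ν : ℂ} (hν : Complex.sin (Real.pi * ν) ≠ 0) (τ : ℝ) :
    besselK ν τ = macdonald ν τ := by
  unfold besselK
  simp only [hν, if_false]
  rw [← sin_mul_macdonald]
  have : (Real.pi : ℂ) ≠ 0 := by exact_mod_cast Real.pi_ne_zero
  field_simp

/-! ### Stieltjes transforms, and the coefficients as moments -/

/-- The Stieltjes kernel is bounded away from its pole, uniformly on closed subsectors of
`|arg z| < π`. -/
theorem cos_half_im_le_norm_one_add_exp {w : ℂ} (hw : |w.im| ≤ Real.pi) :
    Real.cos (w.im / 2) ≤ ‖1 + Complex.exp w‖ := by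
  have h0 : 0 ≤ Real.cos (w.im / 2) := by
    have := abs_le.1 hw
    exact Real.cos_nonneg_of_neg_pi_div_two_le_of_le (by linarith) (by linarith)
  refine le_of_sq_le_sq ?_ (norm_nonneg _)
  rw [← Complex.normSq_eq_norm_sq, Complex.normSq_apply]
  simp only [Complex.add_re, Complex.add_im, Complex.one_re, Complex.one_im, Complex.exp_re,
    Complex.exp_im, zero_add]
  have h1 : Real.cos w.im = 2 * Real.cos (w.im / 2) ^ 2 - 1 := by
    rw [← Real.cos_two_mul, mul_div_cancel₀ _ two_ne_zero]
  have h2 := Real.sin_sq_add_cos_sq w.im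
  have h3 := Real.exp_pos w.re
  have h4 := Real.cos_sq_le_one (w.im / 2)
  set r := Real.exp w.re
  set c := Real.cos (w.im / 2)
  have h5 : (1 + r * Real.cos w.im) * (1 + r * Real.cos w.im) +
      r * Real.sin w.im * (r * Real.sin w.im) = 1 + 2 * r * (2 * c ^ 2 - 1) + r ^ 2 := by
    rw [← h1]
    linear_combination r ^ 2 * h2
  rw [h5]
  nlinarith [mul_nonneg (sq_nonneg (1 - r)) (sub_nonneg.2 h4), mul_nonneg h3.le (sq_nonneg c),
    mul_nonneg (sq_nonneg r) (sq_nonneg c)]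

theorem cos_half_pos {y : ℝ} (hy : |y| < Real.pi) : 0 < Real.cos (y / 2) := by
  have := abs_lt.1 hy
  exact Real.cos_pos_of_mem_Ioo ⟨by linarith, by linarith⟩

theorem abs_im_sub_le (τ : ℝ) (ζ : ℂ) : |((τ : ℂ) - ζ).im| = |ζ.im| := by
  simp

theorem one_add_exp_sub_ne_zero {ζ : ℂ} (hζ : |ζ.im| < Real.pi) (τ : ℝ) :
    1 + Complex.exp (τ - ζ) ≠ 0 := by
  have hw : |((τ : ℂ) - ζ).im| < Real.pi := by rwa [abs_im_sub_le]
  exact norm_pos_iff.1 ((cos_half_pos hw).trans_le (cos_half_im_le_norm_one_add_exp hw.le))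

theorem norm_inv_one_add_exp_sub_le {ζ : ℂ} {θ : ℝ} (hζ : |ζ.im| ≤ θ) (hθ : θ < Real.pi) (τ : ℝ) :
    ‖(1 + Complex.exp (τ - ζ))⁻¹‖ ≤ (Real.cos (θ / 2))⁻¹ := by
  have h1 : |((τ : ℂ) - ζ).im| ≤ θ := by rwa [abs_im_sub_le]
  have h0 : 0 ≤ θ := (abs_nonneg _).trans h1
  have h2 : Real.cos (θ / 2) ≤ Real.cos (((τ : ℂ) - ζ).im / 2) := by
    rw [← Real.cos_abs (((τ : ℂ) - ζ).im / 2)]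
    refine Real.cos_le_cos_of_nonneg_of_le_pi (abs_nonneg _) (by linarith) ?_
    rw [abs_div, abs_two]
    linarith
  rw [norm_inv]
  refine inv_anti₀ (cos_half_pos (by rwa [abs_of_nonneg h0])) (h2.trans ?_)
  exact cos_half_im_le_norm_one_add_exp (h1.trans hθ.le)

/-- The generalized Stieltjes transform `∫ Ψ(τ) (1 + e^τ/z)^{-j} dτ` at `z = e^ζ`. -/
def stieltjes (Ψ : ℝ → ℂ) (j : ℕ) (ζ : ℂ) : ℂ :=
  ∫ τ : ℝ, Ψ τ * (1 + Complex.exp (τ - ζ))⁻¹ ^ j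

theorem aestronglyMeasurable_stieltjes_integrand {Ψ : ℝ → ℂ} (hΨ : Integrable Ψ) (j : ℕ) (ζ : ℂ) :
    AEStronglyMeasurable (fun τ : ℝ => Ψ τ * (1 + Complex.exp (τ - ζ))⁻¹ ^ j) :=
  hΨ.aestronglyMeasurable.mul
    (by fun_prop : Measurable fun τ : ℝ => (1 + Complex.exp (τ - ζ))⁻¹ ^ j).aestronglyMeasurable

theorem norm_stieltjes_integrand_le {Ψ : ℝ → ℂ} (j : ℕ) {ζ : ℂ} {θ : ℝ} (hζ : |ζ.im| ≤ θ)
    (hθ : θ < Real.pi) (τ : ℝ) :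
    ‖Ψ τ * (1 + Complex.exp (τ - ζ))⁻¹ ^ j‖ ≤ (Real.cos (θ / 2))⁻¹ ^ j * ‖Ψ τ‖ := by
  rw [norm_mul, norm_pow, mul_comm]
  gcongr
  exact norm_inv_one_add_exp_sub_le hζ hθ τ

theorem integrable_stieltjes {Ψ : ℝ → ℂ} (hΨ : Integrable Ψ) (j : ℕ) {ζ : ℂ}
    (hζ : |ζ.im| < Real.pi) :
    Integrable (fun τ : ℝ => Ψ τ * (1 + Complex.exp (τ - ζ))⁻¹ ^ j) :=
  (hΨ.norm.const_mul ((Real.cos (|ζ.im| / 2))⁻¹ ^ j)).mono'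
    (aestronglyMeasurable_stieltjes_integrand hΨ j ζ)
    (ae_of_all _ (norm_stieltjes_integrand_le j le_rfl hζ))

theorem norm_stieltjes_le {Ψ : ℝ → ℂ} (hΨ : Integrable Ψ) (j : ℕ) {ζ : ℂ}
    (hζ : |ζ.im| < Real.pi) :
    ‖stieltjes Ψ j ζ‖ ≤ (Real.cos (|ζ.im| / 2))⁻¹ ^ j * ∫ τ, ‖Ψ τ‖ := by
  rw [← integral_const_mul]
  refine (norm_integral_le_integral_norm _).trans ?_
  exact integral_mono (integrable_stieltjes hΨ j hζ).norm (hΨ.norm.const_mul _)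
    (norm_stieltjes_integrand_le j le_rfl hζ)

theorem hasDerivAt_stieltjes {Ψ : ℝ → ℂ} (hΨ : Integrable Ψ) (j : ℕ) {ζ : ℂ}
    (hζ : |ζ.im| < Real.pi) :
    HasDerivAt (stieltjes Ψ j) (j * (stieltjes Ψ j ζ - stieltjes Ψ (j + 1) ζ)) ζ := by
  obtain ⟨θ, h1, h2⟩ := exists_between hζ
  have hs : {w : ℂ | |w.im| < θ} ∈ 𝓝 ζ :=
    (isOpen_lt (by fun_prop) continuous_const).mem_nhds h1
  set c := (Real.cos (θ / 2))⁻¹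
  have key := (hasDerivAt_integral_of_dominated_loc_of_deriv_le (𝕜 := ℂ) (μ := volume)
    (F := fun (ζ : ℂ) (τ : ℝ) => Ψ τ * (1 + Complex.exp (τ - ζ))⁻¹ ^ j)
    (F' := fun (ζ : ℂ) (τ : ℝ) => (j : ℂ) * (Ψ τ * (1 + Complex.exp (τ - ζ))⁻¹ ^ j -
      Ψ τ * (1 + Complex.exp (τ - ζ))⁻¹ ^ (j + 1)))
    (bound := fun τ => j * (c ^ j * ‖Ψ τ‖ + c ^ (j + 1) * ‖Ψ τ‖))
    hs (Eventually.of_forall fun w => aestronglyMeasurable_stieltjes_integrand hΨ j w)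
    (integrable_stieltjes hΨ j hζ) ?_ ?_ ?_ ?_).2
  · rw [integral_const_mul, integral_sub (integrable_stieltjes hΨ j hζ)
      (integrable_stieltjes hΨ (j + 1) hζ)] at key
    exact key
  · exact ((aestronglyMeasurable_stieltjes_integrand hΨ j ζ).sub
      (aestronglyMeasurable_stieltjes_integrand hΨ (j + 1) ζ)).const_mul _
  · refine ae_of_all _ fun τ w hw => ?_
    rw [norm_mul, Complex.norm_natCast]
    gcongr
    exact (norm_sub_le _ _).trans (add_le_add
      (norm_stieltjes_integrand_le j (le_of_lt hw) h2 τ)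
      (norm_stieltjes_integrand_le (j + 1) (le_of_lt hw) h2 τ))
  · exact ((hΨ.norm.const_mul _).add (hΨ.norm.const_mul _)).const_mul _
  · refine ae_of_all _ fun τ w hw => ?_
    have hne := one_add_exp_sub_ne_zero (lt_trans (show |w.im| < θ from hw) h2) τ
    have hd : HasDerivAt (fun w : ℂ => 1 + Complex.exp (τ - w))
        (Complex.exp (τ - w) * (-1)) w := by
      exact (((hasDerivAt_id w).const_sub (τ : ℂ)).cexp).const_add 1
    have := ((hd.inv hne).pow j).const_mul (Ψ τ)
    convert! this using 1
    simp only [Pi.inv_apply]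
    generalize hE : 1 + Complex.exp (τ - w) = E at *
    have hE' : Complex.exp (τ - w) = E - 1 := by rw [← hE]; ring
    rw [hE']
    rcases j with _ | j
    · simp
    · rw [Nat.add_sub_cancel]
      simp only [pow_succ]
      generalize E⁻¹ ^ j = p
      field_simp

/-- The coefficients `a_n(ν) = (4ν² - 1²)⋯(4ν² - (2n-1)²) / (8^n n!)` of the large-argument
expansion of `K_ν`. -/
def aCoeff (n : ℕ) (ν : ℂ) : ℂ :=
  (∏ k ∈ Finset.range n, (4 * ν ^ 2 - (2 * (k : ℂ) + 1) ^ 2)) / (8 ^ n * (n.factorial : ℂ))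

theorem aCoeff_zero (ν : ℂ) : aCoeff 0 ν = 1 := by simp [aCoeff]

theorem aCoeff_succ (n : ℕ) (ν : ℂ) :
    2 * ((n : ℂ) + 1) * aCoeff (n + 1) ν = (ν ^ 2 - 1 / 4 - n * (n + 1)) * aCoeff n ν := by
  unfold aCoeff
  rw [Finset.prod_range_succ, Nat.factorial_succ]
  have : (n : ℂ) + 1 ≠ 0 := by exact_mod_cast Nat.succ_ne_zero n
  have h2 : (n.factorial : ℂ) ≠ 0 := by exact_mod_cast n.factorial_ne_zero
  push_cast
  field_simp
  ring

theorem cos_div_pi_eq_prod (ν : ℂ) (N : ℕ) : Complex.cos (Real.pi * ν) / Real.pi =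
    (∏ k ∈ Finset.range N, (((k : ℂ) + 1 / 2) ^ 2 - ν ^ 2)) *
      ((Complex.Gamma (N + 1 / 2 + ν))⁻¹ * (Complex.Gamma (N + 1 / 2 - ν))⁻¹) := by
  induction N with
  | zero =>
    have h := Complex.Gamma_mul_Gamma_one_sub (1 / 2 + ν)
    rw [mul_add, show (Real.pi : ℂ) * (1 / 2) = Real.pi / 2 by ring,
      add_comm (Real.pi / 2 : ℂ), Complex.sin_add_pi_div_two] at h
    simp only [Finset.range_zero, Finset.prod_empty, one_mul, Nat.cast_zero, zero_add]
    rw [show (1 / 2 - ν : ℂ) = 1 - (1 / 2 + ν) by ring, ← mul_inv, h, inv_div]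
  | succ N ih =>
    have h1 := Complex.one_div_Gamma_eq_self_mul_one_div_Gamma_add_one (N + 1 / 2 + ν)
    have h2 := Complex.one_div_Gamma_eq_self_mul_one_div_Gamma_add_one (N + 1 / 2 - ν)
    rw [ih, h1, h2, Finset.prod_range_succ, show ((N + 1 : ℕ) : ℂ) + 1 / 2 + ν =
      N + 1 / 2 + ν + 1 by push_cast; ring, show ((N + 1 : ℕ) : ℂ) + 1 / 2 - ν =
      N + 1 / 2 - ν + 1 by push_cast; ring]
    ring

theorem aCoeff_eq_prod (N : ℕ) (ν : ℂ) : aCoeff N ν = (-1) ^ N / (2 ^ N * (N.factorial : ℂ)) *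
    ∏ k ∈ Finset.range N, (((k : ℂ) + 1 / 2) ^ 2 - ν ^ 2) := by
  unfold aCoeff
  have : ∏ k ∈ Finset.range N, (4 * ν ^ 2 - (2 * (k : ℂ) + 1) ^ 2) =
      (-4) ^ N * ∏ k ∈ Finset.range N, (((k : ℂ) + 1 / 2) ^ 2 - ν ^ 2) := by
    rw [← Finset.card_range N, ← Finset.prod_const, Finset.card_range, ← Finset.prod_mul_distrib]
    exact Finset.prod_congr rfl fun k _ => by ring
  have h2 : (N.factorial : ℂ) ≠ 0 := by exact_mod_cast N.factorial_ne_zero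
  rw [this, show (-4 : ℂ) ^ N = (-1) ^ N * 4 ^ N by rw [← mul_pow]; norm_num,
    show (8 : ℂ) ^ N = 4 ^ N * 2 ^ N by rw [← mul_pow]; norm_num]
  generalize ∏ k ∈ Finset.range N, (((k : ℂ) + 1 / 2) ^ 2 - ν ^ 2) = P
  field_simp

/-- The density `e^{-t} t^{N+1/2} K_ν(t)` (with respect to `dt/t`, at `t = e^τ`) whose Stieltjes
transform is the remainder of the expansion of `K_ν`. -/
def besselDensity (N : ℕ) (ν : ℂ) (τ : ℝ) : ℂ :=
  Complex.exp (((N : ℂ) + 1 / 2) * τ - Real.exp τ) * macdonald ν τ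

theorem re_nat_add_half (N : ℕ) : ((N : ℂ) + 1 / 2).re = N + 1 / 2 := by
  simp

theorem integrable_besselDensity {N : ℕ} {ν : ℂ} (h : |ν.re| < N + 1 / 2) :
    Integrable (besselDensity N ν) :=
  integrable_moment (by rwa [re_nat_add_half])

theorem integral_besselDensity {N : ℕ} {ν : ℂ} (h : |ν.re| < N + 1 / 2) :
    ∫ τ, besselDensity N ν τ = (Real.sqrt (Real.pi / 2) : ℂ) / (2 ^ N * (N.factorial : ℂ)) *
      (Complex.Gamma (N + 1 / 2 + ν) * Complex.Gamma (N + 1 / 2 - ν)) := by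
  unfold besselDensity
  rw [integral_moment (by rwa [re_nat_add_half])]
  have hd := Complex.Gamma_mul_Gamma_add_half ((N : ℂ) + 1 / 2)
  rw [add_assoc, add_halves, Complex.Gamma_nat_eq_factorial] at hd
  have h2 : (N.factorial : ℂ) ≠ 0 := by exact_mod_cast N.factorial_ne_zero
  have hG : Complex.Gamma (2 * ((N : ℂ) + 1 / 2)) ≠ 0 := by
    apply Complex.Gamma_ne_zero_of_re_pos
    simp
    positivity
  have h3 : (2 : ℂ) ^ (1 - 2 * ((N : ℂ) + 1 / 2)) = (2 ^ N)⁻¹ * (2 ^ N)⁻¹ := by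
    rw [show 1 - 2 * ((N : ℂ) + 1 / 2) = -((2 * N : ℕ) : ℂ) by push_cast; ring,
      Complex.cpow_neg, Complex.cpow_natCast, two_mul, pow_add, mul_inv]
  have h4 : Complex.exp (((N : ℂ) + 1 / 2) * Real.log 2) = 2 ^ N * (Real.sqrt 2 : ℂ) := by
    rw [add_mul, Complex.exp_add, Complex.exp_nat_mul, exp_log_two, Real.sqrt_eq_rpow,
      Real.rpow_def_of_pos two_pos, Complex.ofReal_exp]
    congr 2
    push_cast
    ring
  have h5 : (Real.sqrt (Real.pi / 2) : ℂ) = (Real.sqrt 2 : ℂ) * (Real.sqrt Real.pi : ℂ) / 2 := by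
    rw [← Complex.ofReal_mul, ← Real.sqrt_mul (by norm_num),
      show Real.pi / 2 = 2 * Real.pi / 2 ^ 2 by ring, Real.sqrt_div (by positivity),
      Real.sqrt_sq (by norm_num)]
    push_cast
    rfl
  rw [h3] at hd
  rw [h4, h5]
  have h6 : Complex.Gamma ((N : ℂ) + 1 / 2) = Complex.Gamma (2 * ((N : ℂ) + 1 / 2)) *
      ((2 ^ N)⁻¹ * (2 ^ N)⁻¹) * (Real.sqrt Real.pi : ℂ) / (N.factorial : ℂ) := by
    rw [eq_div_iff h2, hd]
  rw [h6]
  generalize Complex.Gamma (2 * ((N : ℂ) + 1 / 2)) = G at *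
  generalize Complex.Gamma ((N : ℂ) + 1 / 2 + ν) = G₁
  generalize Complex.Gamma ((N : ℂ) + 1 / 2 - ν) = G₂
  field_simp

/-- The constant in front of the Stieltjes transform in the remainder of the expansion of `K_ν`. -/
def stokesConst (N : ℕ) (ν : ℂ) : ℂ :=
  (-1) ^ N * (Complex.cos (Real.pi * ν) / Real.pi) * (Real.sqrt (2 / Real.pi) : ℂ)

theorem sqrt_two_div_pi_mul :
    (Real.sqrt (2 / Real.pi) : ℂ) * (Real.sqrt (Real.pi / 2) : ℂ) = 1 := by
  rw [← Complex.ofReal_mul, ← Real.sqrt_mul (by positivity), div_mul_div_comm, mul_comm Real.pi,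
    div_self (by positivity), Real.sqrt_one, Complex.ofReal_one]

/-- The coefficient `a_N` is a moment of the density. -/
theorem stokesConst_mul_integral {N : ℕ} {ν : ℂ} (h : |ν.re| < N + 1 / 2) :
    stokesConst N ν * ∫ τ, besselDensity N ν τ = aCoeff N ν := by
  have hb := abs_lt.1 h
  have h1 : Complex.Gamma (N + 1 / 2 + ν) ≠ 0 :=
    Complex.Gamma_ne_zero_of_re_pos (by rw [Complex.add_re, re_nat_add_half]; linarith)
  have h2 : Complex.Gamma (N + 1 / 2 - ν) ≠ 0 :=
    Complex.Gamma_ne_zero_of_re_pos (by rw [Complex.sub_re, re_nat_add_half]; linarith)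
  rw [integral_besselDensity h, stokesConst, cos_div_pi_eq_prod ν N, aCoeff_eq_prod]
  generalize ∏ k ∈ Finset.range N, (((k : ℂ) + 1 / 2) ^ 2 - ν ^ 2) = P
  generalize Complex.Gamma ((N : ℂ) + 1 / 2 + ν) = G₁ at *
  generalize Complex.Gamma ((N : ℂ) + 1 / 2 - ν) = G₂ at *
  have h3 : (N.factorial : ℂ) ≠ 0 := by exact_mod_cast N.factorial_ne_zero
  have h4 := sqrt_two_div_pi_mul
  generalize (Real.sqrt (2 / Real.pi) : ℂ) = s at *
  generalize (Real.sqrt (Real.pi / 2) : ℂ) = t at *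
  field_simp
  linear_combination P * h4

/-! ### The remainder in the expansion of `K_ν` on the positive axis -/

theorem abs_im_ofReal_lt_pi (ξ : ℝ) : |(ξ : ℂ).im| < Real.pi := by
  simpa using Real.pi_pos

theorem hasDerivAt_besselDensity (N : ℕ) (ν : ℂ) (τ : ℝ) :
    HasDerivAt (besselDensity N ν) (((N : ℂ) + 1 / 2 + ν - Real.exp τ) * besselDensity N ν τ -
      besselDensity (N + 1) (ν + 1) τ) τ := by
  have h1 : HasDerivAt (fun τ : ℝ => ((N : ℂ) + 1 / 2) * τ - Real.exp τ)
      (((N : ℂ) + 1 / 2) * 1 - Real.exp τ) τ :=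
    ((Complex.ofRealCLM.hasDerivAt (x := τ)).const_mul _).sub
      (Real.hasDerivAt_exp τ).ofReal_comp
  have h2 := h1.cexp.mul (hasDerivAt_macdonald' ν τ)
  unfold besselDensity
  convert! h2 using 1
  rw [show (((N + 1 : ℕ) : ℂ) + 1 / 2) * τ - Real.exp τ =
    ((N : ℂ) + 1 / 2) * τ - Real.exp τ + τ by push_cast; ring, Complex.exp_add _ (τ : ℂ),
    ← Complex.ofReal_exp τ]
  ring

theorem hasDerivAt_besselDensity_succ (N : ℕ) (ν : ℂ) (τ : ℝ) :
    HasDerivAt (besselDensity (N + 1) (ν + 1)) (((N : ℂ) + 1 / 2 - ν - Real.exp τ) *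
      besselDensity (N + 1) (ν + 1) τ - Real.exp τ ^ 2 * besselDensity N ν τ) τ := by
  have h1 : HasDerivAt (fun τ : ℝ => (((N + 1 : ℕ) : ℂ) + 1 / 2) * τ - Real.exp τ)
      ((((N + 1 : ℕ) : ℂ) + 1 / 2) * 1 - Real.exp τ) τ :=
    ((Complex.ofRealCLM.hasDerivAt (x := τ)).const_mul _).sub
      (Real.hasDerivAt_exp τ).ofReal_comp
  have h2 := h1.cexp.mul (hasDerivAt_macdonald_succ ν τ)
  unfold besselDensity
  convert! h2 using 1
  rw [show (((N + 1 : ℕ) : ℂ) + 1 / 2) * τ - Real.exp τ =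
    ((N : ℂ) + 1 / 2) * τ - Real.exp τ + τ by push_cast; ring, Complex.exp_add _ (τ : ℂ),
    ← Complex.ofReal_exp τ]
  push_cast
  ring

/-- Integration by parts against the modified Bessel equation: the Stieltjes transforms with the
kernels `(1 + t/x)^{-j}`, `j = 1, 2, 3`, of `e^{-t} t^{N+1/2} K_ν(t)` are linearly related. -/
theorem stieltjes_besselDensity_relation {N : ℕ} {ν : ℂ} (h : |ν.re| < N + 1 / 2) (ξ : ℝ) :
    2 * Real.exp ξ * N * (∫ τ, besselDensity N ν τ) +
      (ν ^ 2 - 1 / 4 - N * (N - 1) - 2 * Real.exp ξ * (N - 1)) *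
        stieltjes (besselDensity N ν) 1 ξ +
      (2 - 2 * N - 2 * Real.exp ξ) * stieltjes (besselDensity N ν) 2 ξ -
      2 * stieltjes (besselDensity N ν) 3 ξ = 0 := by
  have hξ := abs_im_ofReal_lt_pi ξ
  set x : ℂ := (Real.exp ξ : ℂ) with hx
  set A := besselDensity N ν with hA
  set B := besselDensity (N + 1) (ν + 1) with hB
  have iA : Integrable A := integrable_besselDensity h
  have iB : Integrable B := integrable_besselDensity (by
    have := abs_lt.1 h
    rw [Complex.add_re, Complex.one_re]
    push_cast
    exact abs_lt.2 ⟨by linarith, by linarith⟩)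
  have iS := fun j => integrable_stieltjes iA j hξ
  have iT := integrable_stieltjes iB 1 hξ
  have hF : ∀ τ : ℝ, HasDerivAt (fun τ : ℝ => x * A τ
      + (ν - 1 / 2 - x - (N - 1)) * (A τ * (1 + Complex.exp (τ - ξ))⁻¹ ^ 1)
      - A τ * (1 + Complex.exp (τ - ξ))⁻¹ ^ 2 - B τ * (1 + Complex.exp (τ - ξ))⁻¹ ^ 1)
      (2 * x * N * A τ + (ν ^ 2 - 1 / 4 - N * (N - 1) - 2 * x * (N - 1)) *
        (A τ * (1 + Complex.exp (τ - ξ))⁻¹ ^ 1) +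
      (2 - 2 * N - 2 * x) * (A τ * (1 + Complex.exp (τ - ξ))⁻¹ ^ 2) -
      2 * (A τ * (1 + Complex.exp (τ - ξ))⁻¹ ^ 3)) τ := by
    intro τ
    have hne := one_add_exp_sub_ne_zero hξ τ
    have hr : HasDerivAt (fun τ : ℝ => (1 + Complex.exp ((τ : ℂ) - ξ))⁻¹)
        (-(Complex.exp (τ - ξ) * 1) / (1 + Complex.exp (τ - ξ)) ^ 2) τ :=
      HasDerivAt.fun_inv
        ((((Complex.ofRealCLM.hasDerivAt (x := τ)).sub_const (ξ : ℂ)).cexp).const_add 1)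
        hne
    have dA : HasDerivAt A _ τ := hasDerivAt_besselDensity N ν τ
    have dB : HasDerivAt B _ τ := hasDerivAt_besselDensity_succ N ν τ
    have := (((dA.const_mul x).add ((dA.mul (hr.pow 1)).const_mul (ν - 1 / 2 - x - (N - 1)))).sub
      (dA.mul (hr.pow 2))).sub (dB.mul (hr.pow 1))
    convert! this using 1
    rw [← hA, ← hB]
    simp only [Pi.pow_apply]
    have hX : (Real.exp τ : ℂ) = x * ((1 + Complex.exp ((τ : ℂ) - ξ)) - 1) := by
      rw [add_sub_cancel_left, hx, Complex.ofReal_exp, Complex.ofReal_exp, ← Complex.exp_add,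
        add_sub_cancel]
    have hX' : Complex.exp ((τ : ℂ) - ξ) = (1 + Complex.exp ((τ : ℂ) - ξ)) - 1 := by ring
    rw [hX]
    generalize hE : 1 + Complex.exp ((τ : ℂ) - ξ) = E at *
    rw [hX']
    generalize A τ = a
    generalize B τ = b
    simp only [Nat.reduceSub, pow_one, pow_zero]
    field_simp
    push_cast
    ring
  have key := integral_eq_zero_of_hasDerivAt_of_integrable hF
    ((((iA.const_mul _).add ((iS 1).const_mul _)).add ((iS 2).const_mul _)).sub
      ((iS 3).const_mul _))
    ((((iA.const_mul _).add ((iS 1).const_mul _)).sub (iS 2)).sub iT)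
  rw [integral_sub, integral_add, integral_add, integral_const_mul, integral_const_mul,
    integral_const_mul, integral_const_mul] at key
  · exact key
  · exact iA.const_mul _
  · exact (iS 1).const_mul _
  · exact (iA.const_mul _).add ((iS 1).const_mul _)
  · exact (iS 2).const_mul _
  · exact ((iA.const_mul _).add ((iS 1).const_mul _)).add ((iS 2).const_mul _)
  · exact (iS 3).const_mul _

/-- The bracket in the expansion of `K_ν`: the truncated asymptotic series plus its remainder. -/
def besselBracket (N : ℕ) (ν ζ : ℂ) : ℂ :=
  ∑ n ∈ Finset.range N, aCoeff n ν * Complex.exp (-n * ζ) +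
    stokesConst N ν * (Complex.exp (-N * ζ) * stieltjes (besselDensity N ν) 1 ζ)

/-- The derivative of the bracket in `log z`. -/
def besselBracketDeriv (N : ℕ) (ν ζ : ℂ) : ℂ :=
  ∑ n ∈ Finset.range N, -n * aCoeff n ν * Complex.exp (-n * ζ) +
    stokesConst N ν * (Complex.exp (-N * ζ) * ((1 - N) * stieltjes (besselDensity N ν) 1 ζ -
      stieltjes (besselDensity N ν) 2 ζ))

theorem hasDerivAt_exp_neg_nat_mul (n : ℕ) (ζ : ℂ) :
    HasDerivAt (fun ζ : ℂ => Complex.exp (-n * ζ)) (-n * Complex.exp (-n * ζ)) ζ := by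
  have := ((hasDerivAt_id ζ).const_mul (-n : ℂ)).cexp
  convert! this using 1
  simp only [id]
  ring

theorem hasDerivAt_besselBracket {N : ℕ} {ν : ℂ} (h : |ν.re| < N + 1 / 2) {ζ : ℂ}
    (hζ : |ζ.im| < Real.pi) :
    HasDerivAt (besselBracket N ν) (besselBracketDeriv N ν ζ) ζ := by
  have iA := integrable_besselDensity h
  have h1 : HasDerivAt (fun ζ : ℂ => ∑ n ∈ Finset.range N, aCoeff n ν * Complex.exp (-n * ζ))
      (∑ n ∈ Finset.range N, aCoeff n ν * (-n * Complex.exp (-n * ζ))) ζ :=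
    HasDerivAt.fun_sum fun n _ => (hasDerivAt_exp_neg_nat_mul n ζ).const_mul _
  have h2 := ((hasDerivAt_exp_neg_nat_mul N ζ).mul
    (hasDerivAt_stieltjes iA 1 hζ)).const_mul (stokesConst N ν)
  unfold besselBracketDeriv
  convert! h1.add h2 using 1
  congr 1
  · exact Finset.sum_congr rfl fun n _ => by ring
  · push_cast
    ring

/-- The truncated series solves the differential equation of `x^{1/2} e^x K_ν(x)` up to its last
term, which is what the remainder has to compensate. -/
theorem sum_aCoeff_ode (N : ℕ) (ν ζ : ℂ) :
    ∑ n ∈ Finset.range N, (n : ℂ) ^ 2 * aCoeff n ν * Complex.exp (-n * ζ) -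
      (2 * Complex.exp ζ + 1) * ∑ n ∈ Finset.range N, -n * aCoeff n ν * Complex.exp (-n * ζ) -
      (ν ^ 2 - 1 / 4) * ∑ n ∈ Finset.range N, aCoeff n ν * Complex.exp (-n * ζ) =
      -2 * N * aCoeff N ν * (Complex.exp ζ * Complex.exp (-N * ζ)) := by
  induction N with
  | zero => simp
  | succ N ih =>
    have hrec := aCoeff_succ N ν
    have he : Complex.exp ζ * Complex.exp (-((N + 1 : ℕ) : ℂ) * ζ) = Complex.exp (-N * ζ) := by
      rw [← Complex.exp_add]
      congr 1
      push_cast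
      ring
    rw [Finset.sum_range_succ, Finset.sum_range_succ, Finset.sum_range_succ, he]
    push_cast
    linear_combination ih + Complex.exp (-N * ζ) * hrec

/-- The bracket solves the equation `w'' - (2x + 1) w' = (ν² - 1/4) w` of `x^{1/2} e^x K_ν(x)`
(derivatives in `log x`). -/
theorem hasDerivAt_besselBracketDeriv {N : ℕ} {ν : ℂ} (h : |ν.re| < N + 1 / 2) (ξ : ℝ) :
    HasDerivAt (besselBracketDeriv N ν) ((2 * Complex.exp ξ + 1) * besselBracketDeriv N ν ξ +
      (ν ^ 2 - 1 / 4) * besselBracket N ν ξ) ξ := by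
  have hξ := abs_im_ofReal_lt_pi ξ
  have iA := integrable_besselDensity h
  have h1 : HasDerivAt (fun ζ : ℂ =>
      ∑ n ∈ Finset.range N, -n * aCoeff n ν * Complex.exp (-n * ζ))
      (∑ n ∈ Finset.range N, -n * aCoeff n ν * (-n * Complex.exp (-n * (ξ : ℂ)))) ξ :=
    HasDerivAt.fun_sum fun n _ => (hasDerivAt_exp_neg_nat_mul n ξ).const_mul _
  have h2 := ((hasDerivAt_exp_neg_nat_mul N (ξ : ℂ)).mul
    (((hasDerivAt_stieltjes iA 1 hξ).const_mul (1 - N : ℂ)).sub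
      (hasDerivAt_stieltjes iA 2 hξ))).const_mul (stokesConst N ν)
  have h3 := sum_aCoeff_ode N ν ξ
  have h4 := stieltjes_besselDensity_relation h ξ
  have h5 := stokesConst_mul_integral h
  convert! h1.add h2 using 1
  have h6 : ∑ n ∈ Finset.range N, -n * aCoeff n ν * (-n * Complex.exp (-n * (ξ : ℂ))) =
      ∑ n ∈ Finset.range N, (n : ℂ) ^ 2 * aCoeff n ν * Complex.exp (-n * (ξ : ℂ)) :=
    Finset.sum_congr rfl fun n _ => by ring
  rw [h6]
  unfold besselBracketDeriv besselBracket
  -- the term left over by the truncated series cancels because `a_N` is the moment of the density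
  rw [← h5] at h3
  rw [Complex.ofReal_exp] at h4
  simp only [Pi.sub_apply]
  push_cast
  linear_combination -h3 + stokesConst N ν * Complex.exp (-N * (ξ : ℂ)) * h4

/-- Wronskians of solutions of `f'' = p f` are constant. -/
theorem hasDerivAt_wronskian {f f₁ g g₁ : ℝ → ℂ} {p : ℂ} {τ : ℝ}
    (hf : HasDerivAt f (f₁ τ) τ) (hf₁ : HasDerivAt f₁ (p * f τ) τ)
    (hg : HasDerivAt g (g₁ τ) τ) (hg₁ : HasDerivAt g₁ (p * g τ) τ) :
    HasDerivAt (fun τ => f τ * g₁ τ - f₁ τ * g τ) 0 τ := by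
  convert! (hf.mul hg₁).sub (hf₁.mul hg) using 1
  ring

theorem hasDerivAt_macdonald_deriv (ν : ℂ) (τ : ℝ) :
    HasDerivAt (fun τ : ℝ => ν * macdonald ν τ - Real.exp τ * macdonald (ν + 1) τ)
      ((Real.exp τ ^ 2 + ν ^ 2) * macdonald ν τ) τ := by
  convert! ((hasDerivAt_macdonald' ν τ).const_mul ν).sub
    ((Real.hasDerivAt_exp τ).ofReal_comp.mul (hasDerivAt_macdonald_succ ν τ)) using 1
  ring

theorem hasDerivAt_besselI_deriv (ν : ℂ) (τ : ℝ) :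
    HasDerivAt (fun τ : ℝ => ν * besselI ν τ + Real.exp τ * besselI (ν + 1) τ)
      ((Real.exp τ ^ 2 + ν ^ 2) * besselI ν τ) τ := by
  convert! ((hasDerivAt_besselI ν τ).comp_ofReal.const_mul ν).add
    ((Real.hasDerivAt_exp τ).ofReal_comp.mul (hasDerivAt_besselI_succ ν τ).comp_ofReal) using 1
  rw [← Complex.ofReal_exp]
  ring

theorem tendsto_exp_neg_nat_mul {n : ℕ} (hn : n ≠ 0) :
    Tendsto (fun ξ : ℝ => Complex.exp (-n * (ξ : ℂ))) atTop (𝓝 0) := by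
  rw [tendsto_zero_iff_norm_tendsto_zero]
  have : ∀ ξ : ℝ, ‖Complex.exp (-n * (ξ : ℂ))‖ = Real.exp (-(n * ξ)) := by
    intro ξ
    rw [Complex.norm_exp]
    congr 1
    simp
  simp_rw [this]
  refine Real.tendsto_exp_neg_atTop_nhds_zero.comp ?_
  exact tendsto_id.const_mul_atTop (by positivity)

theorem tendsto_exp_neg_mul_stieltjes {N : ℕ} (hN : N ≠ 0) {Ψ : ℝ → ℂ} (hΨ : Integrable Ψ)
    (j : ℕ) : Tendsto (fun ξ : ℝ => Complex.exp (-N * (ξ : ℂ)) * stieltjes Ψ j ξ) atTop (𝓝 0) := by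
  refine (tendsto_exp_neg_nat_mul hN).zero_mul_isBoundedUnder_le ?_
  refine isBoundedUnder_of ⟨∫ τ, ‖Ψ τ‖, fun ξ => ?_⟩
  have := norm_stieltjes_le hΨ j (abs_im_ofReal_lt_pi ξ)
  simpa using this

theorem tendsto_besselBracket {N : ℕ} (hN : N ≠ 0) {ν : ℂ} (h : |ν.re| < N + 1 / 2) :
    Tendsto (fun ξ : ℝ => besselBracket N ν ξ) atTop (𝓝 1) := by
  have iA := integrable_besselDensity h
  obtain ⟨n, rfl⟩ := Nat.exists_eq_succ_of_ne_zero hN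
  have h1 : Tendsto (fun ξ : ℝ => ∑ k ∈ Finset.range n,
      aCoeff (k + 1) ν * Complex.exp (-((k + 1 : ℕ) : ℂ) * (ξ : ℂ))) atTop
      (𝓝 (∑ k ∈ Finset.range n, aCoeff (k + 1) ν * 0)) :=
    tendsto_finsetSum _ fun k _ => (tendsto_exp_neg_nat_mul k.succ_ne_zero).const_mul _
  have h2 := (tendsto_exp_neg_mul_stieltjes hN iA 1).const_mul (stokesConst (n + 1) ν)
  have h3 := (h1.add_const 1).add h2
  simp only [mul_zero, Finset.sum_const_zero, zero_add, add_zero] at h3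
  refine h3.congr fun ξ => ?_
  unfold besselBracket
  rw [Finset.sum_range_succ']
  simp [aCoeff_zero]

theorem tendsto_besselBracketDeriv {N : ℕ} (hN : N ≠ 0) {ν : ℂ} (h : |ν.re| < N + 1 / 2) :
    Tendsto (fun ξ : ℝ => besselBracketDeriv N ν ξ) atTop (𝓝 0) := by
  have iA := integrable_besselDensity h
  obtain ⟨n, rfl⟩ := Nat.exists_eq_succ_of_ne_zero hN
  have h1 : Tendsto (fun ξ : ℝ => ∑ k ∈ Finset.range n, -((k + 1 : ℕ) : ℂ) *
      aCoeff (k + 1) ν * Complex.exp (-((k + 1 : ℕ) : ℂ) * (ξ : ℂ))) atTop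
      (𝓝 (∑ k ∈ Finset.range n, -((k + 1 : ℕ) : ℂ) * aCoeff (k + 1) ν * 0)) :=
    tendsto_finsetSum _ fun k _ => (tendsto_exp_neg_nat_mul k.succ_ne_zero).const_mul _
  have h2 := (((tendsto_exp_neg_mul_stieltjes hN iA 1).const_mul (1 - (n + 1 : ℕ) : ℂ)).sub
    (tendsto_exp_neg_mul_stieltjes hN iA 2)).const_mul (stokesConst (n + 1) ν)
  have h3 := h1.add h2
  simp only [mul_zero, Finset.sum_const_zero, zero_add, sub_zero] at h3
  refine h3.congr fun ξ => ?_
  unfold besselBracketDeriv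
  rw [Finset.sum_range_succ']
  simp only [Nat.cast_zero, neg_zero, zero_mul, add_zero]
  ring

theorem tendsto_exp_mul_exp_neg_two_exp :
    Tendsto (fun ξ : ℝ => Complex.exp (-ξ / 2 - Complex.exp ξ) ^ 2 * Complex.exp ξ) atTop
      (𝓝 0) := by
  rw [tendsto_zero_iff_norm_tendsto_zero]
  have : ∀ ξ : ℝ, ‖Complex.exp (-ξ / 2 - Complex.exp ξ) ^ 2 * Complex.exp ξ‖ =
      Real.exp (-(2 * Real.exp ξ)) := by
    intro ξ
    rw [← Complex.exp_nat_mul, ← Complex.exp_add, ← Complex.norm_exp_ofReal]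
    congr 2
    push_cast
    ring
  simp_rw [this]
  exact Real.tendsto_exp_neg_atTop_nhds_zero.comp (Real.tendsto_exp_atTop.const_mul_atTop two_pos)

/-- The expansion of `K_ν` on the positive axis, with its remainder as a Stieltjes transform:
`K_ν(x) = (π/(2x))^{1/2} e^{-x}` times the bracket. The right-hand side is a recessive solution of
the modified Bessel equation, so it is a multiple of `K_ν`, and the factor is read off at `+∞`. -/
theorem macdonald_eq_besselBracket {N : ℕ} (hN : N ≠ 0) {ν : ℂ} (h : |ν.re| < N + 1 / 2) (ξ : ℝ) :
    macdonald ν ξ = (Real.sqrt (Real.pi / 2) : ℂ) * Complex.exp (-ξ / 2 - Complex.exp ξ) *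
      besselBracket N ν ξ := by
  set g : ℝ → ℂ := fun ξ => Complex.exp (-ξ / 2 - Complex.exp ξ) with hg
  set w : ℝ → ℂ := fun ξ => besselBracket N ν ξ with hw
  set w₁ : ℝ → ℂ := fun ξ => besselBracketDeriv N ν ξ with hw₁
  set G : ℝ → ℂ := fun ξ => g ξ * w ξ with hG
  set G₁ : ℝ → ℂ := fun ξ => g ξ * (w₁ ξ - (1 / 2 + Complex.exp ξ) * w ξ) with hG₁
  set k₁ : ℝ → ℂ := fun τ => ν * macdonald ν τ - Real.exp τ * macdonald (ν + 1) τ with hk₁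
  set I₁ : ℝ → ℂ := fun τ => ν * besselI ν τ + Real.exp τ * besselI (ν + 1) τ with hI₁
  have dexp : ∀ τ : ℝ, HasDerivAt (fun τ : ℝ => Complex.exp τ) (Complex.exp τ) τ := fun τ =>
    (Complex.hasDerivAt_exp (τ : ℂ)).comp_ofReal
  have dg : ∀ τ : ℝ, HasDerivAt g (g τ * (-1 / 2 - Complex.exp τ)) τ := fun τ =>
    (((Complex.ofRealCLM.hasDerivAt (x := τ)).neg.div_const 2).sub (dexp τ)).cexp
  have dw : ∀ τ : ℝ, HasDerivAt w (w₁ τ) τ := fun τ =>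
    (hasDerivAt_besselBracket h (abs_im_ofReal_lt_pi τ)).comp_ofReal
  have dw₁ : ∀ τ : ℝ, HasDerivAt w₁ ((2 * Complex.exp τ + 1) * w₁ τ + (ν ^ 2 - 1 / 4) * w τ) τ :=
    fun τ => (hasDerivAt_besselBracketDeriv h τ).comp_ofReal
  have dG : ∀ τ : ℝ, HasDerivAt G (G₁ τ) τ := fun τ => by
    convert! (dg τ).mul (dw τ) using 1
    simp only [hG₁]
    ring
  have dG₁ : ∀ τ : ℝ, HasDerivAt G₁ ((Real.exp τ ^ 2 + ν ^ 2) * G τ) τ := fun τ => by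
    convert! (dg τ).mul ((dw₁ τ).sub (((dexp τ).const_add (1 / 2)).mul (dw τ))) using 1
    simp only [hG, Pi.sub_apply, Pi.mul_apply, Complex.ofReal_exp]
    ring
  have dk : ∀ τ : ℝ, HasDerivAt (macdonald ν) (k₁ τ) τ := hasDerivAt_macdonald' ν
  have dk₁ := hasDerivAt_macdonald_deriv ν
  have dI : ∀ τ : ℝ, HasDerivAt (fun τ : ℝ => besselI ν τ) (I₁ τ) τ := fun τ => by
    convert! (hasDerivAt_besselI ν τ).comp_ofReal using 1
    simp only [hI₁, Complex.ofReal_exp]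
  have dI₁ := hasDerivAt_besselI_deriv ν
  have lw : Tendsto w atTop (𝓝 1) := tendsto_besselBracket hN h
  have lw₁ : Tendsto w₁ atTop (𝓝 0) := tendsto_besselBracketDeriv hN h
  have lk := tendsto_macdonald_atTop ν
  have lk' := tendsto_macdonald_atTop (ν + 1)
  have kg : ∀ (μ : ℂ) (τ : ℝ), macdonald μ τ =
      g τ * (Complex.exp (τ / 2 + Real.exp τ) * macdonald μ τ) := fun μ τ => by
    rw [← mul_assoc, ← Complex.exp_add]
    simp [neg_div]
  -- the Wronskian with `K_ν` is constant, and it vanishes at `+∞` because both solutions decay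
  have W0 : ∀ τ, G τ * k₁ τ - G₁ τ * macdonald ν τ = 0 := by
    refine eq_of_hasDerivAt_zero_of_tendsto (l := atTop)
      (fun τ => hasDerivAt_wronskian (dG τ) (dG₁ τ) (dk τ) (dk₁ τ)) ?_
    have hx0 : Tendsto (fun ξ : ℝ => Complex.exp (-ξ)) atTop (𝓝 0) := by
      simpa using tendsto_exp_neg_nat_mul one_ne_zero
    have lg : Tendsto (fun ξ : ℝ => g ξ ^ 2 * Complex.exp ξ) atTop (𝓝 0) :=
      tendsto_exp_mul_exp_neg_two_exp
    have := lg.mul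
      ((((lk.const_mul ν).mul hx0).sub lk').mul lw |>.sub
        (((lw₁.mul hx0).sub (((hx0.const_mul (1 / 2)).add_const 1).mul lw)).mul lk))
    rw [zero_mul] at this
    refine this.congr fun τ => ?_
    simp only [hG, hG₁, hk₁]
    have ka := kg ν τ
    have kb := kg (ν + 1) τ
    generalize Complex.exp (τ / 2 + Real.exp τ) * macdonald ν τ = a at ka ⊢
    generalize Complex.exp (τ / 2 + Real.exp τ) * macdonald (ν + 1) τ = b at kb ⊢
    rw [ka, kb]
    have he : Complex.exp (-τ) * Complex.exp τ = 1 := by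
      rw [← Complex.exp_add, neg_add_cancel, Complex.exp_zero]
    rw [Complex.ofReal_exp]
    linear_combination (g τ ^ 2) * (ν * a * w τ - w₁ τ * a + 1 / 2 * w τ * a) * he
  -- the Wronskian with `I_ν` is a constant `c`; since that of `I_ν` and `K_ν` is known, the two
  -- relations solve for `G = c K_ν`
  have WI : ∀ τ, HasDerivAt (fun τ : ℝ => G τ * I₁ τ - G₁ τ * besselI ν τ) 0 τ := fun τ =>
    hasDerivAt_wronskian (dG τ) (dG₁ τ) (dI τ) (dI₁ τ)
  have hc := is_const_of_deriv_eq_zero (fun τ => (WI τ).differentiableAt) fun τ => (WI τ).deriv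
  set c := G 0 * I₁ 0 - G₁ 0 * besselI ν (0 : ℝ) with hcdef
  have hGk : ∀ τ, G τ = c * macdonald ν τ := by
    intro τ
    have e1 := besselI_macdonald_wronskian ν τ
    have e2 := hc τ 0
    have e3 := W0 τ
    simp only [hk₁, hI₁] at e1 e2 e3
    rw [hcdef]
    linear_combination (-G τ) * e1 + macdonald ν τ * e2 - besselI ν τ * e3
  have hwk : ∀ τ : ℝ, w τ = c * (Complex.exp (τ / 2 + Real.exp τ) * macdonald ν τ) := by
    intro τ
    have e := hGk τ
    rw [kg ν τ] at e
    exact mul_left_cancel₀ (Complex.exp_ne_zero _) (show g τ * w τ = g τ * _ by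
      rw [← mul_assoc, mul_comm (g τ) c, mul_assoc]; exact e)
  have hc1 : 1 = c * (Real.sqrt (Real.pi / 2) : ℂ) :=
    tendsto_nhds_unique lw ((lk.const_mul c).congr fun τ => (hwk τ).symm)
  have := hGk ξ
  simp only [hG] at this
  rw [mul_assoc, this]
  linear_combination macdonald ν ξ * hc1

/-! ### Continuation in the argument and in the order, and the expansion of `K'_ν` -/

/-- The open strip of logarithms with `|arg z| < π`. -/
def openStrip : Set ℂ := {ζ : ℂ | |ζ.im| < Real.pi}

theorem isOpen_openStrip : IsOpen openStrip := isOpen_lt (by fun_prop) continuous_const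

theorem isPreconnected_openStrip : IsPreconnected openStrip := by
  refine Convex.isPreconnected fun a ha b hb s t hs ht hst => ?_
  simp only [openStrip, Set.mem_ofPred_eq] at *
  rw [abs_lt] at *
  simp only [Complex.add_im, Complex.smul_im, smul_eq_mul]
  rcases hs.eq_or_lt with rfl | hs
  · rw [zero_add] at hst; subst hst; simpa using hb
  · constructor <;> nlinarith [mul_nonneg ht (sub_nonneg.2 hb.2.le),
      mul_nonneg ht (sub_nonneg.2 hb.1.le), mul_pos hs (sub_pos.2 ha.1),
      mul_pos hs (sub_pos.2 ha.2)]

/-- The identity theorem on the strip: holomorphic functions that agree at the points of argument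
zero are equal. -/
theorem eqOn_openStrip {f g : ℂ → ℂ} (hf : DifferentiableOn ℂ f openStrip)
    (hg : DifferentiableOn ℂ g openStrip) (h : ∀ ξ : ℝ, f ξ = g ξ) : Set.EqOn f g openStrip := by
  refine (hf.analyticOnNhd isOpen_openStrip).eqOn_of_preconnected_of_frequently_eq
    (hg.analyticOnNhd isOpen_openStrip) isPreconnected_openStrip (z₀ := 0)
    (by simpa [openStrip] using Real.pi_pos) ?_
  have hin : Tendsto (fun t : ℝ => (t : ℂ)) (𝓝[≠] 0) (𝓝[≠] 0) := by
    refine tendsto_nhdsWithin_iff.2 ⟨?_, ?_⟩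
    · exact (by simpa using Complex.continuous_ofReal.tendsto 0 :
        Tendsto (fun t : ℝ => (t : ℂ)) (𝓝 0) (𝓝 0)).mono_left nhdsWithin_le_nhds
    · filter_upwards [self_mem_nhdsWithin] with t ht
      simpa using ht
  exact hin.frequently (Eventually.of_forall h).frequently

theorem pi_ne_zero_complex : (Real.pi : ℂ) ≠ 0 := by exact_mod_cast Real.pi_ne_zero

/-- The quotient `(π/2) (I_{-μ} - I_μ) / sin(πμ)`, which is `K_μ` off the integers. -/
def besselKQuot (μ ζ : ℂ) : ℂ :=
  (Real.pi / 2 : ℂ) * (besselI (-μ) ζ - besselI μ ζ) / Complex.sin (Real.pi * μ)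

theorem besselK_of_ne {ν : ℂ} (hν : Complex.sin (Real.pi * ν) ≠ 0) (ζ : ℂ) :
    besselK ν ζ = besselKQuot ν ζ := by
  simp [besselK, besselKQuot, hν]

theorem eventually_sin_ne_zero (ν : ℂ) : ∀ᶠ μ in 𝓝[≠] ν, Complex.sin (Real.pi * μ) ≠ 0 := by
  by_cases h : Complex.sin (Real.pi * ν) = 0
  · have hd : HasDerivAt (fun μ : ℂ => Complex.sin (Real.pi * μ))
        (Complex.cos (Real.pi * ν) * (Real.pi * 1)) ν := ((hasDerivAt_id ν).const_mul _).csin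
    refine hd.eventually_ne (c := 0) ?_
    have hc : Complex.cos (Real.pi * ν) ≠ 0 := by
      intro hc
      have := Complex.sin_sq_add_cos_sq (Real.pi * ν)
      rw [h, hc] at this
      norm_num at this
    exact mul_ne_zero hc (by simp)
  · exact eventually_nhdsWithin_of_eventually_nhds
      ((by fun_prop : Continuous fun μ : ℂ =>
        Complex.sin (Real.pi * μ)).continuousAt.eventually_ne h)

/-- To identify `K_ν(z)` it suffices to know a limit of the quotient at `ν`. -/
theorem besselK_eq_of_tendsto {ν ζ L : ℂ}
    (h : Tendsto (fun μ => besselKQuot μ ζ) (𝓝[≠] ν) (𝓝 L)) : besselK ν ζ = L := by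
  by_cases hν : Complex.sin (Real.pi * ν) = 0
  · have h1 : besselK ν ζ = limUnder (𝓝[≠] ν) fun μ => besselKQuot μ ζ := by
      simp [besselK, besselKQuot, hν]
    rw [h1, h.limUnder_eq]
  · rw [besselK_of_ne hν]
    refine tendsto_nhds_unique ?_ h
    have : ContinuousAt (fun μ => besselKQuot μ ζ) ν := by
      unfold besselKQuot
      exact (continuousAt_const.mul (((continuous_besselI_order ζ).comp
        continuous_neg).continuousAt.sub (continuous_besselI_order ζ).continuousAt)).div
        (by fun_prop) hν
    exact this.tendsto.mono_left nhdsWithin_le_nhds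

theorem prefK_eq (ζ : ℂ) : prefK ζ =
    (Real.sqrt (Real.pi / 2) : ℂ) * Complex.exp (-ζ / 2 - Complex.exp ζ) := by
  rw [prefK, sub_eq_add_neg, Complex.exp_add, mul_assoc]

theorem differentiable_prefK : Differentiable ℂ prefK := by
  unfold prefK
  fun_prop

theorem differentiableOn_besselBracket {N : ℕ} {ν : ℂ} (h : |ν.re| < N + 1 / 2) :
    DifferentiableOn ℂ (besselBracket N ν) openStrip := fun _ hζ =>
  (hasDerivAt_besselBracket h hζ).differentiableAt.differentiableWithinAt

theorem besselKQuot_eq_bracket {N : ℕ} (hN : N ≠ 0) {ν : ℂ} (h : |ν.re| < N + 1 / 2)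
    (hν : Complex.sin (Real.pi * ν) ≠ 0) {ζ : ℂ} (hζ : ζ ∈ openStrip) :
    besselKQuot ν ζ = prefK ζ * besselBracket N ν ζ := by
  refine eqOn_openStrip (f := besselKQuot ν) (g := fun ζ => prefK ζ * besselBracket N ν ζ)
    (Differentiable.differentiableOn ?_)
    (differentiable_prefK.differentiableOn.mul (differentiableOn_besselBracket h)) (fun ξ => ?_) hζ
  · unfold besselKQuot
    exact (((differentiable_besselI _).sub (differentiable_besselI _)).const_mul _).div_const _
  · rw [← besselK_of_ne hν, besselK_ofReal hν, macdonald_eq_besselBracket hN h, prefK_eq]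

theorem norm_besselDensity_le {N : ℕ} {μ : ℂ} {s : ℝ} (h : |μ.re| ≤ s) (τ : ℝ) :
    ‖besselDensity N μ τ‖ ≤ 2 * ‖besselDensity N (s : ℂ) τ‖ := by
  unfold besselDensity
  rw [norm_mul, norm_mul, ← ofReal_macdonaldReal, Complex.norm_real,
    Real.norm_of_nonneg (macdonaldReal_nonneg _ _), mul_left_comm]
  gcongr
  exact (norm_macdonald_le μ τ).trans (macdonaldReal_le h τ)

theorem continuousAt_stieltjes_order {N : ℕ} {ν : ℂ} (h : |ν.re| < N + 1 / 2) {ζ : ℂ}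
    (hζ : ζ ∈ openStrip) :
    ContinuousAt (fun μ => stieltjes (besselDensity N μ) 1 ζ) ν := by
  obtain ⟨s, hs1, hs2⟩ := exists_between h
  have hs0 : 0 ≤ s := (abs_nonneg _).trans hs1.le
  have is : Integrable (besselDensity N (s : ℂ)) :=
    integrable_besselDensity (by rwa [Complex.ofReal_re, abs_of_nonneg hs0])
  have hev : ∀ᶠ μ : ℂ in 𝓝 ν, |μ.re| < s :=
    (by fun_prop : Continuous fun μ : ℂ => |μ.re|).continuousAt.eventually_lt continuousAt_const hs1
  refine continuousAt_of_dominated (bound := fun τ =>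
    (Real.cos (|ζ.im| / 2))⁻¹ ^ 1 * (2 * ‖besselDensity N (s : ℂ) τ‖)) ?_ ?_
    ((is.norm.const_mul _).const_mul _) (ae_of_all _ fun τ => ?_)
  · filter_upwards [hev] with μ hμ
    exact aestronglyMeasurable_stieltjes_integrand (integrable_besselDensity (hμ.trans hs2)) 1 ζ
  · filter_upwards [hev] with μ hμ
    refine ae_of_all _ fun τ => (norm_stieltjes_integrand_le 1 le_rfl hζ τ).trans ?_
    have := cos_half_pos (y := |ζ.im|) (by rw [abs_abs]; exact hζ)
    gcongr
    exact norm_besselDensity_le hμ.le τ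
  · unfold besselDensity
    exact ((continuous_const.mul (continuous_macdonald_order τ)).mul
      continuous_const).continuousAt

theorem continuousAt_besselBracket_order {N : ℕ} {ν : ℂ} (h : |ν.re| < N + 1 / 2) {ζ : ℂ}
    (hζ : ζ ∈ openStrip) : ContinuousAt (fun μ => besselBracket N μ ζ) ν := by
  have h1 : Continuous fun μ : ℂ => ∑ n ∈ Finset.range N, aCoeff n μ * Complex.exp (-n * ζ) := by
    unfold aCoeff
    fun_prop
  have h2 : Continuous fun μ : ℂ => stokesConst N μ := by
    unfold stokesConst
    fun_prop
  unfold besselBracket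
  exact h1.continuousAt.add (h2.continuousAt.mul
    (continuousAt_const.mul (continuousAt_stieltjes_order h hζ)))

/-- The limit defining `K_ν` at integer orders exists on the strip, since the expansion with its
remainder is continuous in the order. -/
theorem tendsto_besselKQuot_bracket {N : ℕ} (hN : N ≠ 0) {ν : ℂ} (h : |ν.re| < N + 1 / 2) {ζ : ℂ}
    (hζ : ζ ∈ openStrip) :
    Tendsto (fun μ => besselKQuot μ ζ) (𝓝[≠] ν) (𝓝 (prefK ζ * besselBracket N ν ζ)) := by
  have h1 : ContinuousAt (fun μ => prefK ζ * besselBracket N μ ζ) ν :=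
    continuousAt_const.mul (continuousAt_besselBracket_order h hζ)
  refine (h1.tendsto.mono_left nhdsWithin_le_nhds).congr' ?_
  have hev : ∀ᶠ μ : ℂ in 𝓝 ν, |μ.re| < N + 1 / 2 :=
    (by fun_prop : Continuous fun μ : ℂ => |μ.re|).continuousAt.eventually_lt continuousAt_const h
  filter_upwards [eventually_sin_ne_zero ν, nhdsWithin_le_nhds hev] with μ hμ hμ2
  exact (besselKQuot_eq_bracket hN hμ2 hμ hζ).symm

/-- The expansion of `K_ν(z)` with its remainder, for `|arg z| < π` and every order. -/
theorem besselK_eq_bracket {N : ℕ} (hN : N ≠ 0) {ν : ℂ} (h : |ν.re| < N + 1 / 2) {ζ : ℂ}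
    (hζ : ζ ∈ openStrip) : besselK ν ζ = prefK ζ * besselBracket N ν ζ :=
  besselK_eq_of_tendsto (tendsto_besselKQuot_bracket hN h hζ)

theorem exists_nat_order_bound (ν : ℂ) : ∃ N : ℕ, N ≠ 0 ∧ |ν.re| < N + 1 / 2 := by
  obtain ⟨n, hn⟩ := exists_nat_ge |ν.re|
  exact ⟨n + 1, n.succ_ne_zero, by push_cast; linarith⟩

theorem tendsto_besselKQuot_of_mem {ζ : ℂ} (hζ : ζ ∈ openStrip) (ν : ℂ) :
    Tendsto (fun μ => besselKQuot μ ζ) (𝓝[≠] ν) (𝓝 (besselK ν ζ)) := by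
  obtain ⟨N, hN, h⟩ := exists_nat_order_bound ν
  rw [besselK_eq_bracket hN h hζ]
  exact tendsto_besselKQuot_bracket hN h hζ

theorem differentiableOn_besselK (ν : ℂ) : DifferentiableOn ℂ (besselK ν) openStrip := by
  obtain ⟨N, hN, h⟩ := exists_nat_order_bound ν
  exact (differentiable_prefK.differentiableOn.mul (differentiableOn_besselBracket h)).congr
    fun ζ hζ => besselK_eq_bracket hN h hζ

theorem ofReal_mem_openStrip (ξ : ℝ) : (ξ : ℂ) ∈ openStrip := abs_im_ofReal_lt_pi ξ

theorem besselK_ofReal_eq_macdonald (ν : ℂ) (ξ : ℝ) : besselK ν ξ = macdonald ν ξ := by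
  obtain ⟨N, hN, h⟩ := exists_nat_order_bound ν
  rw [besselK_eq_bracket hN h (ofReal_mem_openStrip ξ), macdonald_eq_besselBracket hN h, prefK_eq]

/-- `K'_ν = -(K_{ν+1} + K_{ν-1})/2` for `|arg z| < π`. -/
theorem besselK'_eq_neg_half {ζ : ℂ} (hζ : ζ ∈ openStrip) (ν : ℂ) :
    besselK' ν ζ = -(besselK (ν + 1) ζ + besselK (ν - 1) ζ) / 2 := by
  have key : Set.EqOn (deriv (besselK ν))
      (fun ζ => -(Complex.exp ζ / 2) * (besselK (ν + 1) ζ + besselK (ν - 1) ζ)) openStrip := by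
    refine eqOn_openStrip ((differentiableOn_besselK ν).deriv isOpen_openStrip)
      (DifferentiableOn.mul (by fun_prop)
        ((differentiableOn_besselK _).add (differentiableOn_besselK _))) fun ξ => ?_
    have h1 := ((differentiableOn_besselK ν).differentiableAt
      (isOpen_openStrip.mem_nhds (ofReal_mem_openStrip ξ))).hasDerivAt.comp_ofReal
    simp_rw [besselK_ofReal_eq_macdonald] at h1 ⊢
    rw [h1.unique (hasDerivAt_macdonald ν ξ), Complex.ofReal_exp]
  rw [besselK', zDeriv, key hζ, Complex.exp_neg]
  field_simp [Complex.exp_ne_zero]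

theorem besselI_add_pi_mul_I (μ ζ : ℂ) :
    besselI μ (ζ + Real.pi * Complex.I) = Complex.exp (Real.pi * Complex.I * μ) * besselI μ ζ := by
  rw [besselI_eq, besselI_eq, show 2 * (ζ + Real.pi * Complex.I - Real.log 2) =
    2 * (ζ - Real.log 2) + 2 * Real.pi * Complex.I by ring, Complex.exp_periodic, ← mul_assoc,
    ← Complex.exp_add]
  congr 2
  ring

/-- The connection formula `K_μ(z e^{πi}) = e^{-πiμ} K_μ(z) - πi I_μ(z)`. -/
theorem besselKQuot_add_pi_mul_I {μ : ℂ} (hμ : Complex.sin (Real.pi * μ) ≠ 0) (ζ : ℂ) :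
    besselKQuot μ (ζ + Real.pi * Complex.I) =
      Complex.exp (-(Real.pi * Complex.I * μ)) * besselKQuot μ ζ -
        Real.pi * Complex.I * besselI μ ζ := by
  unfold besselKQuot
  rw [besselI_add_pi_mul_I, besselI_add_pi_mul_I, mul_neg]
  field_simp
  have hs : Complex.exp (Real.pi * Complex.I * μ) - Complex.exp (-(Real.pi * Complex.I * μ)) =
      2 * Complex.I * Complex.sin (Real.pi * μ) := by
    rw [Complex.sin, show -(Real.pi * μ) * Complex.I = -(Real.pi * Complex.I * μ) by ring,
      show Real.pi * μ * Complex.I = Real.pi * Complex.I * μ by ring]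
    linear_combination (Complex.exp (Real.pi * Complex.I * μ) -
      Complex.exp (-(Real.pi * Complex.I * μ))) * Complex.I_mul_I
  linear_combination -besselI μ ζ * hs

theorem tendsto_besselKQuot_add {ζ : ℂ} (hζ : ζ ∈ openStrip) (ν : ℂ) :
    Tendsto (fun μ => besselKQuot μ (ζ + Real.pi * Complex.I)) (𝓝[≠] ν)
      (𝓝 (Complex.exp (-(Real.pi * Complex.I * ν)) * besselK ν ζ -
        Real.pi * Complex.I * besselI ν ζ)) := by
  have h1 : Tendsto (fun μ : ℂ => Complex.exp (-(Real.pi * Complex.I * μ))) (𝓝[≠] ν)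
      (𝓝 (Complex.exp (-(Real.pi * Complex.I * ν)))) :=
    ((by fun_prop : Continuous fun μ : ℂ => Complex.exp (-(Real.pi * Complex.I * μ))).tendsto
      ν).mono_left nhdsWithin_le_nhds
  have h2 : Tendsto (fun μ : ℂ => besselI μ ζ) (𝓝[≠] ν) (𝓝 (besselI ν ζ)) :=
    ((continuous_besselI_order ζ).tendsto ν).mono_left nhdsWithin_le_nhds
  refine ((h1.mul (tendsto_besselKQuot_of_mem hζ ν)).sub (h2.const_mul _)).congr' ?_
  filter_upwards [eventually_sin_ne_zero ν] with μ hμ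
  exact (besselKQuot_add_pi_mul_I hμ ζ).symm

theorem tendsto_besselKQuot_sub {ζ : ℂ} (hζ : ζ ∈ openStrip) (ν : ℂ) :
    Tendsto (fun μ => besselKQuot μ (ζ - Real.pi * Complex.I)) (𝓝[≠] ν)
      (𝓝 (Complex.exp (Real.pi * Complex.I * ν) * (besselK ν ζ +
        Real.pi * Complex.I * besselI ν (ζ - Real.pi * Complex.I)))) := by
  have h1 : Tendsto (fun μ : ℂ => Complex.exp (Real.pi * Complex.I * μ)) (𝓝[≠] ν)
      (𝓝 (Complex.exp (Real.pi * Complex.I * ν))) :=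
    ((by fun_prop : Continuous fun μ : ℂ => Complex.exp (Real.pi * Complex.I * μ)).tendsto
      ν).mono_left nhdsWithin_le_nhds
  have h2 : Tendsto (fun μ : ℂ => besselI μ (ζ - Real.pi * Complex.I)) (𝓝[≠] ν)
      (𝓝 (besselI ν (ζ - Real.pi * Complex.I))) :=
    ((continuous_besselI_order _).tendsto ν).mono_left nhdsWithin_le_nhds
  refine (h1.mul ((tendsto_besselKQuot_of_mem hζ ν).add (h2.const_mul _))).congr' ?_
  filter_upwards [eventually_sin_ne_zero ν] with μ hμ
  have h3 := besselKQuot_add_pi_mul_I hμ (ζ - Real.pi * Complex.I)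
  rw [sub_add_cancel] at h3
  rw [h3, sub_add_cancel, ← mul_assoc, ← Complex.exp_add, add_neg_cancel, Complex.exp_zero, one_mul]

theorem sub_pi_mem_openStrip {ζ : ℂ} (h0 : 0 < ζ.im) (h1 : ζ.im < 2 * Real.pi) :
    ζ - Real.pi * Complex.I ∈ openStrip := by
  simp only [openStrip, Set.mem_ofPred_eq, abs_lt]
  simp
  constructor <;> linarith

theorem add_pi_mem_openStrip {ζ : ℂ} (h0 : ζ.im < 0) (h1 : -(2 * Real.pi) < ζ.im) :
    ζ + Real.pi * Complex.I ∈ openStrip := by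
  simp only [openStrip, Set.mem_ofPred_eq, abs_lt]
  simp
  constructor <;> linarith

/-- The strip `|arg z| < 2π`, a neighbourhood of the closed sector `|arg z| ≤ π`. -/
def doubleStrip : Set ℂ := {ζ : ℂ | |ζ.im| < 2 * Real.pi}

theorem isOpen_doubleStrip : IsOpen doubleStrip := isOpen_lt (by fun_prop) continuous_const

theorem tendsto_besselKQuot {ζ : ℂ} (hζ : ζ ∈ doubleStrip) (ν : ℂ) :
    Tendsto (fun μ => besselKQuot μ ζ) (𝓝[≠] ν) (𝓝 (besselK ν ζ)) := by
  have hb := abs_lt.1 (show |ζ.im| < 2 * Real.pi from hζ)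
  suffices h : ∃ L, Tendsto (fun μ => besselKQuot μ ζ) (𝓝[≠] ν) (𝓝 L) by
    obtain ⟨L, hL⟩ := h
    rwa [besselK_eq_of_tendsto hL]
  rcases lt_trichotomy ζ.im 0 with h | h | h
  · have := tendsto_besselKQuot_sub (add_pi_mem_openStrip h hb.1) ν
    rw [add_sub_cancel_right] at this
    exact ⟨_, this⟩
  · exact ⟨_, tendsto_besselKQuot_of_mem (by simp [openStrip, h, Real.pi_pos]) ν⟩
  · have := tendsto_besselKQuot_add (sub_pi_mem_openStrip h hb.2) ν
    rw [sub_add_cancel] at this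
    exact ⟨_, this⟩

theorem differentiableOn_besselK_doubleStrip (ν : ℂ) :
    DifferentiableOn ℂ (besselK ν) doubleStrip := by
  intro ζ hζ
  refine DifferentiableAt.differentiableWithinAt ?_
  have hb := abs_lt.1 (show |ζ.im| < 2 * Real.pi from hζ)
  have dI := differentiable_besselI ν
  have dK : ∀ w ∈ openStrip, DifferentiableAt ℂ (besselK ν) w := fun w hw =>
    (differentiableOn_besselK ν).differentiableAt (isOpen_openStrip.mem_nhds hw)
  rcases lt_trichotomy ζ.im 0 with h | h | h
  · have hm := add_pi_mem_openStrip h hb.1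
    have hev : ∀ᶠ w in 𝓝 ζ, w + Real.pi * Complex.I ∈ openStrip :=
      (by fun_prop : Continuous fun w : ℂ => w + Real.pi * Complex.I).continuousAt
        (isOpen_openStrip.mem_nhds hm)
    have h1 : DifferentiableAt ℂ (fun w => Complex.exp (Real.pi * Complex.I * ν) *
        (besselK ν (w + Real.pi * Complex.I) + Real.pi * Complex.I * besselI ν w)) ζ := by
      refine (DifferentiableAt.add ?_ (dI.differentiableAt.const_mul _)).const_mul _
      exact (dK _ hm).comp ζ (by fun_prop : DifferentiableAt ℂ (fun w => w + Real.pi * Complex.I) ζ)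
    refine h1.congr_of_eventuallyEq ?_
    filter_upwards [hev] with w hw
    have := tendsto_besselKQuot_sub hw ν
    rw [add_sub_cancel_right] at this
    exact besselK_eq_of_tendsto this
  · exact dK _ (by simp [openStrip, h, Real.pi_pos])
  · have hm := sub_pi_mem_openStrip h hb.2
    have hev : ∀ᶠ w in 𝓝 ζ, w - Real.pi * Complex.I ∈ openStrip :=
      (by fun_prop : Continuous fun w : ℂ => w - Real.pi * Complex.I).continuousAt
        (isOpen_openStrip.mem_nhds hm)
    have h1 : DifferentiableAt ℂ (fun w => Complex.exp (-(Real.pi * Complex.I * ν)) *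
        besselK ν (w - Real.pi * Complex.I) -
          Real.pi * Complex.I * besselI ν (w - Real.pi * Complex.I)) ζ := by
      have hs : DifferentiableAt ℂ (fun w => w - Real.pi * Complex.I) ζ := by fun_prop
      exact (((dK _ hm).comp ζ hs).const_mul _).sub ((dI.differentiableAt.comp ζ hs).const_mul _)
    refine h1.congr_of_eventuallyEq ?_
    filter_upwards [hev] with w hw
    have := tendsto_besselKQuot_add hw ν
    rw [sub_add_cancel] at this
    exact besselK_eq_of_tendsto this

theorem continuousOn_besselK' (ν : ℂ) : ContinuousOn (besselK' ν) doubleStrip := by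
  unfold besselK' zDeriv
  exact (by fun_prop : Continuous fun ζ : ℂ => Complex.exp (-ζ)).continuousOn.mul
    ((differentiableOn_besselK_doubleStrip ν).deriv isOpen_doubleStrip).continuousOn

/-- `b_n(ν) = (a_n(ν+1) + a_n(ν-1))/2`, as both `a_n(ν ± 1)` contain the product in `b_n(ν)`. -/
theorem bCoeff_eq (n : ℕ) (ν : ℂ) : bCoeff n ν = (aCoeff n (ν + 1) + aCoeff n (ν - 1)) / 2 := by
  have h : ∀ (n : ℕ) (μ : ℂ),
      ∏ k ∈ Finset.range (n + 1), (4 * (μ + 1) ^ 2 - (2 * (k : ℂ) + 1) ^ 2) =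
      (∏ k ∈ Finset.range n, (4 * μ ^ 2 - (2 * (k : ℂ) + 1) ^ 2)) *
        ((2 * μ + 2 * n + 1) * (2 * μ + 2 * n + 3)) := by
    intro n μ
    induction n with
    | zero => simp; ring
    | succ n ih =>
      rw [Finset.prod_range_succ, ih, Finset.prod_range_succ]
      push_cast
      ring
  rcases n with _ | n
  · simp [bCoeff, aCoeff_zero]
  · have h1 := h n ν
    have h2 := h n (-ν)
    have h3 : ∀ k ∈ Finset.range (n + 1), 4 * (-ν + 1) ^ 2 - (2 * (k : ℂ) + 1) ^ 2 =
      4 * (ν - 1) ^ 2 - (2 * (k : ℂ) + 1) ^ 2 := fun k _ => by ring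
    rw [Finset.prod_congr rfl h3] at h2
    simp only [neg_sq] at h2
    have h4 : bCoeff (n + 1) ν = (∏ k ∈ Finset.range n, (4 * ν ^ 2 - (2 * (k : ℂ) + 1) ^ 2)) *
      (4 * ν ^ 2 + 4 * ((n : ℂ) + 1) ^ 2 - 1) / (8 ^ (n + 1) * ((n + 1).factorial : ℂ)) := rfl
    rw [h4, aCoeff, aCoeff, h1, h2]
    generalize ∏ k ∈ Finset.range n, (4 * ν ^ 2 - (2 * (k : ℂ) + 1) ^ 2) = P
    ring

/-- The density `-e^{-t} t^{N+1/2} K'_ν(t)` (with respect to `dt/t`, at `t = e^τ`). -/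
def derivDensity (N : ℕ) (ν : ℂ) (τ : ℝ) : ℂ :=
  (besselDensity N (ν + 1) τ + besselDensity N (ν - 1) τ) / 2

theorem abs_re_add_one_lt {ν : ℂ} {x : ℝ} (h : |ν.re| < x - 1 / 2) :
    |(ν + 1).re| < x + 1 / 2 := by
  have := abs_lt.1 h
  rw [Complex.add_re, Complex.one_re]
  exact abs_lt.2 ⟨by linarith, by linarith⟩

theorem abs_re_sub_one_lt {ν : ℂ} {x : ℝ} (h : |ν.re| < x - 1 / 2) :
    |(ν - 1).re| < x + 1 / 2 := by
  have := abs_lt.1 h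
  rw [Complex.sub_re, Complex.one_re]
  exact abs_lt.2 ⟨by linarith, by linarith⟩

theorem integrable_derivDensity {N : ℕ} {ν : ℂ} (h : |ν.re| < N - 1 / 2) :
    Integrable (derivDensity N ν) :=
  ((integrable_besselDensity (abs_re_add_one_lt h)).add
    (integrable_besselDensity (abs_re_sub_one_lt h))).div_const 2

theorem stokesConst_add_one (N : ℕ) (ν : ℂ) : stokesConst N (ν + 1) = -stokesConst N ν := by
  unfold stokesConst
  rw [mul_add, mul_one, Complex.cos_add_pi]
  ring

theorem stokesConst_sub_one (N : ℕ) (ν : ℂ) : stokesConst N (ν - 1) = -stokesConst N ν := by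
  unfold stokesConst
  rw [mul_sub, mul_one, Complex.cos_sub_pi]
  ring

/-- The coefficient `b_N` is a moment of the density. -/
theorem bCoeff_eq_integral {N : ℕ} {ν : ℂ} (h : |ν.re| < N - 1 / 2) :
    bCoeff N ν = -stokesConst N ν * ∫ τ, derivDensity N ν τ := by
  unfold derivDensity
  rw [bCoeff_eq, ← stokesConst_mul_integral (abs_re_add_one_lt h),
    ← stokesConst_mul_integral (abs_re_sub_one_lt h), integral_div,
    integral_add (integrable_besselDensity (abs_re_add_one_lt h))
      (integrable_besselDensity (abs_re_sub_one_lt h)), stokesConst_add_one, stokesConst_sub_one]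
  ring

theorem exp_neg_nat_mul_eq (n : ℕ) (ζ : ℂ) : Complex.exp (-n * ζ) = 1 / Complex.exp ζ ^ n := by
  rw [neg_mul, Complex.exp_neg, Complex.exp_nat_mul, one_div]

theorem stieltjes_derivDensity {N : ℕ} {ν : ℂ} (h : |ν.re| < N - 1 / 2) {ζ : ℂ}
    (hζ : ζ ∈ openStrip) : stieltjes (derivDensity N ν) 1 ζ =
      (stieltjes (besselDensity N (ν + 1)) 1 ζ + stieltjes (besselDensity N (ν - 1)) 1 ζ) / 2 := by
  unfold stieltjes derivDensity
  rw [← integral_add (integrable_stieltjes (integrable_besselDensity (abs_re_add_one_lt h)) 1 hζ)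
    (integrable_stieltjes (integrable_besselDensity (abs_re_sub_one_lt h)) 1 hζ), ← integral_div]
  congr 1
  ext τ
  ring

/-- The remainder `R_N^{(K')}` as a Stieltjes transform. -/
theorem remK'_eq {N : ℕ} (hN : N ≠ 0) {ν : ℂ} (h : |ν.re| < N - 1 / 2) {ζ : ℂ}
    (hζ : ζ ∈ openStrip) :
    remK' N ζ ν = -stokesConst N ν * (1 / Complex.exp ζ ^ N) *
      stieltjes (derivDensity N ν) 1 ζ := by
  unfold remK'
  rw [besselK'_eq_neg_half hζ, besselK_eq_bracket hN (abs_re_add_one_lt h) hζ,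
    besselK_eq_bracket hN (abs_re_sub_one_lt h) hζ, stieltjes_derivDensity h hζ]
  have h1 : ∑ n ∈ Finset.range N, bCoeff n ν / Complex.exp ζ ^ n =
      (∑ n ∈ Finset.range N, aCoeff n (ν + 1) * Complex.exp (-n * ζ) +
        ∑ n ∈ Finset.range N, aCoeff n (ν - 1) * Complex.exp (-n * ζ)) / 2 := by
    rw [← Finset.sum_add_distrib, Finset.sum_div]
    refine Finset.sum_congr rfl fun n _ => ?_
    rw [bCoeff_eq, exp_neg_nat_mul_eq]
    ring
  rw [h1]
  unfold besselBracket
  rw [stokesConst_add_one, stokesConst_sub_one, exp_neg_nat_mul_eq N]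
  have := prefK_ne_zero ζ
  generalize ∑ n ∈ Finset.range N, aCoeff n (ν + 1) * Complex.exp (-n * ζ) = S₁
  generalize ∑ n ∈ Finset.range N, aCoeff n (ν - 1) * Complex.exp (-n * ζ) = S₂
  field_simp
  ring

/-! ### Basic terminants as Stieltjes transforms -/

/-- The density `t^p e^{-t}` (with respect to `dt/t`, at `t = e^τ`). -/
def gammaDensity (p : ℂ) (τ : ℝ) : ℂ := Complex.exp (p * τ - Real.exp τ)

theorem integrable_gammaDensity {p : ℂ} (hp : 0 < p.re) : Integrable (gammaDensity p) :=
  integrable_gammaKernel hp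

theorem integral_gammaDensity {p : ℂ} (hp : 0 < p.re) : ∫ τ, gammaDensity p τ = Complex.Gamma p :=
  integral_gammaKernel hp

/-- Integration by parts for the Stieltjes transform of `t^p e^{-t}`. -/
theorem stieltjes_gammaDensity_relation {p : ℂ} (hp : 0 < p.re) {ζ : ℂ} (hζ : ζ ∈ openStrip) :
    (p - 1 + Complex.exp ζ) * stieltjes (gammaDensity p) 1 ζ + stieltjes (gammaDensity p) 2 ζ =
      Complex.exp ζ * Complex.Gamma p := by
  have iA := integrable_gammaDensity hp
  have iS := fun j => integrable_stieltjes iA j hζ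
  have hF : ∀ τ : ℝ, HasDerivAt (fun τ : ℝ => gammaDensity p τ * (1 + Complex.exp (τ - ζ))⁻¹ ^ 1)
      ((p - 1 + Complex.exp ζ) * (gammaDensity p τ * (1 + Complex.exp (τ - ζ))⁻¹ ^ 1) +
        gammaDensity p τ * (1 + Complex.exp (τ - ζ))⁻¹ ^ 2 -
        Complex.exp ζ * gammaDensity p τ) τ := by
    intro τ
    have hne := one_add_exp_sub_ne_zero hζ τ
    have hr : HasDerivAt (fun τ : ℝ => (1 + Complex.exp ((τ : ℂ) - ζ))⁻¹)
        (-(Complex.exp (τ - ζ) * 1) / (1 + Complex.exp (τ - ζ)) ^ 2) τ :=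
      HasDerivAt.fun_inv
        ((((Complex.ofRealCLM.hasDerivAt (x := τ)).sub_const ζ).cexp).const_add 1) hne
    have hA : HasDerivAt (gammaDensity p)
        (Complex.exp (p * τ - Real.exp τ) * (p * 1 - Real.exp τ)) τ :=
      (((Complex.ofRealCLM.hasDerivAt (x := τ)).const_mul p).sub
        (Real.hasDerivAt_exp τ).ofReal_comp).cexp
    have := hA.mul (hr.pow 1)
    convert! this using 1
    simp only [Pi.pow_apply, gammaDensity]
    have hX : (Real.exp τ : ℂ) = Complex.exp ζ * ((1 + Complex.exp ((τ : ℂ) - ζ)) - 1) := by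
      rw [add_sub_cancel_left, Complex.ofReal_exp, ← Complex.exp_add, add_sub_cancel]
    generalize Complex.exp (p * τ - Real.exp τ) = a
    rw [hX]
    have hX' : Complex.exp ((τ : ℂ) - ζ) = (1 + Complex.exp ((τ : ℂ) - ζ)) - 1 := by ring
    generalize hE : 1 + Complex.exp ((τ : ℂ) - ζ) = E at *
    rw [hX']
    simp only [Nat.reduceSub, pow_one, pow_zero]
    field_simp
    push_cast
    ring
  have key := integral_eq_zero_of_hasDerivAt_of_integrable hF
    ((((iS 1).const_mul _).add (iS 2)).sub (iA.const_mul _)) (iS 1)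
  rw [integral_sub, integral_add, integral_const_mul, integral_const_mul,
    integral_gammaDensity hp] at key
  · exact sub_eq_zero.1 key
  · exact (iS 1).const_mul _
  · exact iS 2
  · exact ((iS 1).const_mul _).add (iS 2)
  · exact iA.const_mul _

/-- The function `Γ(p) Γ(1-p, w)` at `w = e^η`, as `w^{-p} e^{-w}` times a Stieltjes transform. -/
def incGammaStieltjes (p η : ℂ) : ℂ :=
  Complex.exp (-p * η - Complex.exp η) * stieltjes (gammaDensity p) 1 η

theorem hasDerivAt_incGammaStieltjes {p : ℂ} (hp : 0 < p.re) {η : ℂ} (hη : η ∈ openStrip) :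
    HasDerivAt (incGammaStieltjes p)
      (-Complex.Gamma p * Complex.exp ((1 - p) * η - Complex.exp η)) η := by
  have h1 : HasDerivAt (fun η : ℂ => -p * η - Complex.exp η) (-p * 1 - Complex.exp η) η :=
    ((hasDerivAt_id η).const_mul (-p)).sub (Complex.hasDerivAt_exp η)
  convert! h1.cexp.mul (hasDerivAt_stieltjes (integrable_gammaDensity hp) 1 hη) using 1
  have h2 := stieltjes_gammaDensity_relation hp hη
  rw [show (1 - p) * η - Complex.exp η = (-p * η - Complex.exp η) + η by ring,
    Complex.exp_add _ η]
  push_cast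
  linear_combination Complex.exp (-p * η - Complex.exp η) * h2

theorem tendsto_incGammaStieltjes {p : ℂ} (hp : 0 < p.re) :
    Tendsto (fun s : ℝ => incGammaStieltjes p s) atTop (𝓝 0) := by
  have h1 : Tendsto (fun s : ℝ => Complex.exp (-p * s - Complex.exp s)) atTop (𝓝 0) := by
    refine squeeze_zero_norm' (a := fun s : ℝ => Real.exp (-Real.exp s)) ?_ ?_
    · filter_upwards [eventually_ge_atTop 0] with s hs
      rw [Complex.norm_exp, Real.exp_le_exp, ← Complex.ofReal_exp]
      have := mul_nonneg hp.le hs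
      simp only [Complex.sub_re, Complex.mul_re, Complex.neg_re, Complex.ofReal_re,
        Complex.ofReal_im, mul_zero, sub_zero]
      linarith
    · exact Real.tendsto_exp_neg_atTop_nhds_zero.comp Real.tendsto_exp_atTop
  refine h1.zero_mul_isBoundedUnder_le ?_
  refine isBoundedUnder_of ⟨∫ τ, ‖gammaDensity p τ‖, fun ξ => ?_⟩
  have := norm_stieltjes_le (integrable_gammaDensity hp) 1 (abs_im_ofReal_lt_pi ξ)
  simpa using this

/-- Both sides of `Γ(p) Γ(1-p, x) = x^{-p} e^{-x} ∫₀^∞ t^{p-1} e^{-t}/(1 + t/x) dt` have the same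
derivative and vanish at `+∞`. -/
theorem integral_Ioi_cpow_mul_exp {p : ℂ} (hp : 0 < p.re) (ρ : ℝ) :
    Complex.Gamma p * ∫ t in Set.Ioi (Real.exp ρ), (t : ℂ) ^ (1 - p - 1) * Complex.exp (-(t : ℂ)) =
      incGammaStieltjes p ρ := by
  rw [← integral_comp_exp_Ioi (fun t : ℝ => (t : ℂ) ^ (1 - p - 1) * Complex.exp (-(t : ℂ))) ρ]
  have h1 : ∀ s : ℝ, Real.exp s • ((Real.exp s : ℂ) ^ (1 - p - 1) *
      Complex.exp (-(Real.exp s : ℂ))) = Complex.exp ((1 - p) * s - Complex.exp s) := by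
    intro s
    have := exp_smul_gammaIntegrand (1 - p) s
    rw [abs_of_pos (Real.exp_pos s)] at this
    rw [← Complex.ofReal_exp s, ← this, mul_comm ((Real.exp s : ℂ) ^ (1 - p - 1)),
      Complex.ofReal_exp (-Real.exp s), Complex.ofReal_neg]
  simp_rw [h1]
  have hint : IntegrableOn (fun s : ℝ => -Complex.Gamma p *
      Complex.exp ((1 - p) * s - Complex.exp s)) (Set.Ioi ρ) := by
    refine Integrable.const_mul ?_ _
    have h2 := ((integrable_gammaKernel (a := 1) (by norm_num)).norm.const_mul
      (Real.exp (-p.re * ρ))).integrableOn (s := Set.Ioi ρ)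
    refine Integrable.mono' h2 (by fun_prop : Continuous fun s : ℝ =>
      Complex.exp ((1 - p) * s - Complex.exp s)).aestronglyMeasurable ?_
    refine (ae_restrict_iff' measurableSet_Ioi).2 (ae_of_all _ fun s hs => ?_)
    rw [Complex.norm_exp, Complex.norm_exp, ← Real.exp_add, Real.exp_le_exp, ← Complex.ofReal_exp]
    simp
    nlinarith [Set.mem_Ioi.1 hs]
  have key := integral_Ioi_of_hasDerivAt_of_tendsto' (a := ρ)
    (f := fun s : ℝ => incGammaStieltjes p s)
    (fun s _ => (hasDerivAt_incGammaStieltjes hp (ofReal_mem_openStrip s)).comp_ofReal) hint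
    (tendsto_incGammaStieltjes hp)
  rw [integral_const_mul] at key
  linear_combination -key

theorem incGamma_eq {p : ℂ} (hp : 0 < p.re) (η : ℂ) : Complex.Gamma p * incGamma (1 - p) η =
    incGammaStieltjes p η.re - Complex.Gamma p * (Complex.I * ∫ φ in (0 : ℝ)..η.im,
      Complex.exp ((1 - p) * (η.re + φ * Complex.I)) *
        Complex.exp (-Complex.exp (η.re + φ * Complex.I))) := by
  unfold incGamma
  rw [mul_sub, integral_Ioi_cpow_mul_exp hp]

/-- The incomplete gamma function as a Stieltjes transform for `|arg w| < π`. -/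
theorem Gamma_mul_incGamma {p : ℂ} (hp : 0 < p.re) {η : ℂ} (hη : η ∈ openStrip) :
    Complex.Gamma p * incGamma (1 - p) η = incGammaStieltjes p η := by
  have hd : ∀ φ ∈ Set.uIcc 0 η.im, HasDerivAt
      (fun φ : ℝ => incGammaStieltjes p (η.re + φ * Complex.I))
      (-Complex.Gamma p * Complex.I * (Complex.exp ((1 - p) * (η.re + φ * Complex.I)) *
        Complex.exp (-Complex.exp (η.re + φ * Complex.I)))) φ := by
    intro φ hφ
    have hm : (η.re : ℂ) + φ * Complex.I ∈ openStrip := by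
      have h1 : |φ| ≤ |η.im| := by
        have := Set.abs_sub_left_of_mem_uIcc hφ
        simpa using this
      simpa [openStrip] using h1.trans_lt hη
    have h2 : HasDerivAt (fun φ : ℝ => (η.re : ℂ) + φ * Complex.I) (1 * Complex.I) φ :=
      ((Complex.ofRealCLM.hasDerivAt (x := φ)).mul_const Complex.I).const_add _
    have h3 := (hasDerivAt_incGammaStieltjes hp hm).comp φ h2
    convert! h3 using 1
    rw [← Complex.exp_add, ← sub_eq_add_neg]
    ring
  have key := intervalIntegral.integral_eq_sub_of_hasDerivAt hd
    (Continuous.intervalIntegrable (by fun_prop) _ _)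
  rw [intervalIntegral.integral_const_mul, Complex.re_add_im, Complex.ofReal_zero, zero_mul,
    add_zero] at key
  rw [incGamma_eq hp]
  linear_combination key

/-- The basic terminant `Γ(p) Λ_p(w) = ∫₀^∞ t^{p-1} e^{-t} / (1 + t/w) dt` for `|arg w| < π`. -/
theorem Gamma_mul_terminantL {p : ℂ} (hp : 0 < p.re) {η : ℂ} (hη : η ∈ openStrip) :
    Complex.Gamma p * terminantL p η = stieltjes (gammaDensity p) 1 η := by
  have h := Gamma_mul_incGamma hp hη
  unfold terminantL
  rw [mul_left_comm, h, incGammaStieltjes, ← mul_assoc, ← Complex.exp_add, ← Complex.exp_add]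
  rw [show p * η + Complex.exp η + (-p * η - Complex.exp η) = 0 by ring, Complex.exp_zero, one_mul]

theorem continuous_terminantL {p : ℂ} (hp : 0 < p.re) : Continuous (terminantL p) := by
  have h0 : Complex.Gamma p ≠ 0 := Complex.Gamma_ne_zero_of_re_pos hp
  have h1 : Continuous fun ρ : ℝ => incGammaStieltjes p ρ := continuous_iff_continuousAt.2 fun ρ =>
    (hasDerivAt_incGammaStieltjes hp (ofReal_mem_openStrip ρ)).comp_ofReal.continuousAt
  have h2 : Continuous fun η : ℂ => ∫ φ in (0 : ℝ)..η.im,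
      Complex.exp ((1 - p) * (η.re + φ * Complex.I)) *
        Complex.exp (-Complex.exp (η.re + φ * Complex.I)) :=
    intervalIntegral.continuous_parametric_intervalIntegral_of_continuous (by fun_prop)
      Complex.continuous_im
  have h3 : incGamma (1 - p) = fun η => (Complex.Gamma p)⁻¹ * (incGammaStieltjes p η.re -
      Complex.Gamma p * (Complex.I * ∫ φ in (0 : ℝ)..η.im,
      Complex.exp ((1 - p) * (η.re + φ * Complex.I)) *
        Complex.exp (-Complex.exp (η.re + φ * Complex.I)))) := by
    funext η
    rw [← incGamma_eq hp, inv_mul_cancel_left₀ h0]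
  unfold terminantL
  rw [h3]
  exact (by fun_prop : Continuous fun η : ℂ => Complex.exp (p * η) *
    Complex.exp (Complex.exp η)).mul (continuous_const.mul
      ((h1.comp Complex.continuous_re).sub (continuous_const.mul (continuous_const.mul h2))))

/-- The scaled form `∫₀^∞ t^{p-1} e^{-2t} / (1 + t/z) dt = 2^{-p} Γ(p) Λ_p(2z)`. -/
theorem integral_exp_two_eq_terminantL {q : ℕ} (hq : 0 < q) {ζ : ℂ} (hζ : ζ ∈ openStrip) :
    ∫ τ : ℝ, Complex.exp (q * τ - 2 * Complex.exp τ) * (1 + Complex.exp (τ - ζ))⁻¹ =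
      1 / 2 ^ q * (Complex.Gamma q * terminantL q (ζ + Real.log 2)) := by
  have hm : ζ + Real.log 2 ∈ openStrip := by
    change |(ζ + (Real.log 2 : ℝ)).im| < Real.pi
    rw [Complex.add_im, Complex.ofReal_im, add_zero]
    exact hζ
  rw [Gamma_mul_terminantL (by simpa using hq) hm, stieltjes,
    ← integral_add_right_eq_self (fun τ : ℝ => gammaDensity q τ *
      (1 + Complex.exp (τ - (ζ + Real.log 2)))⁻¹ ^ 1) (Real.log 2), ← integral_const_mul]
  congr 1
  ext τ
  rw [gammaDensity, Real.exp_add, Real.exp_log two_pos, pow_one, Complex.ofReal_add,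
    add_sub_add_right_eq_sub, ← mul_assoc]
  congr 1
  rw [show (q : ℂ) * (τ + Real.log 2) - ((Real.exp τ * 2 : ℝ) : ℂ) =
    (q * τ - 2 * Complex.exp τ) + q * Real.log 2 by push_cast; ring, Complex.exp_add,
    Complex.exp_nat_mul, exp_log_two]
  field_simp

/-! ### The slow variation of `|z|^M R_M(|z|, ν)` -/

theorem besselDensity_ofReal (N : ℕ) (σ τ : ℝ) : besselDensity N (σ : ℂ) τ =
    (Real.exp (((N : ℝ) + 1 / 2) * τ - Real.exp τ) * macdonaldReal σ τ : ℝ) := by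
  rw [besselDensity, ← ofReal_macdonaldReal]
  push_cast
  rfl

theorem derivDensity_ofReal (N : ℕ) (σ τ : ℝ) : derivDensity N (σ : ℂ) τ =
    ((Real.exp (((N : ℝ) + 1 / 2) * τ - Real.exp τ) * macdonaldReal (σ + 1) τ +
      Real.exp (((N : ℝ) + 1 / 2) * τ - Real.exp τ) * macdonaldReal (σ - 1) τ) / 2 : ℝ) := by
  rw [derivDensity, show (σ : ℂ) + 1 = ((σ + 1 : ℝ) : ℂ) by push_cast; rfl,
    show (σ : ℂ) - 1 = ((σ - 1 : ℝ) : ℂ) by push_cast; rfl, besselDensity_ofReal,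
    besselDensity_ofReal, Complex.ofReal_div, Complex.ofReal_add]
  rfl

theorem norm_derivDensity_ofReal (N : ℕ) (σ τ : ℝ) : ‖derivDensity N (σ : ℂ) τ‖ =
    (Real.exp (((N : ℝ) + 1 / 2) * τ - Real.exp τ) * macdonaldReal (σ + 1) τ +
      Real.exp (((N : ℝ) + 1 / 2) * τ - Real.exp τ) * macdonaldReal (σ - 1) τ) / 2 := by
  rw [derivDensity_ofReal, Complex.norm_real, Real.norm_of_nonneg]
  have := macdonaldReal_nonneg (σ + 1) τ
  have := macdonaldReal_nonneg (σ - 1) τ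
  positivity

theorem norm_besselDensity_le_re (N : ℕ) (ν : ℂ) (τ : ℝ) :
    ‖besselDensity N ν τ‖ ≤ Real.exp (((N : ℝ) + 1 / 2) * τ - Real.exp τ) *
      macdonaldReal ν.re τ := by
  rw [besselDensity, norm_mul, Complex.norm_exp]
  gcongr
  · simp [-Complex.ofReal_exp]
  · exact norm_macdonald_le ν τ

/-- The density is dominated by the one at the real order `Re ν`. -/
theorem norm_derivDensity_le (N : ℕ) (ν : ℂ) (τ : ℝ) :
    ‖derivDensity N ν τ‖ ≤ ‖derivDensity N (ν.re : ℂ) τ‖ := by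
  have h1 := norm_besselDensity_le_re N (ν + 1) τ
  have h2 := norm_besselDensity_le_re N (ν - 1) τ
  rw [norm_derivDensity_ofReal, derivDensity, norm_div, Complex.norm_ofNat]
  rw [Complex.add_re, Complex.one_re] at h1
  rw [Complex.sub_re, Complex.one_re] at h2
  have := (norm_add_le (besselDensity N (ν + 1) τ) (besselDensity N (ν - 1) τ)).trans
    (add_le_add h1 h2)
  linarith

/-- The moment `-∫₀^∞ e^{-t} t^{N-1/2} K'_σ(t) dt` for a real order `σ`. -/
def derivMoment (N : ℕ) (σ : ℝ) : ℝ := ∫ τ, ‖derivDensity N (σ : ℂ) τ‖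

theorem derivMoment_nonneg (N : ℕ) (σ : ℝ) : 0 ≤ derivMoment N σ :=
  integral_nonneg fun _ => norm_nonneg _

theorem ofReal_derivMoment (N : ℕ) (σ : ℝ) :
    (derivMoment N σ : ℂ) = ∫ τ, derivDensity N (σ : ℂ) τ := by
  rw [derivMoment, ← integral_complex_ofReal]
  simp_rw [norm_derivDensity_ofReal, derivDensity_ofReal]

/-- The moment is continuous in the order, by its expression through `Γ`. -/
theorem continuousAt_derivMoment {N : ℕ} {σ : ℝ} (h : |σ| < N - 1 / 2) :
    ContinuousAt (derivMoment N) σ := by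
  have hb := abs_lt.1 h
  set C : ℂ := (Real.sqrt (Real.pi / 2) : ℂ) / (2 ^ N * (N.factorial : ℂ))
  have hG : ∀ (f : ℝ → ℂ), Continuous f → 0 < (f σ).re →
      ContinuousAt (fun y => Complex.Gamma (f y)) σ := by
    intro f hf h0
    refine ContinuousAt.comp (g := Complex.Gamma) ?_ hf.continuousAt
    refine (Complex.differentiableAt_Gamma _ fun m hm => ?_).continuousAt
    rw [hm] at h0
    simp at h0
    exact absurd (Nat.cast_nonneg m) (not_le.2 h0)
  have hc : ContinuousAt (fun y : ℝ => ((C * (Complex.Gamma (N + 1 / 2 + (y + 1)) *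
      Complex.Gamma (N + 1 / 2 - (y + 1))) + C * (Complex.Gamma (N + 1 / 2 + (y - 1)) *
      Complex.Gamma (N + 1 / 2 - (y - 1)))) / 2).re) σ := by
    refine Complex.continuous_re.continuousAt.comp (ContinuousAt.div_const (ContinuousAt.add
      (continuousAt_const.mul ((hG _ (by fun_prop) ?_).mul (hG _ (by fun_prop) ?_)))
      (continuousAt_const.mul ((hG _ (by fun_prop) ?_).mul (hG _ (by fun_prop) ?_)))) 2) <;>
    · simp
      linarith
  refine hc.congr ?_
  have hev : ∀ᶠ y : ℝ in 𝓝 σ, |y| < N - 1 / 2 :=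
    continuous_abs.continuousAt.eventually_lt continuousAt_const h
  filter_upwards [hev] with y hy
  have hy' : |(y : ℂ).re| < N - 1 / 2 := hy
  rw [← integral_besselDensity (abs_re_add_one_lt hy'),
    ← integral_besselDensity (abs_re_sub_one_lt hy'),
    ← integral_add (integrable_besselDensity (abs_re_add_one_lt hy'))
      (integrable_besselDensity (abs_re_sub_one_lt hy')), ← integral_div]
  exact (congrArg Complex.re (ofReal_derivMoment N y)).symm

theorem norm_stokesConst (N : ℕ) (ν : ℂ) : ‖stokesConst N ν‖ =
    ‖Complex.cos (Real.pi * ν)‖ * (Real.sqrt (2 / Real.pi) / Real.pi) := by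
  rw [stokesConst, norm_mul, norm_mul, norm_pow, norm_neg, norm_one, one_pow, one_mul, norm_div,
    Complex.norm_real, Complex.norm_real, Real.norm_of_nonneg Real.pi_pos.le,
    Real.norm_of_nonneg (Real.sqrt_nonneg _)]
  ring

theorem norm_bCoeff_div_cos {M : ℕ} {y : ℝ} (h : |y| < M - 1 / 2)
    (hy : Real.cos (Real.pi * y) ≠ 0) :
    ‖bCoeff M (y : ℂ)‖ / |Real.cos (Real.pi * y)| =
      Real.sqrt (2 / Real.pi) / Real.pi * derivMoment M y := by
  rw [bCoeff_eq_integral (ν := (y : ℂ)) h, ← ofReal_derivMoment, norm_mul, norm_neg,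
    norm_stokesConst, Complex.norm_real, Real.norm_of_nonneg (derivMoment_nonneg _ _),
    ← Complex.ofReal_mul, ← Complex.ofReal_cos, Complex.norm_real, Real.norm_eq_abs]
  field_simp

theorem eventually_cos_ne_zero (x : ℝ) : ∀ᶠ y in 𝓝[≠] x, Real.cos (Real.pi * y) ≠ 0 := by
  by_cases h : Real.cos (Real.pi * x) = 0
  · have hd : HasDerivAt (fun y : ℝ => Real.cos (Real.pi * y))
        (-Real.sin (Real.pi * x) * (Real.pi * 1)) x := ((hasDerivAt_id x).const_mul _).cos
    refine hd.eventually_ne (c := 0) ?_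
    have hs : Real.sin (Real.pi * x) ≠ 0 := by
      intro hs
      have := Real.sin_sq_add_cos_sq (Real.pi * x)
      rw [h, hs] at this
      norm_num at this
    exact mul_ne_zero (neg_ne_zero.2 hs) (by simp [Real.pi_ne_zero])
  · exact eventually_nhdsWithin_of_eventually_nhds
      ((by fun_prop : Continuous fun y : ℝ => Real.cos (Real.pi * y)).continuousAt.eventually_ne h)

/-- The ratio `|b_M(σ)| / |cos(πσ)|`, continued to the zeros of the cosine, is a moment. -/
theorem bCosRatio_eq {M : ℕ} {σ : ℝ} (h : |σ| < M - 1 / 2) :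
    bCosRatio M σ = Real.sqrt (2 / Real.pi) / Real.pi * derivMoment M σ := by
  unfold bCosRatio
  by_cases hc : Real.cos (Real.pi * σ) = 0
  · -- the moment is continuous at `σ`, so it is the limit of the ratio there
    simp only [hc, if_true]
    refine Tendsto.limUnder_eq ?_
    refine (((continuousAt_derivMoment h).const_mul _).tendsto.mono_left
      nhdsWithin_le_nhds).congr' ?_
    have hev : ∀ᶠ y : ℝ in 𝓝 σ, |y| < M - 1 / 2 :=
      continuous_abs.continuousAt.eventually_lt continuousAt_const h
    filter_upwards [eventually_cos_ne_zero σ, nhdsWithin_le_nhds hev] with y hy1 hy2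
    exact (norm_bCoeff_div_cos hy2 hy1).symm
  · simp only [hc, if_false]
    exact norm_bCoeff_div_cos h hc

theorem norm_stokesConst_mul_derivMoment {M : ℕ} {ν : ℂ} (h : |ν.re| < M - 1 / 2) :
    ‖stokesConst M ν‖ * derivMoment M ν.re =
      ‖Complex.cos (Real.pi * ν)‖ * bCosRatio M ν.re := by
  rw [norm_stokesConst, bCosRatio_eq h, mul_assoc]

/-- The elementary inequality behind the comparison of `R_M(t)` with `R_M(|z|)`: for positive
`s`, `t`, `r`, `|1/(1 + s/t) - 1/(1 + s/r)| ≤ |t - r|/r`. -/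
theorem abs_inv_one_add_exp_sub_le (s t r : ℝ) :
    |(1 + Real.exp (s - t))⁻¹ - (1 + Real.exp (s - r))⁻¹| ≤ |1 - Real.exp (t - r)| := by
  have h1 := Real.exp_pos (s - t)
  have h2 := Real.exp_pos (s - r)
  have h3 : Real.exp (s - r) = Real.exp (s - t) * Real.exp (t - r) := by
    rw [← Real.exp_add]; ring_nf
  rw [show (1 + Real.exp (s - t))⁻¹ - (1 + Real.exp (s - r))⁻¹ =
    (1 - Real.exp (t - r)) * (-Real.exp (s - t) / ((1 + Real.exp (s - t)) *
      (1 + Real.exp (s - r)))) by rw [h3] at *; field_simp; ring, abs_mul]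
  refine mul_le_of_le_one_right (abs_nonneg _) ?_
  rw [abs_div, abs_neg, abs_of_pos h1, abs_of_pos (by positivity), div_le_one (by positivity)]
  nlinarith [mul_pos h1 h2]

theorem abs_one_sub_exp_le_norm (τ : ℝ) (ζ : ℂ) :
    |1 - Real.exp (τ - ζ.re)| ≤ ‖1 + Complex.exp (τ - ζ)‖ := by
  have h := abs_norm_sub_norm_le (1 : ℂ) (-Complex.exp (τ - ζ))
  rwa [norm_one, norm_neg, Complex.norm_exp, Complex.sub_re, Complex.ofReal_re,
    sub_neg_eq_add] at h

/-- `|z|^M R_M(|z|, ν)` changes slowly with `|z|`, at the rate given by the moment of the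
density. -/
theorem norm_remK'_sub_le {M : ℕ} (hM : M ≠ 0) {ν : ℂ} (h : |ν.re| < M - 1 / 2) (τ : ℝ) (ζ : ℂ) :
    ‖Complex.exp τ ^ M * remK' M τ ν - Complex.exp ζ.re ^ M * remK' M ζ.re ν‖ ≤
      ‖stokesConst M ν‖ * derivMoment M ν.re * ‖1 + Complex.exp (τ - ζ)‖ := by
  have hS : ∀ x : ℝ, Complex.exp x ^ M * remK' M x ν =
      -stokesConst M ν * stieltjes (derivDensity M ν) 1 x := by
    intro x
    rw [remK'_eq hM h (ofReal_mem_openStrip x)]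
    field_simp [Complex.exp_ne_zero]
  have iS := fun x : ℝ => integrable_stieltjes (integrable_derivDensity h) 1
    (ofReal_mem_openStrip x)
  rw [hS, hS, ← mul_sub, norm_mul, norm_neg, mul_assoc]
  gcongr
  rw [stieltjes, stieltjes, ← integral_sub (iS τ) (iS ζ.re)]
  have hre : |(ν.re : ℂ).re| < M - 1 / 2 := h
  refine (norm_integral_le_of_norm_le
    ((integrable_derivDensity hre).norm.mul_const ‖1 + Complex.exp (τ - ζ)‖)
    (ae_of_all _ fun s => ?_)).trans_eq (integral_mul_const _ _)
  -- the bound on the difference of the kernels does not depend on `s`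
  rw [← mul_sub, norm_mul]
  refine mul_le_mul (norm_derivDensity_le M ν s) ?_ (norm_nonneg _) (norm_nonneg _)
  refine le_trans ?_ (abs_one_sub_exp_le_norm τ ζ)
  refine le_trans (le_of_eq ?_) (abs_inv_one_add_exp_sub_le s τ ζ.re)
  rw [← Real.norm_eq_abs, ← Complex.norm_real]
  push_cast
  simp only [pow_one]

/-! ### The re-expansion of the remainder for `K'_ν` -/

theorem integrable_exp_two {q : ℕ} (hq : 0 < q) :
    Integrable fun τ : ℝ => Complex.exp (q * τ - 2 * Complex.exp τ) := by
  simpa using integrable_gammaKernel_scaled (a := (q : ℂ)) (by simpa using hq) two_pos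

theorem integral_norm_exp_two {q : ℕ} (hq : 0 < q) :
    ∫ τ : ℝ, ‖Complex.exp (q * τ - 2 * Complex.exp τ)‖ = Real.Gamma q / 2 ^ q := by
  have h := integral_gammaKernel_scaled (a := (q : ℂ)) (by simpa using hq) two_pos
  have h1 : ∀ τ : ℝ, Complex.exp (q * τ - (2 * Real.exp τ : ℝ)) =
      (‖Complex.exp (q * τ - 2 * Complex.exp τ)‖ : ℂ) := by
    intro τ
    rw [show (q : ℂ) * τ - 2 * Complex.exp τ = ((q * τ - 2 * Real.exp τ : ℝ) : ℂ) by push_cast; rfl,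
      Complex.norm_exp_ofReal]
    push_cast
    rfl
  simp_rw [h1] at h
  rw [integral_complex_ofReal, neg_mul, Complex.exp_neg, Complex.exp_nat_mul, exp_log_two] at h
  apply Complex.ofReal_injective
  rw [h, Complex.ofReal_div, ← Complex.Gamma_ofReal]
  push_cast
  ring

theorem integrable_exp_two_mul {q : ℕ} (hq : 0 < q) {ζ : ℂ} (hζ : ζ ∈ openStrip) :
    Integrable fun τ : ℝ =>
      Complex.exp (q * τ - 2 * Complex.exp τ) * (1 + Complex.exp (τ - ζ))⁻¹ := by
  simpa using integrable_stieltjes (integrable_exp_two hq) 1 hζ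

/-- Along the positive axis, the density is the expansion of `-K'_ν` with `M` terms and its
remainder, times `e^{-t} t^{N+1/2}`. -/
theorem derivDensity_eq_sum {N M : ℕ} (hMN : M ≤ N) (ν : ℂ) (τ : ℝ) : derivDensity N ν τ =
    (Real.sqrt (Real.pi / 2) : ℂ) * (∑ m ∈ Finset.range M, bCoeff m ν *
      Complex.exp ((N - m : ℕ) * τ - 2 * Complex.exp τ) +
      Complex.exp ((N - M : ℕ) * τ - 2 * Complex.exp τ) *
        (Complex.exp τ ^ M * remK' M τ ν)) := by
  have h1 := besselK'_eq M τ ν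
  rw [besselK'_eq_neg_half (ofReal_mem_openStrip τ), besselK_ofReal_eq_macdonald,
    besselK_ofReal_eq_macdonald, prefK_eq] at h1
  have h2 : ∀ m ≤ N, Complex.exp ((N - m : ℕ) * τ - 2 * Complex.exp τ) =
      Complex.exp (((N : ℂ) + 1 / 2) * τ - Complex.exp τ) *
        Complex.exp (-τ / 2 - Complex.exp τ) / Complex.exp τ ^ m := by
    intro m hm
    rw [← Complex.exp_nat_mul, ← Complex.exp_add, ← Complex.exp_sub, Nat.cast_sub hm]
    ring_nf
  have h3 : ∑ m ∈ Finset.range M, bCoeff m ν *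
      Complex.exp ((N - m : ℕ) * τ - 2 * Complex.exp τ) =
      Complex.exp (((N : ℂ) + 1 / 2) * τ - Complex.exp τ) *
        Complex.exp (-τ / 2 - Complex.exp τ) *
        ∑ m ∈ Finset.range M, bCoeff m ν / Complex.exp τ ^ m := by
    rw [Finset.mul_sum]
    refine Finset.sum_congr rfl fun m hm => ?_
    rw [h2 m ((Finset.mem_range.1 hm).le.trans hMN)]
    ring
  rw [h3, h2 M hMN, derivDensity, besselDensity, besselDensity, Complex.ofReal_exp]
  have hne := pow_ne_zero M (Complex.exp_ne_zero (τ : ℂ))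
  generalize Complex.exp (((N : ℂ) + 1 / 2) * τ - Complex.exp τ) = a
  generalize Complex.exp (-τ / 2 - Complex.exp τ) = b at *
  generalize Complex.exp (τ : ℂ) ^ M = c at *
  rw [show a * b / c * (c * remK' M τ ν) = a * b * remK' M τ ν by field_simp]
  linear_combination -a * h1

/-- The weighted Stieltjes transform of the remainder `R_M^{(K')}` on the positive axis. -/
def remStieltjes (N M : ℕ) (ν ζ : ℂ) : ℂ :=
  ∫ τ : ℝ, Complex.exp ((N - M : ℕ) * τ - 2 * Complex.exp τ) *
    (Complex.exp τ ^ M * remK' M τ ν) * (1 + Complex.exp (τ - ζ))⁻¹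

/-- The integrand of the re-expanded remainder is that of `R_N` minus those of the terminants. -/
theorem derivDensity_mul_eq {N M : ℕ} (hMN : M ≤ N) (ν ζ : ℂ) (τ : ℝ) :
    (Real.sqrt (Real.pi / 2) : ℂ) * (Complex.exp ((N - M : ℕ) * τ - 2 * Complex.exp τ) *
      (Complex.exp τ ^ M * remK' M τ ν) * (1 + Complex.exp (τ - ζ))⁻¹) =
    derivDensity N ν τ * (1 + Complex.exp (τ - ζ))⁻¹ ^ 1 -
      (Real.sqrt (Real.pi / 2) : ℂ) * ∑ m ∈ Finset.range M, bCoeff m ν *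
        (Complex.exp ((N - m : ℕ) * τ - 2 * Complex.exp τ) * (1 + Complex.exp (τ - ζ))⁻¹) := by
  have h : ∑ m ∈ Finset.range M, bCoeff m ν *
      (Complex.exp ((N - m : ℕ) * τ - 2 * Complex.exp τ) * (1 + Complex.exp (τ - ζ))⁻¹) =
      (∑ m ∈ Finset.range M, bCoeff m ν * Complex.exp ((N - m : ℕ) * τ - 2 * Complex.exp τ)) *
        (1 + Complex.exp (τ - ζ))⁻¹ := by
    rw [Finset.sum_mul]
    exact Finset.sum_congr rfl fun m _ => by ring
  rw [h, derivDensity_eq_sum hMN, pow_one]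
  ring

theorem sqrt_pi_div_two_ne_zero : (Real.sqrt (Real.pi / 2) : ℂ) ≠ 0 :=
  right_ne_zero_of_mul_eq_one sqrt_two_div_pi_mul

theorem integrable_sum_exp_two {N M : ℕ} (hMN : M ≤ N) (ν : ℂ) {ζ : ℂ} (hζ : ζ ∈ openStrip) {m : ℕ}
    (hm : m ∈ Finset.range M) : Integrable fun τ : ℝ => bCoeff m ν *
      (Complex.exp ((N - m : ℕ) * τ - 2 * Complex.exp τ) * (1 + Complex.exp (τ - ζ))⁻¹) :=
  (integrable_exp_two_mul (Nat.sub_pos_of_lt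
    ((Finset.mem_range.1 hm).trans_le hMN)) hζ).const_mul _

theorem integrable_remStieltjes {N M : ℕ} (hMN : M ≤ N) {ν : ℂ} (h : |ν.re| < N - 1 / 2) {ζ : ℂ}
    (hζ : ζ ∈ openStrip) : Integrable fun τ : ℝ =>
      Complex.exp ((N - M : ℕ) * τ - 2 * Complex.exp τ) *
        (Complex.exp τ ^ M * remK' M τ ν) * (1 + Complex.exp (τ - ζ))⁻¹ := by
  have h1 := (integrable_stieltjes (integrable_derivDensity h) 1 hζ).sub
    ((integrable_finsetSum _ fun _ => integrable_sum_exp_two hMN ν hζ).const_mul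
      (Real.sqrt (Real.pi / 2) : ℂ))
  refine (h1.const_mul (Real.sqrt (Real.pi / 2) : ℂ)⁻¹).congr (ae_of_all _ fun τ => ?_)
  have h2 := derivDensity_mul_eq hMN ν ζ τ
  simp only [Pi.sub_apply]
  rw [← h2, inv_mul_cancel_left₀ sqrt_pi_div_two_ne_zero]

theorem sqrt_mul_remStieltjes {N M : ℕ} (hMN : M ≤ N) {ν : ℂ} (h : |ν.re| < N - 1 / 2) {ζ : ℂ}
    (hζ : ζ ∈ openStrip) : (Real.sqrt (Real.pi / 2) : ℂ) * remStieltjes N M ν ζ =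
      stieltjes (derivDensity N ν) 1 ζ - (Real.sqrt (Real.pi / 2) : ℂ) *
        ∑ m ∈ Finset.range M, bCoeff m ν *
          (1 / 2 ^ (N - m) * (Complex.Gamma ((N : ℂ) - m) *
            terminantL ((N : ℂ) - m) (ζ + Real.log 2))) := by
  have i1 := integrable_stieltjes (integrable_derivDensity h) 1 hζ
  have i2 := (integrable_finsetSum _ fun _ => integrable_sum_exp_two hMN ν hζ).const_mul
      (Real.sqrt (Real.pi / 2) : ℂ)
  rw [remStieltjes, ← integral_const_mul]
  simp_rw [derivDensity_mul_eq hMN ν ζ]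
  rw [integral_sub i1 i2, integral_const_mul, integral_finsetSum _
    fun _ => integrable_sum_exp_two hMN ν hζ]
  simp_rw [integral_const_mul]
  rw [stieltjes]
  congr 2
  refine Finset.sum_congr rfl fun m hm => ?_
  have hm' := (Finset.mem_range.1 hm).trans_le hMN
  rw [integral_exp_two_eq_terminantL (Nat.sub_pos_of_lt hm') hζ, Nat.cast_sub hm'.le]

/-- The re-expansion remainder is the Stieltjes transform of `e^{-2t} t^N R_M^{(K')}(t, ν)`. -/
theorem reexpK'_eq {N M : ℕ} (hM : M ≠ 0) (hMN : M ≤ N) {ν : ℂ} (h : |ν.re| < N - 1 / 2) {ζ : ℂ}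
    (hζ : ζ ∈ openStrip) : reexpK' N M ζ ν =
      (-1) ^ (N + 1) * (Complex.cos (Real.pi * ν) / Real.pi) *
      (1 / Complex.exp ζ ^ N) * remStieltjes N M ν ζ := by
  have h1 := sqrt_mul_remStieltjes hMN h hζ
  have h2 := sqrt_two_div_pi_mul
  have h3 : ∑ m ∈ Finset.range M, bCoeff m ν * (1 / 2 ^ (N - m) * (Complex.Gamma ((N : ℂ) - m) *
      terminantL ((N : ℂ) - m) (ζ + Real.log 2))) = 1 / 2 ^ N * ∑ m ∈ Finset.range M,
      2 ^ m * bCoeff m ν * Complex.Gamma ((N : ℂ) - m) *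
        terminantL ((N : ℂ) - m) (ζ + Real.log 2) := by
    rw [Finset.mul_sum]
    refine Finset.sum_congr rfl fun m hm => ?_
    have hm' := (Finset.mem_range.1 hm).le.trans hMN
    rw [← Nat.sub_add_cancel hm', pow_add, Nat.add_sub_cancel, Nat.sub_add_cancel hm']
    field_simp
  rw [h3] at h1
  rw [reexpK', remK'_eq (by omega) h hζ, stokesConst]
  generalize ∑ m ∈ Finset.range M, 2 ^ m * bCoeff m ν * Complex.Gamma ((N : ℂ) - m) *
        terminantL ((N : ℂ) - m) (ζ + Real.log 2) = S at *
  rw [show stieltjes (derivDensity N ν) 1 ζ = (Real.sqrt (Real.pi / 2) : ℂ) *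
    (remStieltjes N M ν ζ + 1 / 2 ^ N * S) by linear_combination -h1]
  generalize (Real.sqrt (Real.pi / 2) : ℂ) = t at *
  generalize (Real.sqrt (2 / Real.pi) : ℂ) = s at *
  rw [show -((-1) ^ N * (Complex.cos (Real.pi * ν) / Real.pi) * s) * (1 / Complex.exp ζ ^ N) *
    (t * (remStieltjes N M ν ζ + 1 / 2 ^ N * S)) = (s * t) * (-((-1) ^ N *
    (Complex.cos (Real.pi * ν) / Real.pi)) * (1 / Complex.exp ζ ^ N) *
    (remStieltjes N M ν ζ + 1 / 2 ^ N * S)) by ring, h2, pow_succ]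
  field_simp
  ring

/-- The part of the re-expansion remainder obtained by freezing `t^M R_M^{(K')}(t, ν)` at
`t = |z|`. -/
def frozenPart (N M : ℕ) (ζ ν : ℂ) : ℂ :=
  (-1) ^ (N + 1) * (Complex.cos (Real.pi * ν) / (2 ^ N * Real.pi)) * (1 / Complex.exp ζ ^ N) *
    (2 ^ M * Complex.exp ζ.re ^ M * remK' M ζ.re ν * Complex.Gamma ((N : ℂ) - M) *
      terminantL ((N : ℂ) - M) (ζ + Real.log 2))

/-- The error committed by freezing. -/
def freezingBound (N M : ℕ) (ζ ν : ℂ) : ℝ :=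
  ‖Complex.cos (Real.pi * ν)‖ / (2 ^ N * Real.pi) * (1 / ‖Complex.exp ζ‖ ^ N) *
    2 ^ M * (‖Complex.cos (Real.pi * ν)‖ * bCosRatio M ν.re) * Real.Gamma ((N : ℝ) - M)

theorem norm_remStieltjes_sub_le {N M : ℕ} (hM : M ≠ 0) (hMN : M < N) {ν : ℂ}
    (h : |ν.re| < M - 1 / 2) {ζ : ℂ} (hζ : ζ ∈ openStrip) :
    ‖remStieltjes N M ν ζ - Complex.exp ζ.re ^ M * remK' M ζ.re ν *
      (1 / 2 ^ (N - M) * (Complex.Gamma ((N : ℂ) - M) *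
            terminantL ((N : ℂ) - M) (ζ + Real.log 2)))‖ ≤
      ‖Complex.cos (Real.pi * ν)‖ * bCosRatio M ν.re *
        (Real.Gamma ((N : ℝ) - M) / 2 ^ (N - M)) := by
  have hq : 0 < N - M := Nat.sub_pos_of_lt hMN
  have hN : |ν.re| < N - 1 / 2 := h.trans (by have : (M : ℝ) < N := by exact_mod_cast hMN
                                              linarith)
  rw [← Nat.cast_sub hMN.le, ← Nat.cast_sub hMN.le, ← integral_exp_two_eq_terminantL hq hζ,
    ← integral_const_mul, remStieltjes, ← integral_sub (integrable_remStieltjes hMN.le hN hζ)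
      ((integrable_exp_two_mul hq hζ).const_mul _), ← norm_stokesConst_mul_derivMoment h,
    ← integral_norm_exp_two hq, ← integral_const_mul]
  refine norm_integral_le_of_norm_le ((integrable_exp_two hq).norm.const_mul _)
    (ae_of_all _ fun τ => ?_)
  have hne : 0 < ‖1 + Complex.exp (τ - ζ)‖ := norm_pos_iff.2 (one_add_exp_sub_ne_zero hζ τ)
  have key := norm_remK'_sub_le hM h τ ζ
  rw [show ∀ a b c d : ℂ, a * b * c - d * (a * c) = a * ((b - d) * c) by intros; ring, norm_mul,
    norm_mul, norm_inv, mul_comm (‖stokesConst M ν‖ * derivMoment M ν.re)]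
  -- here the Stieltjes kernel cancels against the bound for the difference of the remainders
  refine mul_le_mul_of_nonneg_left ?_ (norm_nonneg _)
  rwa [← div_eq_mul_inv, div_le_iff₀ hne]

/-- The freezing estimate on the open sector `|arg z| < π`. -/
theorem norm_reexpK'_sub_le_of_mem {N M : ℕ} (hM : M ≠ 0) (hMN : M < N) {ν : ℂ}
    (h : |ν.re| < M - 1 / 2) {ζ : ℂ} (hζ : ζ ∈ openStrip) :
    ‖reexpK' N M ζ ν - frozenPart N M ζ ν‖ ≤ freezingBound N M ζ ν := by
  have hN : |ν.re| < N - 1 / 2 := h.trans (by have : (M : ℝ) < N := by exact_mod_cast hMN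
                                              linarith)
  have key := norm_remStieltjes_sub_le hM hMN h hζ
  have h2 : (2 : ℂ) ^ N = 2 ^ (N - M) * 2 ^ M := by rw [← pow_add, Nat.sub_add_cancel hMN.le]
  have h2' : (2 : ℝ) ^ N = 2 ^ (N - M) * 2 ^ M := by rw [← pow_add, Nat.sub_add_cancel hMN.le]
  rw [show reexpK' N M ζ ν - frozenPart N M ζ ν = ((-1) ^ (N + 1) *
    (Complex.cos (Real.pi * ν) / Real.pi) * (1 / Complex.exp ζ ^ N)) * (remStieltjes N M ν ζ -
      Complex.exp ζ.re ^ M * remK' M ζ.re ν * (1 / 2 ^ (N - M) * (Complex.Gamma ((N : ℂ) - M) *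
        terminantL ((N : ℂ) - M) (ζ + Real.log 2)))) by
    rw [reexpK'_eq hM hMN.le hN hζ, frozenPart, h2]
    field_simp]
  rw [norm_mul]
  refine (mul_le_mul_of_nonneg_left key (norm_nonneg _)).trans_eq ?_
  rw [freezingBound, h2', norm_mul, norm_mul, norm_pow, norm_neg, norm_one, one_pow, norm_div,
    norm_div, norm_one, norm_pow, Complex.norm_real, Real.norm_of_nonneg Real.pi_pos.le]
  field_simp

theorem continuous_frozenPart {N M : ℕ} (hMN : M < N) (ν : ℂ) :
    Continuous fun ζ => frozenPart N M ζ ν := by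
  have h1 : Continuous (terminantL ((N : ℂ) - M)) := continuous_terminantL (by
    rw [← Nat.cast_sub hMN.le, Complex.natCast_re]
    exact_mod_cast Nat.sub_pos_of_lt hMN)
  have h2 : Continuous fun ξ : ℝ => remK' M ξ ν := by
    unfold remK'
    refine Continuous.sub (Continuous.div ?_ ?_ fun ξ => prefK_ne_zero _) ?_
    · refine Continuous.neg ?_
      exact (continuousOn_besselK' ν).comp_continuous Complex.continuous_ofReal fun ξ => by
        simp [doubleStrip, Real.pi_pos]
    · exact differentiable_prefK.continuous.comp Complex.continuous_ofReal
    · exact continuous_finsetSum _ fun n _ => Continuous.div (by fun_prop) (by fun_prop)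
        fun ξ => pow_ne_zero _ (Complex.exp_ne_zero _)
  unfold frozenPart
  have h3 : Continuous fun ζ : ℂ => 1 / Complex.exp ζ ^ N :=
    Continuous.div (by fun_prop) (by fun_prop) fun ξ => pow_ne_zero _ (Complex.exp_ne_zero _)
  have h4 : Continuous fun ζ : ℂ => remK' M ζ.re ν := h2.comp Complex.continuous_re
  have h5 : Continuous fun ζ : ℂ => terminantL ((N : ℂ) - M) (ζ + Real.log 2) :=
    h1.comp (by fun_prop)
  fun_prop

theorem continuousOn_reexpK' {N M : ℕ} (hMN : M ≤ N) (ν : ℂ) :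
    ContinuousOn (fun ζ => reexpK' N M ζ ν) doubleStrip := by
  have h1 : Continuous fun ζ : ℂ => 1 / Complex.exp ζ ^ N :=
    Continuous.div (by fun_prop) (by fun_prop) fun ξ => pow_ne_zero _ (Complex.exp_ne_zero _)
  have h2 : ∀ m ∈ Finset.range M, Continuous fun ζ : ℂ =>
      terminantL ((N : ℂ) - m) (ζ + Real.log 2) := fun m hm => by
    have hm' := (Finset.mem_range.1 hm).trans_le hMN
    refine (continuous_terminantL ?_).comp (by fun_prop)
    rw [← Nat.cast_sub hm'.le, Complex.natCast_re]
    exact_mod_cast Nat.sub_pos_of_lt hm'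
  unfold reexpK' remK'
  refine ContinuousOn.sub (ContinuousOn.sub (ContinuousOn.div (continuousOn_besselK' ν).neg
    differentiable_prefK.continuous.continuousOn fun ζ _ => prefK_ne_zero ζ) ?_) ?_
  · exact (continuous_finsetSum _ fun n _ => Continuous.div (by fun_prop) (by fun_prop)
        fun ξ => pow_ne_zero _ (Complex.exp_ne_zero _)).continuousOn
  · exact ((continuous_const.mul h1).mul (continuous_finsetSum _ fun m hm =>
      continuous_const.mul (h2 m hm))).continuousOn

/-- The freezing estimate on the closed sector `|arg z| ≤ π`, by continuity. -/
theorem norm_reexpK'_sub_le {N M : ℕ} (hM : M ≠ 0) (hMN : M < N) {ν : ℂ}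
    (h : |ν.re| < M - 1 / 2) {ζ : ℂ} (hζ : |ζ.im| ≤ Real.pi) :
    ‖reexpK' N M ζ ν - frozenPart N M ζ ν‖ ≤ freezingBound N M ζ ν := by
  have hpi := Real.pi_pos
  -- approach `ζ` from inside the strip, keeping `|z|` fixed, so that the bound is constant
  have hc : Tendsto (fun t : ℝ => (ζ.re : ℂ) + (t * ζ.im : ℝ) * Complex.I) (𝓝[<] 1) (𝓝 ζ) := by
    have : Continuous fun t : ℝ => (ζ.re : ℂ) + (t * ζ.im : ℝ) * Complex.I := by fun_prop
    have h1 := this.tendsto 1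
    rw [one_mul, Complex.re_add_im] at h1
    exact h1.mono_left nhdsWithin_le_nhds
  have hcont : ContinuousAt (fun ζ => ‖reexpK' N M ζ ν - frozenPart N M ζ ν‖) ζ :=
    (((continuousOn_reexpK' hMN.le ν).continuousAt (isOpen_doubleStrip.mem_nhds
      (lt_of_le_of_lt hζ (by linarith)))).sub (continuous_frozenPart hMN ν).continuousAt).norm
  refine le_of_tendsto (hcont.tendsto.comp hc) ?_
  filter_upwards [Ioo_mem_nhdsLT (show (0 : ℝ) < 1 by norm_num)] with t ht
  have hm : (ζ.re : ℂ) + (t * ζ.im : ℝ) * Complex.I ∈ openStrip := by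
    change |((ζ.re : ℂ) + (t * ζ.im : ℝ) * Complex.I).im| < Real.pi
    rw [Complex.add_im, Complex.ofReal_im, zero_add, Complex.mul_I_im, Complex.ofReal_re, abs_mul,
      abs_of_pos ht.1]
    nlinarith [ht.1, ht.2, abs_nonneg ζ.im]
  refine (norm_reexpK'_sub_le_of_mem hM hMN h hm).trans_eq ?_
  simp only [freezingBound, Complex.norm_exp]
  simp

theorem norm_Gamma_natCast_sub {N M : ℕ} (hMN : M < N) :
    ‖Complex.Gamma ((N : ℂ) - M)‖ = Real.Gamma ((N : ℝ) - M) := by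
  have h0 : (0 : ℝ) < (N : ℝ) - M := sub_pos.2 (by exact_mod_cast hMN)
  rw [show (N : ℂ) - M = ((N - M : ℝ) : ℂ) by push_cast; rfl, Complex.Gamma_ofReal,
    Complex.norm_real, Real.norm_of_nonneg (Real.Gamma_pos_of_pos h0).le]

theorem norm_frozenPart {N M : ℕ} (hMN : M < N) (ζ ν : ℂ) : ‖frozenPart N M ζ ν‖ =
    ‖Complex.cos (Real.pi * ν)‖ / (2 ^ N * Real.pi) * (1 / ‖Complex.exp ζ‖ ^ N) *
      2 ^ M * ‖Complex.exp ζ‖ ^ M * ‖remK' M (ζ.re : ℂ) ν‖ * Real.Gamma ((N : ℝ) - M) *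
        ‖terminantL ((N : ℂ) - M) (ζ + Real.log 2)‖ := by
  have hE : ‖Complex.exp (ζ.re : ℂ)‖ = ‖Complex.exp ζ‖ := by
    rw [Complex.norm_exp, Complex.norm_exp, Complex.ofReal_re]
  simp only [frozenPart, norm_mul, norm_div, norm_pow, norm_neg, norm_one, one_pow, one_mul,
    norm_Gamma_natCast_sub hMN, hE, Complex.norm_ofNat, Complex.norm_real,
    Real.norm_of_nonneg Real.pi_pos.le]
  ring

/-! ### The passage from `K'_ν` to `J'_ν` and `Y'_ν` -/

theorem exp_pi_div_two_mul_I : Complex.exp (Real.pi / 2 * Complex.I) = Complex.I := by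
  rw [Complex.exp_mul_I, Complex.cos_pi_div_two, Complex.sin_pi_div_two, zero_add, one_mul]

theorem exp_add_pi_div_two_mul_I (ζ : ℂ) :
    Complex.exp (ζ + Real.pi / 2 * Complex.I) = Complex.I * Complex.exp ζ := by
  rw [Complex.exp_add, exp_pi_div_two_mul_I, mul_comm]

theorem exp_sub_pi_div_two_mul_I (ζ : ℂ) :
    Complex.exp (ζ - Real.pi / 2 * Complex.I) = -Complex.I * Complex.exp ζ := by
  rw [Complex.exp_sub, exp_pi_div_two_mul_I, div_eq_mul_inv, Complex.inv_I, mul_comm]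

theorem besselI_add_pi_div_two_mul_I (μ ζ : ℂ) : besselI μ (ζ + Real.pi / 2 * Complex.I) =
    Complex.exp (Real.pi / 2 * Complex.I * μ) * besselJ μ ζ := by
  rw [besselI_eq, besselJ_eq, show 2 * (ζ + Real.pi / 2 * Complex.I - Real.log 2) =
    2 * (ζ - Real.log 2) + Real.pi * Complex.I by ring, Complex.exp_add _ (Real.pi * Complex.I),
    Complex.exp_pi_mul_I, mul_neg_one, ← mul_assoc, ← Complex.exp_add]
  congr 2
  ring

theorem besselI_sub_pi_div_two_mul_I (μ ζ : ℂ) : besselI μ (ζ - Real.pi / 2 * Complex.I) =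
    Complex.exp (-(Real.pi / 2 * Complex.I * μ)) * besselJ μ ζ := by
  rw [besselI_eq, besselJ_eq, show 2 * (ζ - Real.pi / 2 * Complex.I - Real.log 2) =
    2 * (ζ - Real.log 2) - Real.pi * Complex.I by ring, Complex.exp_sub _ (Real.pi * Complex.I),
    Complex.exp_pi_mul_I, div_neg, div_one, ← mul_assoc, ← Complex.exp_add]
  congr 2
  ring

theorem continuous_besselJ_order (ζ : ℂ) : Continuous fun μ => besselJ μ ζ := by
  simp_rw [besselJ_eq]
  exact (by fun_prop : Continuous fun μ : ℂ => Complex.exp (μ * (ζ - Real.log 2))).mul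
    (continuous_besselSeries_order _)

/-- The quotient `(J_μ cos(πμ) - J_{-μ}) / sin(πμ)`, which is `Y_μ` off the integers. -/
def besselYQuot (μ ζ : ℂ) : ℂ :=
  (besselJ μ ζ * Complex.cos (Real.pi * μ) - besselJ (-μ) ζ) / Complex.sin (Real.pi * μ)

theorem exp_pi_div_two_sq (μ : ℂ) : Complex.exp (Real.pi / 2 * Complex.I * μ) ^ 2 =
    Complex.cos (Real.pi * μ) + Complex.sin (Real.pi * μ) * Complex.I := by
  rw [← Complex.exp_mul_I, ← Complex.exp_nat_mul]
  congr 1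
  push_cast
  ring

theorem exp_neg_pi_div_two_sq (μ : ℂ) : Complex.exp (-(Real.pi / 2 * Complex.I * μ)) ^ 2 =
    Complex.cos (Real.pi * μ) - Complex.sin (Real.pi * μ) * Complex.I := by
  have h := Complex.exp_mul_I (-(Real.pi * μ))
  rw [Complex.cos_neg, Complex.sin_neg, neg_mul (Complex.sin _), ← sub_eq_add_neg] at h
  rw [← h, ← Complex.exp_nat_mul]
  congr 1
  push_cast
  ring

theorem exp_mul_exp_neg (w : ℂ) : Complex.exp w * Complex.exp (-w) = 1 := by
  rw [← Complex.exp_add, add_neg_cancel, Complex.exp_zero]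

/-- The connection formula `e^{πiμ/2} K_μ(iz) = -(π/2) (Y_μ(z) + i J_μ(z))`. -/
theorem besselKQuot_add_pi_div_two {μ : ℂ} (hμ : Complex.sin (Real.pi * μ) ≠ 0) (ζ : ℂ) :
    Complex.exp (Real.pi / 2 * Complex.I * μ) * besselKQuot μ (ζ + Real.pi / 2 * Complex.I) =
      -(Real.pi / 2) * (besselYQuot μ ζ + Complex.I * besselJ μ ζ) := by
  have h2 := exp_pi_div_two_sq μ
  have h3 := exp_mul_exp_neg (Real.pi / 2 * Complex.I * μ)
  unfold besselKQuot besselYQuot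
  rw [besselI_add_pi_div_two_mul_I, besselI_add_pi_div_two_mul_I, mul_neg]
  generalize Complex.exp (Real.pi / 2 * Complex.I * μ) = e at *
  generalize Complex.exp (-(Real.pi / 2 * Complex.I * μ)) = e' at *
  field_simp
  linear_combination besselJ (-μ) ζ * h3 - besselJ μ ζ * h2

/-- The connection formula `e^{-πiμ/2} K_μ(-iz) = -(π/2) (Y_μ(z) - i J_μ(z))`. -/
theorem besselKQuot_sub_pi_div_two {μ : ℂ} (hμ : Complex.sin (Real.pi * μ) ≠ 0) (ζ : ℂ) :
    Complex.exp (-(Real.pi / 2 * Complex.I * μ)) *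
        besselKQuot μ (ζ - Real.pi / 2 * Complex.I) =
      -(Real.pi / 2) * (besselYQuot μ ζ - Complex.I * besselJ μ ζ) := by
  have h2 := exp_neg_pi_div_two_sq μ
  have h3 := exp_mul_exp_neg (Real.pi / 2 * Complex.I * μ)
  unfold besselKQuot besselYQuot
  rw [besselI_sub_pi_div_two_mul_I, besselI_sub_pi_div_two_mul_I, mul_neg, neg_neg]
  generalize Complex.exp (Real.pi / 2 * Complex.I * μ) = e at *
  generalize Complex.exp (-(Real.pi / 2 * Complex.I * μ)) = e' at *
  field_simp
  linear_combination besselJ (-μ) ζ * h3 - besselJ μ ζ * h2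

/-- The strip `|arg z| < 3π/2`, on which `z e^{± iπ/2}` stays in the strip where `K_ν` is known. -/
def middleStrip : Set ℂ := {ζ : ℂ | |ζ.im| < 3 * Real.pi / 2}

theorem isOpen_middleStrip : IsOpen middleStrip := isOpen_lt (by fun_prop) continuous_const

theorem add_pi_div_two_im (ζ : ℂ) : (ζ + Real.pi / 2 * Complex.I).im = ζ.im + Real.pi / 2 := by
  rw [show (Real.pi : ℂ) / 2 = ((Real.pi / 2 : ℝ) : ℂ) by push_cast; rfl, Complex.add_im,
    Complex.mul_I_im, Complex.ofReal_re]

theorem sub_pi_div_two_im (ζ : ℂ) : (ζ - Real.pi / 2 * Complex.I).im = ζ.im - Real.pi / 2 := by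
  rw [show (Real.pi : ℂ) / 2 = ((Real.pi / 2 : ℝ) : ℂ) by push_cast; rfl, Complex.sub_im,
    Complex.mul_I_im, Complex.ofReal_re]

theorem add_pi_div_two_re (ζ : ℂ) : (ζ + Real.pi / 2 * Complex.I).re = ζ.re := by
  rw [show (Real.pi : ℂ) / 2 = ((Real.pi / 2 : ℝ) : ℂ) by push_cast; rfl, Complex.add_re,
    Complex.mul_I_re, Complex.ofReal_im, neg_zero, add_zero]

theorem sub_pi_div_two_re (ζ : ℂ) : (ζ - Real.pi / 2 * Complex.I).re = ζ.re := by
  rw [show (Real.pi : ℂ) / 2 = ((Real.pi / 2 : ℝ) : ℂ) by push_cast; rfl, Complex.sub_re,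
    Complex.mul_I_re, Complex.ofReal_im, neg_zero, sub_zero]

theorem add_pi_div_two_mem {ζ : ℂ} (hζ : ζ ∈ middleStrip) :
    ζ + Real.pi / 2 * Complex.I ∈ doubleStrip := by
  have := abs_lt.1 (show |ζ.im| < 3 * Real.pi / 2 from hζ)
  change |(ζ + Real.pi / 2 * Complex.I).im| < _
  rw [add_pi_div_two_im, abs_lt]
  constructor <;> linarith

theorem sub_pi_div_two_mem {ζ : ℂ} (hζ : ζ ∈ middleStrip) :
    ζ - Real.pi / 2 * Complex.I ∈ doubleStrip := by
  have := abs_lt.1 (show |ζ.im| < 3 * Real.pi / 2 from hζ)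
  change |(ζ - Real.pi / 2 * Complex.I).im| < _
  rw [sub_pi_div_two_im, abs_lt]
  constructor <;> linarith

/-- Combinations of `K_μ(z e^{∓iπ/2})` as they occur in the connection formulas are continuous in
the order, which gives the formulas at integer orders. -/
theorem tendsto_connection {ζ : ℂ} (hζ : ζ ∈ middleStrip) (ν : ℂ) (c₁ c₂ : ℂ) :
    Tendsto (fun μ => c₁ * (Complex.exp (-(Real.pi / 2 * Complex.I * μ)) *
        besselKQuot μ (ζ - Real.pi / 2 * Complex.I)) + c₂ *
        (Complex.exp (Real.pi / 2 * Complex.I * μ) *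
          besselKQuot μ (ζ + Real.pi / 2 * Complex.I))) (𝓝[≠] ν)
      (𝓝 (c₁ * (Complex.exp (-(Real.pi / 2 * Complex.I * ν)) *
        besselK ν (ζ - Real.pi / 2 * Complex.I)) + c₂ *
        (Complex.exp (Real.pi / 2 * Complex.I * ν) *
          besselK ν (ζ + Real.pi / 2 * Complex.I)))) := by
  have h1 : Tendsto (fun μ : ℂ => Complex.exp (Real.pi / 2 * Complex.I * μ)) (𝓝[≠] ν)
      (𝓝 (Complex.exp (Real.pi / 2 * Complex.I * ν))) :=
    ((by fun_prop : Continuous fun μ : ℂ => Complex.exp (Real.pi / 2 * Complex.I * μ)).tendsto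
      ν).mono_left nhdsWithin_le_nhds
  have h2 : Tendsto (fun μ : ℂ => Complex.exp (-(Real.pi / 2 * Complex.I * μ))) (𝓝[≠] ν)
      (𝓝 (Complex.exp (-(Real.pi / 2 * Complex.I * ν)))) :=
    ((by fun_prop : Continuous fun μ : ℂ => Complex.exp (-(Real.pi / 2 * Complex.I * μ))).tendsto
      ν).mono_left nhdsWithin_le_nhds
  exact ((h2.mul (tendsto_besselKQuot (sub_pi_div_two_mem hζ) ν)).const_mul c₁).add
    ((h1.mul (tendsto_besselKQuot (add_pi_div_two_mem hζ) ν)).const_mul c₂)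

/-- `J_ν` as a combination of `K_ν(z e^{± iπ/2})`. -/
theorem besselJ_eq_besselK {ζ : ℂ} (hζ : ζ ∈ middleStrip) (ν : ℂ) : besselJ ν ζ =
    -(Complex.I / Real.pi) * (Complex.exp (-(Real.pi / 2 * Complex.I * ν)) *
        besselK ν (ζ - Real.pi / 2 * Complex.I)) +
      Complex.I / Real.pi * (Complex.exp (Real.pi / 2 * Complex.I * ν) *
        besselK ν (ζ + Real.pi / 2 * Complex.I)) := by
  refine tendsto_nhds_unique (((continuous_besselJ_order ζ).tendsto ν).mono_left
    nhdsWithin_le_nhds) ((tendsto_connection hζ ν _ _).congr' ?_)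
  filter_upwards [eventually_sin_ne_zero ν] with μ hμ
  rw [besselKQuot_add_pi_div_two hμ, besselKQuot_sub_pi_div_two hμ]
  have := pi_ne_zero_complex
  field_simp
  linear_combination -2 * besselJ μ ζ * Complex.I_sq

/-- `Y_ν` as a combination of `K_ν(z e^{± iπ/2})`. -/
theorem besselY_eq_besselK {ζ : ℂ} (hζ : ζ ∈ middleStrip) (ν : ℂ) : besselY ν ζ =
    -(1 / Real.pi) * (Complex.exp (-(Real.pi / 2 * Complex.I * ν)) *
        besselK ν (ζ - Real.pi / 2 * Complex.I)) +
      -(1 / Real.pi) * (Complex.exp (Real.pi / 2 * Complex.I * ν) *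
        besselK ν (ζ + Real.pi / 2 * Complex.I)) := by
  have hq : ∀ μ : ℂ, Complex.sin (Real.pi * μ) ≠ 0 → -(1 / Real.pi) *
      (Complex.exp (-(Real.pi / 2 * Complex.I * μ)) *
        besselKQuot μ (ζ - Real.pi / 2 * Complex.I)) +
      -(1 / Real.pi) * (Complex.exp (Real.pi / 2 * Complex.I * μ) *
        besselKQuot μ (ζ + Real.pi / 2 * Complex.I)) = besselYQuot μ ζ := by
    intro μ hμ
    rw [besselKQuot_add_pi_div_two hμ, besselKQuot_sub_pi_div_two hμ]
    have := pi_ne_zero_complex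
    field_simp
    ring
  by_cases hν : Complex.sin (Real.pi * ν) = 0
  · have h1 : besselY ν ζ = limUnder (𝓝[≠] ν) fun μ => besselYQuot μ ζ := by
      simp [besselY, besselYQuot, hν]
    rw [h1]
    refine Tendsto.limUnder_eq ((tendsto_connection hζ ν _ _).congr' ?_)
    filter_upwards [eventually_sin_ne_zero ν] with μ hμ using hq μ hμ
  · rw [besselK_of_ne hν, besselK_of_ne hν, hq ν hν]
    simp [besselY, besselYQuot, hν]

theorem zDeriv_besselK_add {ζ : ℂ} (ν : ℂ) :
    Complex.exp (-ζ) * deriv (besselK ν) (ζ + Real.pi / 2 * Complex.I) =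
      Complex.I * besselK' ν (ζ + Real.pi / 2 * Complex.I) := by
  rw [besselK', zDeriv, Complex.exp_neg (_ + _), exp_add_pi_div_two_mul_I, Complex.exp_neg, mul_inv]
  field_simp [Complex.I_ne_zero]

theorem zDeriv_besselK_sub {ζ : ℂ} (ν : ℂ) :
    Complex.exp (-ζ) * deriv (besselK ν) (ζ - Real.pi / 2 * Complex.I) =
      -Complex.I * besselK' ν (ζ - Real.pi / 2 * Complex.I) := by
  rw [besselK', zDeriv, Complex.exp_neg (_ - _), exp_sub_pi_div_two_mul_I, Complex.exp_neg, mul_inv]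
  field_simp [Complex.I_ne_zero]

/-- The derivative in `z` of a combination of `K_ν(z e^{∓iπ/2})`; the factors `±i` come from
`d(z e^{±iπ/2})/dz`. -/
theorem zDeriv_connection {ζ : ℂ} (hζ : ζ ∈ middleStrip) (ν : ℂ) {f : ℂ → ℂ} (c₁ c₂ : ℂ)
    (hf : ∀ ζ ∈ middleStrip, f ζ = c₁ * (Complex.exp (-(Real.pi / 2 * Complex.I * ν)) *
        besselK ν (ζ - Real.pi / 2 * Complex.I)) + c₂ *
        (Complex.exp (Real.pi / 2 * Complex.I * ν) *
          besselK ν (ζ + Real.pi / 2 * Complex.I))) :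
    zDeriv f ζ = Complex.I * (c₂ * (Complex.exp (Real.pi / 2 * Complex.I * ν) *
          besselK' ν (ζ + Real.pi / 2 * Complex.I)) -
        c₁ * (Complex.exp (-(Real.pi / 2 * Complex.I * ν)) *
        besselK' ν (ζ - Real.pi / 2 * Complex.I))) := by
  have hd : ∀ w ∈ doubleStrip, HasDerivAt (besselK ν) (deriv (besselK ν) w) w := fun w hw =>
    ((differentiableOn_besselK_doubleStrip ν).differentiableAt
      (isOpen_doubleStrip.mem_nhds hw)).hasDerivAt
  have h1 := (hd _ (sub_pi_div_two_mem hζ)).comp_sub_const ζ (Real.pi / 2 * Complex.I)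
  have h2 := (hd _ (add_pi_div_two_mem hζ)).comp_add_const ζ (Real.pi / 2 * Complex.I)
  have h3 := (((h1.const_mul (Complex.exp (-(Real.pi / 2 * Complex.I * ν)))).const_mul c₁).add
    ((h2.const_mul (Complex.exp (Real.pi / 2 * Complex.I * ν))).const_mul c₂))
  have h4 := h3.congr_of_eventuallyEq (f₁ := f)
    (by filter_upwards [isOpen_middleStrip.mem_nhds hζ] with w hw using hf w hw)
  rw [zDeriv, h4.deriv, mul_add, mul_left_comm, mul_left_comm (Complex.exp (-ζ)) (Complex.exp _),
    zDeriv_besselK_sub, mul_left_comm _ c₂, mul_left_comm (Complex.exp (-ζ)) (Complex.exp _),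
    zDeriv_besselK_add]
  ring

theorem prefJ_eq (ζ : ℂ) : prefJ ζ = 2 / Real.pi *
    ((Real.sqrt (Real.pi / 2) : ℂ) * Complex.exp (-ζ / 2)) := by
  have h : (Real.sqrt (2 / Real.pi) : ℂ) = 2 / Real.pi * (Real.sqrt (Real.pi / 2) : ℂ) := by
    have h1 : (Real.sqrt (Real.pi / 2) : ℂ) * (Real.sqrt (Real.pi / 2) : ℂ) = Real.pi / 2 := by
      rw [← Complex.ofReal_mul, Real.mul_self_sqrt (by positivity)]
      push_cast
      rfl
    refine mul_right_cancel₀ sqrt_pi_div_two_ne_zero ?_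
    rw [sqrt_two_div_pi_mul, mul_assoc, h1]
    have := pi_ne_zero_complex
    field_simp
  rw [prefJ, h, mul_assoc]

theorem prefJ_mul (ζ : ℂ) : Real.pi / 2 * prefJ ζ =
    (Real.sqrt (Real.pi / 2) : ℂ) * Complex.exp (-ζ / 2) := by
  have := pi_ne_zero_complex
  rw [prefJ_eq]
  field_simp

theorem neg_I_eq_exp : -Complex.I = Complex.exp (-(Real.pi / 2 * Complex.I)) := by
  rw [Complex.exp_neg, exp_pi_div_two_mul_I, Complex.inv_I]

theorem exp_mul_prefK_add (ν ζ : ℂ) : Complex.exp (Real.pi / 2 * Complex.I * ν) *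
    prefK (ζ + Real.pi / 2 * Complex.I) =
      -Complex.I * (Real.pi / 2 * prefJ ζ) * Complex.exp (-(phase ν ζ * Complex.I)) := by
  have h : Complex.exp (Real.pi / 2 * Complex.I * ν) *
      (Complex.exp (-(ζ + Real.pi / 2 * Complex.I) / 2) *
        Complex.exp (-(Complex.I * Complex.exp ζ))) =
      -Complex.I * (Complex.exp (-ζ / 2) * Complex.exp (-(phase ν ζ * Complex.I))) := by
    rw [neg_I_eq_exp, ← Complex.exp_add, ← Complex.exp_add, ← Complex.exp_add, ← Complex.exp_add,
      phase]
    congr 1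
    ring
  rw [prefK, prefJ_mul, exp_add_pi_div_two_mul_I]
  linear_combination (Real.sqrt (Real.pi / 2) : ℂ) * h

theorem exp_mul_prefK_sub (ν ζ : ℂ) : Complex.exp (-(Real.pi / 2 * Complex.I * ν)) *
    prefK (ζ - Real.pi / 2 * Complex.I) =
      Complex.I * (Real.pi / 2 * prefJ ζ) * Complex.exp (phase ν ζ * Complex.I) := by
  have h : Complex.exp (-(Real.pi / 2 * Complex.I * ν)) *
      (Complex.exp (-(ζ - Real.pi / 2 * Complex.I) / 2) *
        Complex.exp (-(-Complex.I * Complex.exp ζ))) =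
      Complex.exp (Real.pi / 2 * Complex.I) *
        (Complex.exp (-ζ / 2) * Complex.exp (phase ν ζ * Complex.I)) := by
    rw [← Complex.exp_add, ← Complex.exp_add, ← Complex.exp_add, ← Complex.exp_add, phase]
    congr 1
    ring
  rw [exp_pi_div_two_mul_I] at h
  rw [prefK, prefJ_mul, exp_sub_pi_div_two_mul_I]
  linear_combination (Real.sqrt (Real.pi / 2) : ℂ) * h

/-- The normalized function `-K'_ν(z) / ((π/(2z))^(1/2) e^(-z))`. -/
def besselKNormalized (ζ ν : ℂ) : ℂ := -besselK' ν ζ / prefK ζ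

theorem besselK'_eq_mul_normalized (ζ ν : ℂ) :
    besselK' ν ζ = -(prefK ζ * besselKNormalized ζ ν) := by
  rw [besselKNormalized, mul_div_cancel₀ _ (prefK_ne_zero ζ), neg_neg]

theorem besselJ'_eq {ζ : ℂ} (hζ : ζ ∈ middleStrip) (ν : ℂ) : besselJ' ν ζ =
    Complex.I * prefJ ζ / 2 *
      (Complex.exp (phase ν ζ * Complex.I) *
          besselKNormalized (ζ - Real.pi / 2 * Complex.I) ν -
        Complex.exp (-(phase ν ζ * Complex.I)) *
          besselKNormalized (ζ + Real.pi / 2 * Complex.I) ν) := by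
  have h1 := exp_mul_prefK_add ν ζ
  have h2 := exp_mul_prefK_sub ν ζ
  rw [besselJ', zDeriv_connection hζ ν _ _ fun w hw => besselJ_eq_besselK hw ν,
    besselK'_eq_mul_normalized, besselK'_eq_mul_normalized, mul_neg (Complex.exp _),
    ← mul_assoc (Complex.exp _), h1, mul_neg (Complex.exp _), ← mul_assoc (Complex.exp _), h2]
  generalize besselKNormalized (ζ - Real.pi / 2 * Complex.I) ν = A
  generalize besselKNormalized (ζ + Real.pi / 2 * Complex.I) ν = B
  generalize Complex.exp (phase ν ζ * Complex.I) = E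
  generalize Complex.exp (-(phase ν ζ * Complex.I)) = E'
  generalize prefJ ζ = p
  have := pi_ne_zero_complex
  field_simp
  linear_combination p * (E' * B - E * A) * Complex.I_sq

theorem besselY'_eq {ζ : ℂ} (hζ : ζ ∈ middleStrip) (ν : ℂ) : besselY' ν ζ =
    prefJ ζ / 2 *
      (Complex.exp (phase ν ζ * Complex.I) *
          besselKNormalized (ζ - Real.pi / 2 * Complex.I) ν +
        Complex.exp (-(phase ν ζ * Complex.I)) *
          besselKNormalized (ζ + Real.pi / 2 * Complex.I) ν) := by
  have h1 := exp_mul_prefK_add ν ζ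
  have h2 := exp_mul_prefK_sub ν ζ
  rw [besselY', zDeriv_connection hζ ν _ _ fun w hw => besselY_eq_besselK hw ν,
    besselK'_eq_mul_normalized, besselK'_eq_mul_normalized, mul_neg (Complex.exp _),
    ← mul_assoc (Complex.exp _), h1, mul_neg (Complex.exp _), ← mul_assoc (Complex.exp _), h2]
  generalize besselKNormalized (ζ - Real.pi / 2 * Complex.I) ν = A
  generalize besselKNormalized (ζ + Real.pi / 2 * Complex.I) ν = B
  generalize Complex.exp (phase ν ζ * Complex.I) = E
  generalize Complex.exp (-(phase ν ζ * Complex.I)) = E'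
  generalize prefJ ζ = p
  have := pi_ne_zero_complex
  field_simp
  linear_combination p * (-(E' * B) - E * A) * Complex.I_sq

theorem exp_phase_eq (w : ℂ) : Complex.sin w =
    (Complex.exp (-(w * Complex.I)) - Complex.exp (w * Complex.I)) * Complex.I / 2 ∧
    Complex.cos w = (Complex.exp (w * Complex.I) + Complex.exp (-(w * Complex.I))) / 2 := by
  rw [Complex.sin, Complex.cos, neg_mul]
  exact ⟨rfl, rfl⟩

theorem besselJ'_Y'_even {ζ : ℂ} (hζ : ζ ∈ middleStrip) (ν : ℂ) :
    (-besselJ' ν ζ * Complex.sin (phase ν ζ) + besselY' ν ζ * Complex.cos (phase ν ζ)) / prefJ ζ =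
      (besselKNormalized (ζ - Real.pi / 2 * Complex.I) ν +
        besselKNormalized (ζ + Real.pi / 2 * Complex.I) ν) / 2 := by
  obtain ⟨h1, h2⟩ := exp_phase_eq (phase ν ζ)
  have h3 := exp_mul_exp_neg (phase ν ζ * Complex.I)
  have h4 := prefJ_ne_zero ζ
  rw [besselJ'_eq hζ, besselY'_eq hζ, h1, h2]
  generalize besselKNormalized (ζ - Real.pi / 2 * Complex.I) ν = A
  generalize besselKNormalized (ζ + Real.pi / 2 * Complex.I) ν = B
  generalize Complex.exp (phase ν ζ * Complex.I) = E at *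
  generalize Complex.exp (-(phase ν ζ * Complex.I)) = E' at *
  field_simp
  linear_combination (2 * (A + B)) * h3 - (E * A - E' * B) * (E' - E) * Complex.I_sq

theorem besselJ'_Y'_odd {ζ : ℂ} (hζ : ζ ∈ middleStrip) (ν : ℂ) :
    (-besselJ' ν ζ * Complex.cos (phase ν ζ) - besselY' ν ζ * Complex.sin (phase ν ζ)) / prefJ ζ =
      -(Complex.I / 2) * (besselKNormalized (ζ - Real.pi / 2 * Complex.I) ν -
        besselKNormalized (ζ + Real.pi / 2 * Complex.I) ν) := by
  obtain ⟨h1, h2⟩ := exp_phase_eq (phase ν ζ)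
  have h3 := exp_mul_exp_neg (phase ν ζ * Complex.I)
  have h4 := prefJ_ne_zero ζ
  rw [besselJ'_eq hζ, besselY'_eq hζ, h1, h2]
  generalize besselKNormalized (ζ - Real.pi / 2 * Complex.I) ν = A
  generalize besselKNormalized (ζ + Real.pi / 2 * Complex.I) ν = B
  generalize Complex.exp (phase ν ζ * Complex.I) = E at *
  generalize Complex.exp (-(phase ν ζ * Complex.I)) = E' at *
  field_simp
  linear_combination (-2 * (A - B)) * h3

/-- The terms of the expansion of `K'_ν` at `z e^{∓iπ/2}` combine to the even terms of the
expansion for `J'_ν` and `Y'_ν`. -/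
theorem evenSum_eq (k : ℕ) (ζ ν : ℂ) : evenSum k ζ ν =
    (∑ n ∈ Finset.range (2 * k), bCoeff n ν / Complex.exp (ζ - Real.pi / 2 * Complex.I) ^ n +
      ∑ n ∈ Finset.range (2 * k), bCoeff n ν / Complex.exp (ζ + Real.pi / 2 * Complex.I) ^ n) /
        2 := by
  rw [exp_add_pi_div_two_mul_I, exp_sub_pi_div_two_mul_I]
  have hne := Complex.exp_ne_zero ζ
  induction k with
  | zero => simp [evenSum]
  | succ k ih =>
    rw [evenSum, Finset.sum_range_succ, ← evenSum, ih, show 2 * (k + 1) = 2 * k + 1 + 1 by ring,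
      Finset.sum_range_succ, Finset.sum_range_succ, Finset.sum_range_succ, Finset.sum_range_succ]
    have h1 : (-Complex.I * Complex.exp ζ) ^ (2 * k) = (-1) ^ k * Complex.exp ζ ^ (2 * k) := by
      rw [mul_pow, pow_mul (-Complex.I), neg_sq, Complex.I_sq]
    have h2 : (Complex.I * Complex.exp ζ) ^ (2 * k) = (-1) ^ k * Complex.exp ζ ^ (2 * k) := by
      rw [mul_pow, pow_mul Complex.I, Complex.I_sq]
    rw [pow_succ (-Complex.I * Complex.exp ζ), pow_succ (Complex.I * Complex.exp ζ), h1, h2]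
    have h3 : ((-1 : ℂ) ^ k) * (-1) ^ k = 1 := by rw [← mul_pow]; norm_num
    have h4 : ((-1 : ℂ) ^ k)⁻¹ = (-1) ^ k := inv_eq_of_mul_eq_one_left h3
    simp only [div_eq_mul_inv, mul_inv, h4, inv_neg]
    ring

/-- The odd analogue of `evenSum_eq`. -/
theorem oddSum_eq (k : ℕ) (ζ ν : ℂ) : oddSum k ζ ν = -(Complex.I / 2) *
    (∑ n ∈ Finset.range (2 * k + 1), bCoeff n ν / Complex.exp (ζ - Real.pi / 2 * Complex.I) ^ n -
      ∑ n ∈ Finset.range (2 * k + 1), bCoeff n ν /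
        Complex.exp (ζ + Real.pi / 2 * Complex.I) ^ n) := by
  rw [exp_add_pi_div_two_mul_I, exp_sub_pi_div_two_mul_I]
  have hne := Complex.exp_ne_zero ζ
  induction k with
  | zero => simp [oddSum]
  | succ k ih =>
    rw [oddSum, Finset.sum_range_succ, ← oddSum, ih,
      show 2 * (k + 1) + 1 = 2 * k + 1 + 1 + 1 by ring, Finset.sum_range_succ _ (2 * k + 1 + 1),
      Finset.sum_range_succ _ (2 * k + 1), Finset.sum_range_succ _ (2 * k + 1 + 1),
      Finset.sum_range_succ _ (2 * k + 1)]
    have h1 : (-Complex.I * Complex.exp ζ) ^ (2 * k) = (-1) ^ k * Complex.exp ζ ^ (2 * k) := by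
      rw [mul_pow, pow_mul (-Complex.I), neg_sq, Complex.I_sq]
    have h2 : (Complex.I * Complex.exp ζ) ^ (2 * k) = (-1) ^ k * Complex.exp ζ ^ (2 * k) := by
      rw [mul_pow, pow_mul Complex.I, Complex.I_sq]
    have h3 : ((-1 : ℂ) ^ k) * (-1) ^ k = 1 := by rw [← mul_pow]; norm_num
    have h4 : ((-1 : ℂ) ^ k)⁻¹ = (-1) ^ k := inv_eq_of_mul_eq_one_left h3
    simp only [pow_succ, h1, h2, div_eq_mul_inv, mul_inv, h4, inv_neg, Complex.inv_I]
    linear_combination ((-1) ^ k * bCoeff (2 * k + 1) ν * (Complex.exp ζ ^ (2 * k))⁻¹ *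
      (Complex.exp ζ)⁻¹) * Complex.I_sq

/-- The weights with which the expansions at `z e^{∓iπ/2}` enter those for `J'_ν` and `Y'_ν`:
half the powers of `∓i` that turn `(z e^{∓iπ/2})^{-N}` into `± z^{-N}`. -/
theorem exists_weights {N : ℕ} {ζ : ℂ} (hζ : ζ ∈ middleStrip) (ν : ℂ) : ∃ u v : ℂ,
    ‖u‖ = 1 / 2 ∧ ‖v‖ = 1 / 2 ∧
    remJ' N ζ ν = u * remK' N (ζ - Real.pi / 2 * Complex.I) ν +
      v * remK' N (ζ + Real.pi / 2 * Complex.I) ν ∧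
    u * ((-1) ^ (N + 1) * (1 / Complex.exp (ζ - Real.pi / 2 * Complex.I) ^ N)) =
      (-1) ^ (N / 2 + 1) * (1 / Complex.exp ζ ^ N) / 2 ∧
    v * ((-1) ^ (N + 1) * (1 / Complex.exp (ζ + Real.pi / 2 * Complex.I) ^ N)) =
      (-1) ^ (N / 2 + 1) * (1 / Complex.exp ζ ^ N) / 2 := by
  have hne := Complex.exp_ne_zero ζ
  have hr : ∀ w, remK' N w ν = besselKNormalized w ν -
      ∑ n ∈ Finset.range N, bCoeff n ν / Complex.exp w ^ n := fun w => rfl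
  rcases Nat.even_or_odd' N with ⟨k, rfl | rfl⟩
  · have hk : 2 * k / 2 = k := by omega
    refine ⟨1 / 2, 1 / 2, by norm_num, by norm_num, ?_, ?_, ?_⟩
    · rw [remJ', if_pos (even_two_mul k), besselJ'_Y'_even hζ, hk, evenSum_eq, hr, hr]
      ring
    · rw [exp_sub_pi_div_two_mul_I, hk, mul_pow, pow_mul (-Complex.I), neg_sq, Complex.I_sq,
        pow_succ, pow_mul (-1 : ℂ), neg_one_sq, one_pow, pow_succ]
      rcases neg_one_pow_eq_or ℂ k with h | h <;> rw [h] <;> field_simp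
    · rw [exp_add_pi_div_two_mul_I, hk, mul_pow, pow_mul Complex.I, Complex.I_sq,
        pow_succ, pow_mul (-1 : ℂ), neg_one_sq, one_pow, pow_succ]
      rcases neg_one_pow_eq_or ℂ k with h | h <;> rw [h] <;> field_simp
  · have hk : (2 * k + 1) / 2 = k := by omega
    have hodd : ¬ Even (2 * k + 1) := by simp
    refine ⟨Complex.I / 2, -(Complex.I / 2), by simp, by simp, ?_, ?_, ?_⟩
    · rw [remJ', if_neg hodd, besselJ'_Y'_odd hζ, hk, oddSum_eq, hr, hr]
      ring
    · rw [exp_sub_pi_div_two_mul_I, hk, mul_pow, pow_succ (-Complex.I), pow_mul (-Complex.I),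
        neg_sq, Complex.I_sq, show 2 * k + 1 + 1 = 2 * (k + 1) by ring, pow_mul (-1 : ℂ),
        neg_one_sq, one_pow, pow_succ _ k]
      rcases neg_one_pow_eq_or ℂ k with h | h <;> rw [h] <;> field_simp
    · rw [exp_add_pi_div_two_mul_I, hk, mul_pow, pow_succ Complex.I, pow_mul Complex.I,
        Complex.I_sq, show 2 * k + 1 + 1 = 2 * (k + 1) by ring, pow_mul (-1 : ℂ),
        neg_one_sq, one_pow, pow_succ _ k]
      rcases neg_one_pow_eq_or ℂ k with h | h <;> rw [h] <;> field_simp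

/-- The analogue of `frozenPart` for `J'_ν` and `Y'_ν`. -/
def frozenPartJ (N M : ℕ) (ζ ν : ℂ) : ℂ :=
  (-1) ^ (N / 2 + 1) * (Complex.cos (Real.pi * ν) / (2 ^ N * Real.pi)) * (1 / Complex.exp ζ ^ N) *
    (2 ^ M * Complex.exp ζ.re ^ M * remK' M ζ.re ν * Complex.Gamma ((N : ℂ) - M) *
      terminantP ((N : ℂ) - M) (ζ + Real.log 2))

/-- The freezing estimate for `J'_ν` and `Y'_ν`, as an average of those for `K'_ν` at
`z e^{±iπ/2}`. -/
theorem norm_reexpJ'_sub_le {N M : ℕ} (hM : M ≠ 0) (hMN : M < N) {ν : ℂ}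
    (h : |ν.re| < M - 1 / 2) {ζ : ℂ} (hζ : |ζ.im| ≤ Real.pi / 2) :
    ‖reexpJ' N M ζ ν - frozenPartJ N M ζ ν‖ ≤ freezingBound N M ζ ν := by
  have hpi := Real.pi_pos
  have hb := abs_le.1 hζ
  have hm : ζ ∈ middleStrip := lt_of_le_of_lt hζ (by linarith)
  obtain ⟨u, v, hu, hv, h1, h2, h3⟩ := exists_weights (N := N) hm ν
  have ha := norm_reexpK'_sub_le hM hMN h (ζ := ζ - Real.pi / 2 * Complex.I)
    (by rw [sub_pi_div_two_im, abs_le]; constructor <;> linarith)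
  have hb' := norm_reexpK'_sub_le hM hMN h (ζ := ζ + Real.pi / 2 * Complex.I)
    (by rw [add_pi_div_two_im, abs_le]; constructor <;> linarith)
  have hfa : freezingBound N M (ζ - Real.pi / 2 * Complex.I) ν = freezingBound N M ζ ν := by
    simp only [freezingBound, Complex.norm_exp, sub_pi_div_two_re]
  have hfb : freezingBound N M (ζ + Real.pi / 2 * Complex.I) ν = freezingBound N M ζ ν := by
    simp only [freezingBound, Complex.norm_exp, add_pi_div_two_re]
  rw [hfa] at ha
  rw [hfb] at hb'
  have hsum : ∑ m ∈ Finset.range M, 2 ^ m * bCoeff m ν * Complex.Gamma ((N : ℂ) - m) *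
      terminantP ((N : ℂ) - m) (ζ + Real.log 2) =
      (∑ m ∈ Finset.range M, 2 ^ m * bCoeff m ν * Complex.Gamma ((N : ℂ) - m) *
        terminantL ((N : ℂ) - m) (ζ - Real.pi / 2 * Complex.I + Real.log 2) +
      ∑ m ∈ Finset.range M, 2 ^ m * bCoeff m ν * Complex.Gamma ((N : ℂ) - m) *
        terminantL ((N : ℂ) - m) (ζ + Real.pi / 2 * Complex.I + Real.log 2)) / 2 := by
    rw [← Finset.sum_add_distrib, Finset.sum_div]
    refine Finset.sum_congr rfl fun m _ => ?_
    rw [terminantP, sub_add_eq_add_sub, add_right_comm ζ]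
    ring
  have key : reexpJ' N M ζ ν - frozenPartJ N M ζ ν =
      u * (reexpK' N M (ζ - Real.pi / 2 * Complex.I) ν -
        frozenPart N M (ζ - Real.pi / 2 * Complex.I) ν) +
      v * (reexpK' N M (ζ + Real.pi / 2 * Complex.I) ν -
        frozenPart N M (ζ + Real.pi / 2 * Complex.I) ν) := by
    rw [reexpJ', reexpK', reexpK', h1, hsum, frozenPartJ, frozenPart, frozenPart,
      add_pi_div_two_re, sub_pi_div_two_re, terminantP, ← sub_add_eq_add_sub ζ,
      add_right_comm ζ (Real.log 2 : ℂ)]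
    generalize ∑ m ∈ Finset.range M, 2 ^ m * bCoeff m ν * Complex.Gamma ((N : ℂ) - m) *
        terminantL ((N : ℂ) - m) (ζ - Real.pi / 2 * Complex.I + Real.log 2) = Sa
    generalize ∑ m ∈ Finset.range M, 2 ^ m * bCoeff m ν * Complex.Gamma ((N : ℂ) - m) *
        terminantL ((N : ℂ) - m) (ζ + Real.pi / 2 * Complex.I + Real.log 2) = Sb
    generalize terminantL ((N : ℂ) - M) (ζ - Real.pi / 2 * Complex.I + Real.log 2) = La
    generalize terminantL ((N : ℂ) - M) (ζ + Real.pi / 2 * Complex.I + Real.log 2) = Lb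
    generalize Complex.cos (Real.pi * ν) / (2 ^ N * Real.pi) = κ
    generalize 2 ^ M * Complex.exp ζ.re ^ M * remK' M ζ.re ν * Complex.Gamma ((N : ℂ) - M) = c
    linear_combination κ * (Sa + c * La) * h2 + κ * (Sb + c * Lb) * h3
  rw [key]
  refine (norm_add_le _ _).trans ?_
  rw [norm_mul, norm_mul, hu, hv]
  linarith

theorem norm_frozenPartJ {N M : ℕ} (hMN : M < N) (ζ ν : ℂ) : ‖frozenPartJ N M ζ ν‖ =
    ‖Complex.cos (Real.pi * ν)‖ / (2 ^ N * Real.pi) * (1 / ‖Complex.exp ζ‖ ^ N) *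
      2 ^ M * ‖Complex.exp ζ‖ ^ M * ‖remK' M (ζ.re : ℂ) ν‖ * Real.Gamma ((N : ℝ) - M) *
        ‖terminantP ((N : ℂ) - M) (ζ + Real.log 2)‖ := by
  have hE : ‖Complex.exp (ζ.re : ℂ)‖ = ‖Complex.exp ζ‖ := by
    rw [Complex.norm_exp, Complex.norm_exp, Complex.ofReal_re]
  simp only [frozenPartJ, norm_mul, norm_div, norm_pow, norm_neg, norm_one, one_pow, one_mul,
    norm_Gamma_natCast_sub hMN, hE, Complex.norm_ofNat, Complex.norm_real,
    Real.norm_of_nonneg Real.pi_pos.le]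
  ring

end BesselRemainder

end

theorem theorem11 (N M : ℕ) (hM : 0 < M) (hMN : M < N) (ν : ℂ)
    (hν : |ν.re| < (M : ℝ) - 1 / 2) :
    (∀ ζ : ℂ, |ζ.im| ≤ Real.pi →
      ‖BesselRemainder.reexpK' N M ζ ν‖ ≤
        ‖Complex.cos (Real.pi * ν)‖ / (2 ^ N * Real.pi) * (1 / ‖Complex.exp ζ‖ ^ N) *
            2 ^ M * ‖Complex.exp ζ‖ ^ M * ‖BesselRemainder.remK' M (ζ.re : ℂ) ν‖ *
            Real.Gamma ((N : ℝ) - M) *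
            ‖BesselRemainder.terminantL ((N : ℂ) - M) (ζ + Real.log 2)‖ +
          ‖Complex.cos (Real.pi * ν)‖ / (2 ^ N * Real.pi) * (1 / ‖Complex.exp ζ‖ ^ N) *
            2 ^ M * (‖Complex.cos (Real.pi * ν)‖ * BesselRemainder.bCosRatio M ν.re) *
            Real.Gamma ((N : ℝ) - M)) ∧
    (∀ ζ : ℂ, |ζ.im| ≤ Real.pi / 2 →
      ‖BesselRemainder.reexpJ' N M ζ ν‖ ≤
        ‖Complex.cos (Real.pi * ν)‖ / (2 ^ N * Real.pi) * (1 / ‖Complex.exp ζ‖ ^ N) *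
            2 ^ M * ‖Complex.exp ζ‖ ^ M * ‖BesselRemainder.remK' M (ζ.re : ℂ) ν‖ *
            Real.Gamma ((N : ℝ) - M) *
            ‖BesselRemainder.terminantP ((N : ℂ) - M) (ζ + Real.log 2)‖ +
          ‖Complex.cos (Real.pi * ν)‖ / (2 ^ N * Real.pi) * (1 / ‖Complex.exp ζ‖ ^ N) *
            2 ^ M * (‖Complex.cos (Real.pi * ν)‖ * BesselRemainder.bCosRatio M ν.re) *
            Real.Gamma ((N : ℝ) - M)) := by
  refine ⟨fun ζ hζ => ?_, fun ζ hζ => ?_⟩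
  · rw [← BesselRemainder.norm_frozenPart hMN]
    have h1 := BesselRemainder.norm_reexpK'_sub_le hM.ne' hMN hν hζ
    have h2 := norm_le_norm_add_norm_sub' (BesselRemainder.reexpK' N M ζ ν)
      (BesselRemainder.frozenPart N M ζ ν)
    exact h2.trans (add_le_add le_rfl h1)
  · rw [← BesselRemainder.norm_frozenPartJ hMN]
    have h1 := BesselRemainder.norm_reexpJ'_sub_le hM.ne' hMN hν hζ
    have h2 := norm_le_norm_add_norm_sub' (BesselRemainder.reexpJ' N M ζ ν)
      (BesselRemainder.frozenPartJ N M ζ ν)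
    exact h2.trans (add_le_add le_rfl h1)
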